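/- **Setting.** Let $d,m\ge 0$ be integers, $h_0>0$, and let $\Lambda_1\subset\mathbb R^d$ be a finite set with $0\notin\Lambda_1$. Let $q_\lambda\ge0$, $p_\lambda$ ($\lambda\in\Lambda_1$), $c$ and $f$ be real functions on $\mathbb R^d$. For $h\in(0,h_0]$ and $\lambda\in\Lambda_1$ put $\delta_{h,\lambda}\varphi(x)=h^{-1}(\varphi(x+h\lambda)-\varphi(x))$, $\chi_{h,\lambda}=q_\lambda+hp_\lambda$, $$L_h\varphi=\frac1h\sum_{\lambda\in\Lambda_1}q_\lambda\delta_{h,\lambda}\varphi+\sum_{\lambda\in\Lambda_1}p_\lambda\delta_{h,\lambda}\varphi-c\varphi,\qquad \mathcal L\varphi=\frac12\sum_{\lambda\in\Lambda_1}\sum_{i,j=1}^d q_\lambda\lambda_i\lambda_jD_iD_j\varphi+\sum_{\lambda\in\Lambda_1}\sum_{i=1}^d p_\lambda\lambda_iD_i\varphi-c\varphi .$$ $\mathfrak B^m$ is the set of bounded continuous $\psi$ on $\mathbb R^d$ whose generalized derivatives $D^\alpha\psi$, $|\alpha|\le m$, are bounded; $\|\psi\|_m^2=\sup_{\mathbb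 R^d}\sum_{|\alpha|\le m}|D^\alpha\psi|^2$ (essential supremum), and $|D^k\psi|^2=\sum_{|\alpha|=k}|D^\alpha\psi|^2$. A solution of $\mathcal Lv+f=0$ is a $v\in\mathfrak B^2$ satisfying the equation almost everywhere. Fix $\tau_0>0$ and $\tau_\lambda\ge0$ ($\lambda\in\Lambda_1$), and set $|\Lambda_1|^2=\sum_{\lambda\in\Lambda_1}|\lambda|^2$, $\|\Lambda_1\|^2=\sum_{\lambda\in\Lambda_1}|\tau_\lambda\lambda|^2$. Let $\Lambda=\Lambda_1\sqcup\{\ell^1,\dots,\ell^d\}$ with additional symbols $\ell^i$; put $T_{h,\lambda}\varphi(x)=\varphi(x+h\lambda)$, $\bar\delta_{h,\lambda}=\tau_\lambda h^{-1}(T_{h,\lambda}-1)$ for $\lambda\in\Lambda_1$, and $T_{h,\ell^i}=1$, $\bar\delta_{h,\ell^i}=\tau_0D_i$. For $\lambda=(\lambda^1,\lambda^2)\in\Lambda^2$ put $T_{h,\lambda}=T_{h,\lambda^1}T_{h,\lambda^2}$, $\bar\delta_{h,\lambda}=\bar\delta_{h,\lambda^1}\bar\delta_{h,\lambda^2}$.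 For $\mu\in\Lambda\cup\Lambda^2$ put $$Q_{h,\mu}\varphi=h^{-1}\sum_{\lambda\in\Lambda_1}(\bar\delta_{h,\mu}q_\lambda)\delta_{h,\lambda}\varphi,\quad L^0_{h,\mu}\varphi=Q_{h,\mu}\varphi+\sum_{\lambda\in\Lambda_1}(\bar\delta_{h,\mu}p_\lambda)\delta_{h,\lambda}\varphi,$$ $$A_h(\varphi)=2\sum_{\lambda\in\Lambda}(\bar\delta_{h,\lambda}\varphi)L^0_{h,\lambda}T_{h,\lambda}\varphi,\qquad \mathcal Q_h(\varphi)=\sum_{\lambda\in\Lambda_1}\chi_{h,\lambda}(\delta_{h,\lambda}\varphi)^2 .$$ $\mathfrak K$ is the set of bounded linear operators $\mathcal K$ on the space of bounded Borel functions on $\mathbb R^d$ that preserve nonnegativity and satisfy $\mathcal K1\le1$. Let $\delta\in(0,1]$, $K\in[1,\infty)$, $c_0>0$ and $M_0,\dots,M_m$ be constants. **Assumptions.** $m\ge3$ and: 1. $q_\lambda,p_\lambda,c,f\in\mathfrak B^m$ and $\sup_{\mathbb R^d}\big(\sum_{\lambda\in\Lambda_1}(|D^kq_\lambda|^2+|D^kp_\lambda|^2)+|D^kc|^2\big)\le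 M_k^2$ for $k=0,\dots,m$; 2. $\chi_{h,\lambda}\ge0$ for all $h\in(0,h_0]$, $\lambda\in\Lambda_1$; 3. $\sum_{\lambda\in\Lambda_1}\lambda q_\lambda(x)=0$ for all $x$; 4. $c\ge c_0$; 5. for every $h\in(0,h_0]$ there is $\mathcal K\in\mathfrak K$ such that, for all smooth $\varphi$ bounded together with all their derivatives, $$mA_h(\varphi)\le(1-\delta)\sum_{\lambda\in\Lambda}\mathcal Q_h(\bar\delta_{h,\lambda}\varphi)+K\mathcal Q_h(\varphi)+2(1-\delta)c\,\mathcal K\Big(\sum_{\lambda\in\Lambda}|\bar\delta_{h,\lambda}\varphi|^2\Big);$$ 6. for every $h\in(0,h_0]$ and $n=1,\dots,m$ there are $\mathcal K,\mathcal K'\in\mathfrak K$ (possibly equal) such that, for the same $\varphi$, $$n\sum_{\nu\in\Lambda}A_h(\bar\delta_{h,\nu}\varphi)+n(n-1)\sum_{\lambda\in\Lambda^2}(\bar\delta_{h,\lambda}\varphi)Q_{h,\lambda}T_{h,\lambda}\varphi\le(1-\delta)\sum_{\lambda\in\Lambda^2}\mathcal Q_h(\bar\delta_{h,\lambda}\varphi)+K\sum_{\lambda\in\Lambda}\mathcal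 Q_h(\bar\delta_{h,\lambda}\varphi)$$ $$\qquad+2(1-\delta)c\,\mathcal K\Big(\sum_{\lambda\in\Lambda^2}|\bar\delta_{h,\lambda}\varphi|^2\Big)+K\mathcal K'\Big(\sum_{\lambda\in\Lambda}|\bar\delta_{h,\lambda}\varphi|^2\Big).$$ Let $k,l\ge0$ be integers such that one of the following holds, where (S) means $\Lambda_1=-\Lambda_1$ and $q_\lambda=q_{-\lambda}$ for all $\lambda\in\Lambda_1$: (i) $m-l\ge3k+3$; (ii) $m-l\ge2k+3$ and (S); (iii) $k$ is odd, $m-l\ge2k+2$, (S) holds, and $p_{-\lambda}=-p_\lambda$ for all $\lambda\in\Lambda_1$. **Conclusion.** For each $h\in(0,h_0]$ the equation $L_hv_h+f=0$ on $\mathbb R^d$ has a unique bounded solution $v_h$, and $\mathcal Lv+f=0$ has a unique solution $v^{(0)}$ in $\mathfrak B^m$; the functions $v_h$ and $v^{(0)}$ are $l$ times continuously differentiable. Put $$\bar v_h=\sum_{j=0}^kb_jv_{2^{-j}h},\qquad(b_0,\dots,b_k)=(1,0,\dots,0)V^{-1},\quad V=(2^{-ij})_{0\le i,j\le k}.$$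 Then for every multi-index $\alpha$ with $|\alpha|\le l$ and every $h\in(0,h_0]$, $$\sup_{\mathbb R^d}|D^\alpha\bar v_h-D^\alpha v^{(0)}|\le N\|f\|_mh^{k+1}.$$ If (iii) holds, then the same bound holds, for the same $\alpha$ and $h$, with $\bar v_h$ replaced by $$\tilde v_h=\sum_{j=0}^{\tilde k}\tilde b_jv_{2^{-j}h},\qquad\tilde k=\tfrac{k-1}2,\quad(\tilde b_0,\dots,\tilde b_{\tilde k})=(1,0,\dots,0)\tilde V^{-1},\quad\tilde V=(4^{-ij})_{0\le i,j\le\tilde k}.$$ The constant $N$ depends only on $d,m,\delta,K,\tau_0,c_0,|\Lambda_1|,\|\Lambda_1\|,M_0,\dots,M_m$. -/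

import Mathlib

open MeasureTheory
open scoped ContDiff

namespace FDRichardson

noncomputable section

/-- The space `ℝ^d` with its Euclidean norm. -/
abbrev E (d : ℕ) : Type := EuclideanSpace ℝ (Fin d)

/-- The partial derivative `D_i φ`. -/
def pderiv {d : ℕ} (i : Fin d) (φ : E d → ℝ) : E d → ℝ :=
  fun x => fderiv ℝ φ x (EuclideanSpace.single i 1)

/-- The (classical) derivative `D^α φ = D_1^{α_1} ⋯ D_d^{α_d} φ` for a multi-index `α`. -/
def multiDeriv {d : ℕ} (α : Fin d → ℕ) (φ : E d → ℝ) : E d → ℝ :=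
  (List.finRange d).foldr (fun i ψ => (pderiv i)^[α i] ψ) φ

/-- The length `|α|` of a multi-index. -/
def len {d : ℕ} (α : Fin d → ℕ) : ℕ := ∑ i, α i

/-- `g` is the generalized derivative `D^α ψ`. -/
def IsWeakDeriv {d : ℕ} (α : Fin d → ℕ) (ψ g : E d → ℝ) : Prop :=
  LocallyIntegrable g volume ∧
    ∀ φ : E d → ℝ, ContDiff ℝ ∞ φ → HasCompactSupport φ →
      ∫ x, ψ x * multiDeriv α φ x = (-1 : ℝ) ^ len α * ∫ x, g x * φ x

open Classical in
/-- The generalized derivative `D^α ψ`, unique up to null sets when it exists as a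
locally integrable function (and `0` by convention otherwise). -/
def weakDeriv {d : ℕ} (α : Fin d → ℕ) (ψ : E d → ℝ) : E d → ℝ :=
  if h : ∃ g, IsWeakDeriv α ψ g then Classical.choose h else 0

/-- The class `𝔅^m`: bounded continuous functions on `ℝ^d` whose generalized derivatives of
order at most `m` are bounded functions. -/
def MemB {d : ℕ} (m : ℕ) (ψ : E d → ℝ) : Prop :=
  Continuous ψ ∧ (∃ C : ℝ, ∀ x, |ψ x| ≤ C) ∧
    ∀ α : Fin d → ℕ, len α ≤ m →
      ∃ g, IsWeakDeriv α ψ g ∧ ∃ C : ℝ, ∀ᵐ x ∂(volume : Measure (E d)), |g x| ≤ C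

/-- `|D^k ψ|^2 = ∑_{|α| = k} |D^α ψ|^2`, with generalized derivatives. -/
def gradSq {d : ℕ} (k : ℕ) (ψ : E d → ℝ) (x : E d) : ℝ :=
  ∑ α ∈ Finset.piAntidiag (Finset.univ : Finset (Fin d)) k, (weakDeriv α ψ x) ^ 2

/-- The norm `‖ψ‖_m`, where `‖ψ‖_m^2 = sup_x ∑_{|α| ≤ m} |D^α ψ(x)|^2`; as generalized
derivatives are defined almost everywhere, `sup` is the essential supremum. -/
def normB {d : ℕ} (m : ℕ) (ψ : E d → ℝ) : ℝ :=
  Real.sqrt (essSup (fun x => ∑ k ∈ Finset.range (m + 1), gradSq k ψ x) volume)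

/-- The coefficients of a (time-independent) difference scheme: the finite set `Λ₁` of directions,
the functions `q_λ`, `p_λ` (only their values for `λ ∈ Λ₁` matter) and `c`. -/
structure Coeffs (d : ℕ) where
  dirs : Finset (E d)
  q : E d → E d → ℝ
  p : E d → E d → ℝ
  c : E d → ℝ

/-- `δ_{h,λ} φ(x) = (φ(x + hλ) - φ(x)) / h`. -/
def diffQ {d : ℕ} (h : ℝ) (lam : E d) (φ : E d → ℝ) : E d → ℝ :=
  fun x => h⁻¹ * (φ (x + h • lam) - φ x)

/-- `χ_{h,λ} = q_λ + h p_λ`. -/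
def chi {d : ℕ} (S : Coeffs d) (h : ℝ) (lam x : E d) : ℝ := S.q lam x + h * S.p lam x

/-- The difference operator `L_h φ = h⁻¹ ∑ q_λ δ_{h,λ} φ + ∑ p_λ δ_{h,λ} φ - c φ`. -/
def opLh {d : ℕ} (S : Coeffs d) (h : ℝ) (φ : E d → ℝ) (x : E d) : ℝ :=
  h⁻¹ * ∑ lam ∈ S.dirs, S.q lam x * diffQ h lam φ x
    + ∑ lam ∈ S.dirs, S.p lam x * diffQ h lam φ x - S.c x * φ x

/-- The differential operator
`ℒ v = (1/2) ∑_λ ∑_{i,j} q_λ λ_i λ_j D_i D_j v + ∑_λ ∑_i p_λ λ_i D_i v - c v`,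
with generalized derivatives. -/
def opL {d : ℕ} (S : Coeffs d) (v : E d → ℝ) (x : E d) : ℝ :=
  (1 / 2 : ℝ) * ∑ lam ∈ S.dirs, ∑ i, ∑ j,
      S.q lam x * lam i * lam j * weakDeriv (Pi.single i 1 + Pi.single j 1) v x
    + ∑ lam ∈ S.dirs, ∑ i, S.p lam x * lam i * weakDeriv (Pi.single i 1) v x
    - S.c x * v x

/-- `v` is a bounded solution of the difference equation `L_h v + f = 0` on `ℝ^d`. -/
def IsDiffSol {d : ℕ} (S : Coeffs d) (f : E d → ℝ) (h : ℝ) (v : E d → ℝ) : Prop :=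
  (∃ C : ℝ, ∀ x, |v x| ≤ C) ∧ ∀ x, opLh S h v x + f x = 0

/-- `v` is a solution of `ℒ v + f = 0`: it belongs to `𝔅^2` and satisfies the equation
almost everywhere. -/
def IsEllipticSol {d : ℕ} (S : Coeffs d) (f : E d → ℝ) (v : E d → ℝ) : Prop :=
  MemB 2 v ∧ ∀ᵐ x ∂(volume : Measure (E d)), opL S v x + f x = 0

/-- `|Λ₁|`, where `|Λ₁|^2 = ∑_{λ ∈ Λ₁} |λ|^2`. -/
def dirsNorm {d : ℕ} (S : Coeffs d) : ℝ := Real.sqrt (∑ lam ∈ S.dirs, ‖lam‖ ^ 2)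

/-- `‖Λ₁‖`, where `‖Λ₁‖^2 = ∑_{λ ∈ Λ₁} |τ_λ λ|^2`. -/
def dirsWNorm {d : ℕ} (S : Coeffs d) (τ : E d → ℝ) : ℝ :=
  Real.sqrt (∑ lam ∈ S.dirs, ‖τ lam • lam‖ ^ 2)

/-- Regularity of the coefficients: `q_λ, p_λ, c ∈ 𝔅^m` and, for `k = 0, …, m`,
`sup (∑_λ (|D^k q_λ|^2 + |D^k p_λ|^2) + |D^k c|^2) ≤ M_k^2`. -/
def RegularCoeffs {d : ℕ} (S : Coeffs d) (m : ℕ) (M : Fin (m + 1) → ℝ) : Prop :=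
  (∀ lam ∈ S.dirs, MemB m (S.q lam) ∧ MemB m (S.p lam)) ∧ MemB m S.c ∧
    ∀ k : Fin (m + 1), ∀ᵐ x ∂(volume : Measure (E d)),
      ∑ lam ∈ S.dirs, (gradSq k (S.q lam) x + gradSq k (S.p lam) x) + gradSq k S.c x
        ≤ M k ^ 2

/-- The index set `Λ = Λ₁ ∪ Λ₂`: `Sum.inl λ` stands for `λ ∈ Λ₁`, and `Sum.inr i` for the
additional symbol `ℓ^i`, which labels the coordinate derivative `D_i`. -/
def fullDirs {d : ℕ} (S : Coeffs d) : Finset (E d ⊕ Fin d) :=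
  S.dirs.disjSum Finset.univ

/-- The shifts: `T_{h,λ} φ(x) = φ(x + hλ)` for `λ ∈ Λ₁`, and `T_{h,ℓ^i}` is the identity. -/
def shift {d : ℕ} (h : ℝ) : E d ⊕ Fin d → (E d → ℝ) → (E d → ℝ)
  | Sum.inl lam, φ => fun x => φ (x + h • lam)
  | Sum.inr _, φ => φ

/-- `δ̄_{h,λ} = τ_λ h⁻¹ (T_{h,λ} - 1)` for `λ ∈ Λ₁`, and `δ̄_{h,ℓ^i} = τ₀ D_i`. -/
def dbar {d : ℕ} (τ : E d → ℝ) (τ₀ h : ℝ) : E d ⊕ Fin d → (E d → ℝ) → (E d → ℝ)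
  | Sum.inl lam, φ => fun x => τ lam * h⁻¹ * (φ (x + h • lam) - φ x)
  | Sum.inr i, φ => fun x => τ₀ * pderiv i φ x

/-- `T_{h,λ}` for a pair `λ ∈ Λ²`. -/
def shift2 {d : ℕ} (h : ℝ) (μ : (E d ⊕ Fin d) × (E d ⊕ Fin d)) (φ : E d → ℝ) : E d → ℝ :=
  shift h μ.1 (shift h μ.2 φ)

/-- `δ̄_{h,λ}` for a pair `λ ∈ Λ²`. -/
def dbar2 {d : ℕ} (τ : E d → ℝ) (τ₀ h : ℝ) (μ : (E d ⊕ Fin d) × (E d ⊕ Fin d))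
    (φ : E d → ℝ) : E d → ℝ :=
  dbar τ τ₀ h μ.1 (dbar τ τ₀ h μ.2 φ)

/-- `L^0_{h,λ} φ = h⁻¹ ∑_{ν ∈ Λ₁} (δ̄_{h,λ} q_ν) δ_{h,ν} φ + ∑_{ν ∈ Λ₁} (δ̄_{h,λ} p_ν) δ_{h,ν} φ`
for `λ ∈ Λ`. -/
def opL0 {d : ℕ} (S : Coeffs d) (τ : E d → ℝ) (τ₀ h : ℝ) (lam : E d ⊕ Fin d)
    (φ : E d → ℝ) (x : E d) : ℝ :=
  h⁻¹ * ∑ ν ∈ S.dirs, dbar τ τ₀ h lam (S.q ν) x * diffQ h ν φ x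
    + ∑ ν ∈ S.dirs, dbar τ τ₀ h lam (S.p ν) x * diffQ h ν φ x

/-- `Q_{h,λ} φ = h⁻¹ ∑_{ν ∈ Λ₁} (δ̄_{h,λ} q_ν) δ_{h,ν} φ` for `λ ∈ Λ²`. -/
def opQ2 {d : ℕ} (S : Coeffs d) (τ : E d → ℝ) (τ₀ h : ℝ)
    (μ : (E d ⊕ Fin d) × (E d ⊕ Fin d)) (φ : E d → ℝ) (x : E d) : ℝ :=
  h⁻¹ * ∑ ν ∈ S.dirs, dbar2 τ τ₀ h μ (S.q ν) x * diffQ h ν φ x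

/-- `A_h(φ) = 2 ∑_{λ ∈ Λ} (δ̄_{h,λ} φ) L^0_{h,λ} T_{h,λ} φ`. -/
def formA {d : ℕ} (S : Coeffs d) (τ : E d → ℝ) (τ₀ h : ℝ) (φ : E d → ℝ) (x : E d) : ℝ :=
  2 * ∑ lam ∈ fullDirs S,
    dbar τ τ₀ h lam φ x * opL0 S τ τ₀ h lam (shift h lam φ) x

/-- `𝒬_h(φ) = ∑_{λ ∈ Λ₁} χ_{h,λ} (δ_{h,λ} φ)^2`. -/
def formQ {d : ℕ} (S : Coeffs d) (h : ℝ) (φ : E d → ℝ) (x : E d) : ℝ :=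
  ∑ lam ∈ S.dirs, chi S h lam x * (diffQ h lam φ x) ^ 2

/-- `φ` is a bounded Borel function, `φ ∈ B(ℝ^d)`. -/
def BddBorel {d : ℕ} (φ : E d → ℝ) : Prop :=
  Measurable φ ∧ ∃ C : ℝ, ∀ x, |φ x| ≤ C

/-- The class `𝔎`: linear operators `𝒦` of `B(ℝ^d)` into itself which preserve nonnegativity and
satisfy `𝒦 1 ≤ 1` (hence are bounded, with norm at most `1`). The values of `𝒦` outside
`B(ℝ^d)` are irrelevant. -/
structure ClassK {d : ℕ} (𝒦 : (E d → ℝ) → (E d → ℝ)) : Prop where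
  map_bdd : ∀ φ, BddBorel φ → BddBorel (𝒦 φ)
  map_add : ∀ φ ψ, BddBorel φ → BddBorel ψ → 𝒦 (φ + ψ) = 𝒦 φ + 𝒦 ψ
  map_smul : ∀ (a : ℝ) (φ), BddBorel φ → 𝒦 (a • φ) = a • 𝒦 φ
  map_nonneg : ∀ φ, BddBorel φ → (∀ x, 0 ≤ φ x) → ∀ x, 0 ≤ 𝒦 φ x
  map_one_le : ∀ x, 𝒦 (fun _ => 1) x ≤ 1

/-- Test functions: smooth functions that are bounded together with all their derivatives. -/
def SmoothBdd {d : ℕ} (φ : E d → ℝ) : Prop :=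
  ContDiff ℝ ∞ φ ∧ ∀ n : ℕ, ∃ C : ℝ, ∀ x, ‖iteratedFDeriv ℝ n φ x‖ ≤ C

/-- The first-order structural condition: for every `h ∈ (0, h₀]` there is `𝒦 ∈ 𝔎` with
`m A_h(φ) ≤ (1-δ) ∑_{λ ∈ Λ} 𝒬_h(δ̄_{h,λ} φ) + K 𝒬_h(φ) + 2(1-δ) c 𝒦(∑_{λ ∈ Λ} |δ̄_{h,λ} φ|^2)`. -/
def StructCond1 {d : ℕ} (S : Coeffs d) (τ : E d → ℝ) (τ₀ h₀ δ K : ℝ) (m : ℕ) : Prop :=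
  ∀ h : ℝ, 0 < h → h ≤ h₀ → ∃ 𝒦 : (E d → ℝ) → (E d → ℝ), ClassK 𝒦 ∧
    ∀ φ : E d → ℝ, SmoothBdd φ → ∀ x,
      (m : ℝ) * formA S τ τ₀ h φ x
        ≤ (1 - δ) * ∑ lam ∈ fullDirs S, formQ S h (dbar τ τ₀ h lam φ) x
          + K * formQ S h φ x
          + 2 * (1 - δ) * S.c x *
              𝒦 (fun y => ∑ lam ∈ fullDirs S, |dbar τ τ₀ h lam φ y| ^ 2) x

/-- The second-order structural condition: for every `h ∈ (0, h₀]` and `n = 1, …, m` there are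
`𝒦, 𝒦' ∈ 𝔎` with
`n ∑_{ν ∈ Λ} A_h(δ̄_{h,ν} φ) + n(n-1) ∑_{λ ∈ Λ²} (δ̄_{h,λ} φ) Q_{h,λ} T_{h,λ} φ
  ≤ (1-δ) ∑_{λ ∈ Λ²} 𝒬_h(δ̄_{h,λ} φ) + K ∑_{λ ∈ Λ} 𝒬_h(δ̄_{h,λ} φ)
    + 2(1-δ) c 𝒦(∑_{λ ∈ Λ²} |δ̄_{h,λ} φ|^2) + K 𝒦'(∑_{λ ∈ Λ} |δ̄_{h,λ} φ|^2)`;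
the operators may coincide. -/
def StructCond2 {d : ℕ} (S : Coeffs d) (τ : E d → ℝ) (τ₀ h₀ δ K : ℝ) (m : ℕ) : Prop :=
  ∀ h : ℝ, 0 < h → h ≤ h₀ → ∀ n : ℕ, 1 ≤ n → n ≤ m →
    ∃ 𝒦 𝒦' : (E d → ℝ) → (E d → ℝ), ClassK 𝒦 ∧ ClassK 𝒦' ∧
      ∀ φ : E d → ℝ, SmoothBdd φ → ∀ x,
        (n : ℝ) * ∑ ν ∈ fullDirs S, formA S τ τ₀ h (dbar τ τ₀ h ν φ) x
          + (n : ℝ) * ((n : ℝ) - 1) * ∑ μ ∈ fullDirs S ×ˢ fullDirs S,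
              dbar2 τ τ₀ h μ φ x * opQ2 S τ τ₀ h μ (shift2 h μ φ) x
        ≤ (1 - δ) * ∑ μ ∈ fullDirs S ×ˢ fullDirs S, formQ S h (dbar2 τ τ₀ h μ φ) x
          + K * ∑ lam ∈ fullDirs S, formQ S h (dbar τ τ₀ h lam φ) x
          + 2 * (1 - δ) * S.c x *
              𝒦 (fun y => ∑ μ ∈ fullDirs S ×ˢ fullDirs S, |dbar2 τ τ₀ h μ φ y| ^ 2) x
          + K * 𝒦' (fun y => ∑ lam ∈ fullDirs S, |dbar τ τ₀ h lam φ y| ^ 2) x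

/-- The symmetry condition (S): `Λ₁ = -Λ₁` and `q_{-λ} = q_λ` for `λ ∈ Λ₁`. -/
def SymmCond {d : ℕ} (S : Coeffs d) : Prop :=
  ∀ lam ∈ S.dirs, -lam ∈ S.dirs ∧ ∀ x, S.q (-lam) x = S.q lam x

/-- The condition `p_{-λ} = -p_λ` for `λ ∈ Λ₁`. -/
def AntisymmCond {d : ℕ} (S : Coeffs d) : Prop :=
  ∀ lam ∈ S.dirs, ∀ x, S.p (-lam) x = -S.p lam x

/-- The Vandermonde matrix with entries `r^{i j}`, `i, j = 0, …, n`. -/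
def vand (r : ℝ) (n : ℕ) : Matrix (Fin (n + 1)) (Fin (n + 1)) ℝ :=
  Matrix.of fun i j => r ^ ((i : ℕ) * (j : ℕ))

/-- The weights `(1, 0, …, 0) V⁻¹`, where `V` is the matrix `vand r n`. -/
def weights (r : ℝ) (n : ℕ) : Fin (n + 1) → ℝ :=
  Matrix.vecMul (Pi.single 0 1) (vand r n)⁻¹

/-- `v̄_h = ∑_{j ≤ k} b_j v_{2^{-j} h}`, with weights `b` from the Vandermonde matrix
with entries `2^{-ij}`, `0 ≤ i, j ≤ k`. -/
def richardson {d : ℕ} (k : ℕ) (v : ℝ → E d → ℝ) (h : ℝ) : E d → ℝ :=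
  fun x => ∑ j : Fin (k + 1), weights (1 / 2) k j * v ((1 / 2 : ℝ) ^ (j : ℕ) * h) x

/-- `ṽ_h = ∑_{j ≤ k̃} b̃_j v_{2^{-j} h}` for odd `k`, where `k̃ = (k-1)/2` and the weights `b̃`
come from the Vandermonde matrix with entries `4^{-ij}`, `0 ≤ i, j ≤ k̃`. -/
def richardsonOdd {d : ℕ} (k : ℕ) (v : ℝ → E d → ℝ) (h : ℝ) : E d → ℝ :=
  fun x => ∑ j : Fin ((k - 1) / 2 + 1),
    weights (1 / 4) ((k - 1) / 2) j * v ((1 / 2 : ℝ) ^ (j : ℕ) * h) x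

end

end FDRichardson

open MeasureTheory
open scoped ContDiff

namespace FDRichardson

noncomputable section

variable {d : ℕ} {ι : Type*}

/-- Iterated partial derivatives along a word, the head of the word acting first. -/
def Dw : List (Fin d) → (E d → ℝ) → E d → ℝ
  | [], φ => φ
  | i :: w, φ => Dw w (pderiv i φ)

/-- Smooth functions all of whose partial derivatives are bounded. -/
def SB (φ : E d → ℝ) : Prop := ContDiff ℝ ∞ φ ∧ ∀ w, ∃ C, ∀ x, |Dw w φ x| ≤ C

/-- The partial derivatives up to order `n` are bounded by `C`. -/
def CB (n : ℕ) (C : ℝ) (φ : E d → ℝ) : Prop := ∀ w, w.length ≤ n → ∀ x, |Dw w φ x| ≤ C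

/-- The partial derivatives up to order `n` of a finite family have sums of squares bounded
by `B`. -/
def CBf (n : ℕ) (B : ℝ) (s : Finset ι) (φ : ι → E d → ℝ) : Prop :=
  ∀ w, w.length ≤ n → ∀ x, ∑ i ∈ s, (Dw w (φ i) x) ^ 2 ≤ B

@[simp] lemma Dw_nil (φ : E d → ℝ) : Dw [] φ = φ := rfl
@[simp] lemma Dw_cons (i : Fin d) (w) (φ : E d → ℝ) : Dw (i :: w) φ = Dw w (pderiv i φ) := rfl

lemma Dw_append (w w' : List (Fin d)) (φ : E d → ℝ) : Dw (w ++ w') φ = Dw w' (Dw w φ) := by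
  induction w generalizing φ with
  | nil => rfl
  | cons i w ih => simp [ih]

lemma contDiff_pderiv {φ : E d → ℝ} (hφ : ContDiff ℝ ∞ φ) (i : Fin d) :
    ContDiff ℝ ∞ (pderiv i φ) := by
  unfold pderiv
  exact ((contDiff_infty_iff_fderiv.1 hφ).2).clm_apply contDiff_const

lemma contDiff_Dw {φ : E d → ℝ} (hφ : ContDiff ℝ ∞ φ) (w : List (Fin d)) :
    ContDiff ℝ ∞ (Dw w φ) := by
  induction w generalizing φ with
  | nil => exact hφ
  | cons i w ih => exact ih (contDiff_pderiv hφ i)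

lemma differentiable_of_smooth {φ : E d → ℝ} (hφ : ContDiff ℝ ∞ φ) : Differentiable ℝ φ :=
  hφ.differentiable (by simp)

lemma pderiv_comm {φ : E d → ℝ} (hφ : ContDiff ℝ ∞ φ) (i j : Fin d) :
    pderiv i (pderiv j φ) = pderiv j (pderiv i φ) := by
  funext x
  have h2 : DifferentiableAt ℝ (fderiv ℝ φ) x :=
    ((contDiff_infty_iff_fderiv.1 hφ).2).differentiable (by simp) x
  have hs := second_derivative_symmetric (f := φ) (f' := fderiv ℝ φ) (x := x)
    (fun y => (differentiable_of_smooth hφ y).hasFDerivAt) h2.hasFDerivAt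
    (EuclideanSpace.single i 1) (EuclideanSpace.single j 1)
  have key : ∀ i j : Fin d, pderiv i (pderiv j φ) x
      = fderiv ℝ (fderiv ℝ φ) x (EuclideanSpace.single i 1) (EuclideanSpace.single j 1) := by
    intro i j
    have : HasFDerivAt (fun y => fderiv ℝ φ y (EuclideanSpace.single j (1 : ℝ)))
        ((ContinuousLinearMap.apply ℝ ℝ (EuclideanSpace.single j (1 : ℝ))).comp
          (fderiv ℝ (fderiv ℝ φ) x)) x :=
      (ContinuousLinearMap.apply ℝ ℝ (EuclideanSpace.single j (1 : ℝ))).hasFDerivAt.comp x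
        h2.hasFDerivAt
    have e : pderiv i (pderiv j φ) x = fderiv ℝ
        (fun y => fderiv ℝ φ y (EuclideanSpace.single j (1 : ℝ))) x
          (EuclideanSpace.single i 1) := rfl
    rw [e, this.fderiv]; rfl
  rw [key, key, hs]

lemma Dw_pderiv {φ : E d → ℝ} (hφ : ContDiff ℝ ∞ φ) (i : Fin d) (w : List (Fin d)) :
    Dw w (pderiv i φ) = pderiv i (Dw w φ) := by
  induction w generalizing φ with
  | nil => rfl
  | cons j w ih =>
    simp only [Dw_cons]
    rw [pderiv_comm hφ, ih (contDiff_pderiv hφ j)]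

lemma Dw_perm {w w' : List (Fin d)} (h : w.Perm w') {φ : E d → ℝ} (hφ : ContDiff ℝ ∞ φ) :
    Dw w φ = Dw w' φ := by
  induction h generalizing φ with
  | nil => rfl
  | cons i _ ih => exact ih (contDiff_pderiv hφ i)
  | swap i j w => simp only [Dw_cons]; rw [pderiv_comm hφ]
  | trans _ _ ih1 ih2 => rw [ih1 hφ, ih2 hφ]

section algebra
variable {φ ψ : E d → ℝ}

lemma pderiv_add (hφ : Differentiable ℝ φ) (hψ : Differentiable ℝ ψ) (i : Fin d) :
    pderiv i (fun x => φ x + ψ x) = fun x => pderiv i φ x + pderiv i ψ x := by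
  funext x; unfold pderiv
  rw [fderiv_fun_add (hφ x) (hψ x)]; rfl

lemma pderiv_sub (hφ : Differentiable ℝ φ) (hψ : Differentiable ℝ ψ) (i : Fin d) :
    pderiv i (fun x => φ x - ψ x) = fun x => pderiv i φ x - pderiv i ψ x := by
  funext x; unfold pderiv
  rw [fderiv_fun_sub (hφ x) (hψ x)]; rfl

lemma pderiv_mul (hφ : Differentiable ℝ φ) (hψ : Differentiable ℝ ψ) (i : Fin d) :
    pderiv i (fun x => φ x * ψ x) = fun x => pderiv i φ x * ψ x + φ x * pderiv i ψ x := by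
  funext x; unfold pderiv
  rw [fderiv_fun_mul (hφ x) (hψ x)]
  simp; ring

lemma pderiv_const_mul (hφ : Differentiable ℝ φ) (a : ℝ) (i : Fin d) :
    pderiv i (fun x => a * φ x) = fun x => a * pderiv i φ x := by
  funext x; unfold pderiv
  rw [((hφ x).hasFDerivAt.const_mul a).fderiv]; rfl

lemma pderiv_const (a : ℝ) (i : Fin d) : pderiv i (fun _ : E d => a) = fun _ => 0 := by
  funext x; unfold pderiv; simp

lemma pderiv_sum {s : Finset ι} {φ : ι → E d → ℝ} (hφ : ∀ k ∈ s, Differentiable ℝ (φ k))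
    (i : Fin d) : pderiv i (fun x => ∑ k ∈ s, φ k x) = fun x => ∑ k ∈ s, pderiv i (φ k) x := by
  funext x; unfold pderiv
  rw [(HasFDerivAt.fun_sum fun k hk => (hφ k hk x).hasFDerivAt).fderiv]
  simp

lemma pderiv_tr (φ : E d → ℝ) (y : E d) (i : Fin d) :
    pderiv i (fun x => φ (x + y)) = fun x => pderiv i φ (x + y) := by
  funext x; unfold pderiv
  rw [fderiv_comp_add_right]

lemma contDiff_tr (hφ : ContDiff ℝ ∞ φ) (y : E d) : ContDiff ℝ ∞ (fun x => φ (x + y)) := by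
  fun_prop

lemma Dw_add (hφ : ContDiff ℝ ∞ φ) (hψ : ContDiff ℝ ∞ ψ) (w : List (Fin d)) :
    Dw w (fun x => φ x + ψ x) = fun x => Dw w φ x + Dw w ψ x := by
  induction w generalizing φ ψ with
  | nil => rfl
  | cons i w ih =>
    simp only [Dw_cons]
    rw [pderiv_add (differentiable_of_smooth hφ) (differentiable_of_smooth hψ),
      ih (contDiff_pderiv hφ i) (contDiff_pderiv hψ i)]

lemma Dw_sub (hφ : ContDiff ℝ ∞ φ) (hψ : ContDiff ℝ ∞ ψ) (w : List (Fin d)) :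
    Dw w (fun x => φ x - ψ x) = fun x => Dw w φ x - Dw w ψ x := by
  induction w generalizing φ ψ with
  | nil => rfl
  | cons i w ih =>
    simp only [Dw_cons]
    rw [pderiv_sub (differentiable_of_smooth hφ) (differentiable_of_smooth hψ),
      ih (contDiff_pderiv hφ i) (contDiff_pderiv hψ i)]

lemma Dw_const_mul (hφ : ContDiff ℝ ∞ φ) (a : ℝ) (w : List (Fin d)) :
    Dw w (fun x => a * φ x) = fun x => a * Dw w φ x := by
  induction w generalizing φ with
  | nil => rfl
  | cons i w ih =>
    simp only [Dw_cons]
    rw [pderiv_const_mul (differentiable_of_smooth hφ), ih (contDiff_pderiv hφ i)]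

lemma Dw_zero (w : List (Fin d)) : Dw w (fun _ : E d => (0 : ℝ)) = fun _ => 0 := by
  induction w with
  | nil => rfl
  | cons i w ih => simp only [Dw_cons]; rw [pderiv_const, ih]

lemma Dw_sum {s : Finset ι} {φ : ι → E d → ℝ} (hφ : ∀ k ∈ s, ContDiff ℝ ∞ (φ k))
    (w : List (Fin d)) :
    Dw w (fun x => ∑ k ∈ s, φ k x) = fun x => ∑ k ∈ s, Dw w (φ k) x := by
  induction w generalizing φ with
  | nil => rfl
  | cons i w ih =>
    simp only [Dw_cons]
    rw [pderiv_sum (fun k hk => differentiable_of_smooth (hφ k hk)),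
      ih (fun k hk => contDiff_pderiv (hφ k hk) i)]

lemma Dw_tr (φ : E d → ℝ) (y : E d) (w : List (Fin d)) :
    Dw w (fun x => φ (x + y)) = fun x => Dw w φ (x + y) := by
  induction w generalizing φ with
  | nil => rfl
  | cons i w ih => simp only [Dw_cons]; rw [pderiv_tr, ih]

end algebra

section bounds
variable {φ ψ : E d → ℝ} {n k : ℕ} {C C' A B : ℝ} {s : Finset ι}

lemma CB.mono (h : CB n C φ) (hk : k ≤ n) (hC : C ≤ C') : CB k C' φ :=
  fun w hw x => (h w (hw.trans hk) x).trans hC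

lemma CB.nonneg (h : CB n C φ) : 0 ≤ C := (abs_nonneg _).trans (h [] (Nat.zero_le _) 0)

lemma CB.bound (h : CB n C φ) (x : E d) : |φ x| ≤ C := h [] (Nat.zero_le _) x

lemma CB.pd (h : CB (n + 1) C φ) (i : Fin d) : CB n C (pderiv i φ) :=
  fun w hw x => h (i :: w) (by simpa using hw) x

lemma CBf.mono {φ : ι → E d → ℝ} (h : CBf n B s φ) (hk : k ≤ n) (hB : B ≤ A) : CBf k A s φ :=
  fun w hw x => (h w (hw.trans hk) x).trans hB

lemma CBf.pd {φ : ι → E d → ℝ} (h : CBf (n + 1) B s φ) (i : Fin d) :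
    CBf n B s (fun k => pderiv i (φ k)) :=
  fun w hw x => h (i :: w) (by simpa using hw) x

lemma CBf.nonneg {φ : ι → E d → ℝ} (h : CBf n B s φ) : 0 ≤ B :=
  (Finset.sum_nonneg fun _ _ => sq_nonneg _).trans (h [] (Nat.zero_le _) 0)

lemma CB.toCBf (h : CB n C φ) : CBf n (C ^ 2) ({()} : Finset Unit) (fun _ => φ) := by
  intro w hw x
  rw [Finset.sum_singleton, sq_le_sq, abs_of_nonneg h.nonneg]
  exact h w hw x

lemma CB.add (h : CB n C φ) (h' : CB n C' ψ) (hφ : ContDiff ℝ ∞ φ) (hψ : ContDiff ℝ ∞ ψ) :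
    CB n (C + C') (fun x => φ x + ψ x) := by
  intro w hw x
  rw [Dw_add hφ hψ]
  exact (abs_add_le _ _).trans (add_le_add (h w hw x) (h' w hw x))

lemma CB.sub (h : CB n C φ) (h' : CB n C' ψ) (hφ : ContDiff ℝ ∞ φ) (hψ : ContDiff ℝ ∞ ψ) :
    CB n (C + C') (fun x => φ x - ψ x) := by
  intro w hw x
  rw [Dw_sub hφ hψ]
  exact (abs_sub _ _).trans (add_le_add (h w hw x) (h' w hw x))

lemma CB.const_mul (h : CB n C φ) (hφ : ContDiff ℝ ∞ φ) (a : ℝ) :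
    CB n (|a| * C) (fun x => a * φ x) := by
  intro w hw x
  rw [Dw_const_mul hφ, abs_mul]
  exact mul_le_mul_of_nonneg_left (h w hw x) (abs_nonneg _)

lemma CB.sum {φ : ι → E d → ℝ} {C : ι → ℝ} (h : ∀ k ∈ s, CB n (C k) (φ k))
    (hφ : ∀ k ∈ s, ContDiff ℝ ∞ (φ k)) : CB n (∑ k ∈ s, C k) (fun x => ∑ k ∈ s, φ k x) := by
  intro w hw x
  rw [Dw_sum hφ]
  exact (Finset.abs_sum_le_sum_abs _ _).trans (Finset.sum_le_sum fun k hk => h k hk w hw x)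

/-- Derivatives of a finite sum of products. -/
lemma CBf.sum_mul {a b : ι → E d → ℝ} (ha : CBf n A s a) (hb : CBf n B s b)
    (ha' : ∀ k ∈ s, ContDiff ℝ ∞ (a k)) (hb' : ∀ k ∈ s, ContDiff ℝ ∞ (b k)) :
    CB n (2 ^ n * (Real.sqrt A * Real.sqrt B)) (fun x => ∑ k ∈ s, a k x * b k x) := by
  have hbase : ∀ {n : ℕ} {a b : ι → E d → ℝ}, CBf n A s a → CBf n B s b →
      ∀ x, |∑ k ∈ s, a k x * b k x| ≤ Real.sqrt A * Real.sqrt B := by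
    intro n a b ha hb x
    rw [← Real.sqrt_mul ha.nonneg, ← Real.sqrt_sq_eq_abs]
    refine Real.sqrt_le_sqrt ((Finset.sum_mul_sq_le_sq_mul_sq _ _ _).trans ?_)
    exact mul_le_mul (ha [] (Nat.zero_le _) x) (hb [] (Nat.zero_le _) x)
      (Finset.sum_nonneg fun _ _ => sq_nonneg _) ha.nonneg
  induction n generalizing a b with
  | zero =>
    intro w hw x
    obtain rfl : w = [] := List.length_eq_zero_iff.1 (Nat.le_zero.1 hw)
    simpa using hbase ha hb x
  | succ n ih =>
    intro w hw x
    have h0 : 0 ≤ Real.sqrt A * Real.sqrt B := by positivity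
    have h1 : (1 : ℝ) ≤ 2 ^ n := one_le_pow₀ (by norm_num)
    cases w with
    | nil =>
      refine (hbase ha hb x).trans ?_
      rw [pow_succ]; nlinarith
    | cons i w =>
      have hw' : w.length ≤ n := by simpa using hw
      have e : pderiv i (fun x => ∑ k ∈ s, a k x * b k x)
          = fun x => (∑ k ∈ s, pderiv i (a k) x * b k x) + ∑ k ∈ s, a k x * pderiv i (b k) x := by
        rw [pderiv_sum (φ := fun k x => a k x * b k x)
          (fun k hk => (differentiable_of_smooth (ha' k hk)).fun_mul
            (differentiable_of_smooth (hb' k hk)))]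
        funext x
        rw [← Finset.sum_add_distrib]
        refine Finset.sum_congr rfl fun k hk => ?_
        rw [pderiv_mul (differentiable_of_smooth (ha' k hk)) (differentiable_of_smooth (hb' k hk))]
      rw [Dw_cons, e, Dw_add
        (ContDiff.sum fun k hk => (contDiff_pderiv (ha' k hk) i).mul (hb' k hk))
        (ContDiff.sum fun k hk => (ha' k hk).mul (contDiff_pderiv (hb' k hk) i))]
      have h2 := ih (ha.pd i) (hb.mono (Nat.le_succ n) le_rfl)
        (fun k hk => contDiff_pderiv (ha' k hk) i) hb' w hw' x
      have h3 := ih (ha.mono (Nat.le_succ n) le_rfl) (hb.pd i) ha'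
        (fun k hk => contDiff_pderiv (hb' k hk) i) w hw' x
      refine (abs_add_le _ _).trans ((add_le_add h2 h3).trans (le_of_eq ?_))
      ring

lemma CB.mul (ha : CB n A φ) (hb : CB n B ψ) (hφ : ContDiff ℝ ∞ φ) (hψ : ContDiff ℝ ∞ ψ) :
    CB n (2 ^ n * (A * B)) (fun x => φ x * ψ x) := by
  have := CBf.sum_mul ha.toCBf hb.toCBf (fun _ _ => hφ) (fun _ _ => hψ)
  simpa [Real.sqrt_sq ha.nonneg, Real.sqrt_sq hb.nonneg] using this

/-- The leading term in the derivative of a product. -/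
lemma Dw_mul_sub_leading (ha : CB (n + 1) A φ) (hb : CB n B ψ) (hφ : ContDiff ℝ ∞ φ)
    (hψ : ContDiff ℝ ∞ ψ) (w : List (Fin d)) (hw : w.length ≤ n + 1) (x : E d) :
    |Dw w (fun x => φ x * ψ x) x - φ x * Dw w ψ x| ≤ 2 ^ (n + 1) * (A * B) := by
  have hAB : 0 ≤ A * B := mul_nonneg ha.nonneg hb.nonneg
  cases w with
  | nil => simp only [Dw_nil, sub_self, abs_zero]; positivity
  | cons i w =>
  have hw' : w.length ≤ n := by simpa using hw
  have key : |Dw w (fun x => φ x * pderiv i ψ x) x - φ x * Dw w (pderiv i ψ) x|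
      ≤ 2 ^ n * (A * B) := by
    induction n generalizing φ ψ i w with
    | zero =>
      obtain rfl : w = [] := List.length_eq_zero_iff.1 (Nat.le_zero.1 hw')
      simpa using hAB
    | succ n ih =>
      cases w with
      | nil => simp only [Dw_nil, sub_self, abs_zero]; positivity
      | cons j w =>
        have hw2 : w.length ≤ n := by simpa using hw'
        have h1 := ih (ha.mono (Nat.le_succ _) le_rfl) (hb.pd i) hφ (contDiff_pderiv hψ i)
          j w (by simpa using hw2) hw2
        have h2 := ((ha.pd j).mono (Nat.le_succ n) le_rfl).mul (hb.pd i)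
          (contDiff_pderiv hφ j) (contDiff_pderiv hψ i) w hw2 x
        rw [Dw_cons, pderiv_mul (differentiable_of_smooth hφ)
          (differentiable_of_smooth (contDiff_pderiv hψ i)),
          Dw_add ((contDiff_pderiv hφ j).mul (contDiff_pderiv hψ i))
            (hφ.mul (contDiff_pderiv (contDiff_pderiv hψ i) j)), Dw_cons]
        rw [add_sub_assoc]
        refine (abs_add_le _ _).trans ((add_le_add h2 h1).trans (le_of_eq ?_))
        ring
  have h2 := (ha.pd i).mul hb (contDiff_pderiv hφ i) hψ w hw' x
  rw [Dw_cons, pderiv_mul (differentiable_of_smooth hφ) (differentiable_of_smooth hψ),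
    Dw_add ((contDiff_pderiv hφ i).mul hψ) (hφ.mul (contDiff_pderiv hψ i)), Dw_cons, add_sub_assoc]
  refine (abs_add_le _ _).trans ((add_le_add h2 key).trans (le_of_eq ?_))
  ring

end bounds

section SB
variable {φ ψ : E d → ℝ} {s : Finset ι}

/-- A smooth function has bounded derivatives iff it has bounds of each order. -/
lemma SB_iff : SB φ ↔ ContDiff ℝ ∞ φ ∧ ∀ n, ∃ C, CB n C φ := by
  refine and_congr_right fun hφ => ⟨fun h n => ?_, fun h w => ?_⟩
  · choose C hC using h
    have hfin : {w : List (Fin d) | w.length ≤ n}.Finite := List.finite_length_le _ n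
    refine ⟨∑ w ∈ hfin.toFinset, |C w|, fun w hw x => ?_⟩
    have hmem : w ∈ hfin.toFinset := hfin.mem_toFinset.2 hw
    exact ((hC w x).trans (le_abs_self _)).trans
      (Finset.single_le_sum (f := fun w => |C w|) (fun _ _ => abs_nonneg _) hmem)
  · obtain ⟨C, hC⟩ := h w.length
    exact ⟨C, fun x => hC w le_rfl x⟩

lemma SB.exists_CB (h : SB φ) (n : ℕ) : ∃ C, CB n C φ := (SB_iff.1 h).2 n

lemma SB.pd (h : SB φ) (i : Fin d) : SB (pderiv i φ) :=
  ⟨contDiff_pderiv h.1 i, fun w => h.2 (i :: w)⟩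

lemma SB.add (h : SB φ) (h' : SB ψ) : SB (fun x => φ x + ψ x) := by
  refine SB_iff.2 ⟨h.1.add h'.1, fun n => ?_⟩
  obtain ⟨C, hC⟩ := h.exists_CB n
  obtain ⟨C', hC'⟩ := h'.exists_CB n
  exact ⟨_, hC.add hC' h.1 h'.1⟩

lemma SB.sub (h : SB φ) (h' : SB ψ) : SB (fun x => φ x - ψ x) := by
  refine SB_iff.2 ⟨h.1.sub h'.1, fun n => ?_⟩
  obtain ⟨C, hC⟩ := h.exists_CB n
  obtain ⟨C', hC'⟩ := h'.exists_CB n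
  exact ⟨_, hC.sub hC' h.1 h'.1⟩

lemma SB.mul (h : SB φ) (h' : SB ψ) : SB (fun x => φ x * ψ x) := by
  refine SB_iff.2 ⟨h.1.mul h'.1, fun n => ?_⟩
  obtain ⟨C, hC⟩ := h.exists_CB n
  obtain ⟨C', hC'⟩ := h'.exists_CB n
  exact ⟨_, hC.mul hC' h.1 h'.1⟩

lemma SB.const_mul (h : SB φ) (a : ℝ) : SB (fun x => a * φ x) := by
  refine SB_iff.2 ⟨contDiff_const.mul h.1, fun n => ?_⟩
  obtain ⟨C, hC⟩ := h.exists_CB n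
  exact ⟨_, hC.const_mul h.1 a⟩

lemma SB_zero : SB (fun _ : E d => (0 : ℝ)) :=
  ⟨contDiff_const, fun w => ⟨0, fun x => by rw [Dw_zero]; simp⟩⟩

lemma SB_const (a : ℝ) : SB (fun _ : E d => a) := by
  refine ⟨contDiff_const, fun w => ?_⟩
  cases w with
  | nil => exact ⟨|a|, fun x => le_rfl⟩
  | cons i w => exact ⟨0, fun x => by rw [Dw_cons, pderiv_const, Dw_zero]; simp⟩

lemma SB.sum {φ : ι → E d → ℝ} (h : ∀ k ∈ s, SB (φ k)) : SB (fun x => ∑ k ∈ s, φ k x) := by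
  classical
  induction s using Finset.induction_on with
  | empty => simpa using SB_zero
  | insert a s ha ih =>
    simp only [Finset.sum_insert ha]
    exact (h a (Finset.mem_insert_self _ _)).add
      (ih fun k hk => h k (Finset.mem_insert_of_mem hk))

lemma SB.tr (h : SB φ) (y : E d) : SB (fun x => φ (x + y)) := by
  refine ⟨contDiff_tr h.1 y, fun w => ?_⟩
  obtain ⟨C, hC⟩ := h.2 w
  exact ⟨C, fun x => by rw [Dw_tr]; exact hC _⟩

lemma SB.bdd (h : SB φ) : ∃ C, ∀ x, |φ x| ≤ C := h.2 []

end SB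

end

end FDRichardson

open MeasureTheory
open scoped ContDiff

namespace FDRichardson

noncomputable section

variable {d : ℕ} {ι : Type*}

/-- The directional derivative `∑ y_i D_i φ`. -/
def dirD (y : E d) (φ : E d → ℝ) : E d → ℝ := fun x => ∑ i, y i * pderiv i φ x

lemma dirD_eq_fderiv (y : E d) (φ : E d → ℝ) (x : E d) : dirD y φ x = fderiv ℝ φ x y := by
  have hy : y = ∑ i, y i • EuclideanSpace.single i (1 : ℝ) := by
    have := (EuclideanSpace.basisFun (Fin d) ℝ).sum_repr y
    simpa using this.symm
  conv_rhs => rw [hy, map_sum]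
  simp [dirD, pderiv]

lemma contDiff_dirD {φ : E d → ℝ} (hφ : ContDiff ℝ ∞ φ) (y : E d) : ContDiff ℝ ∞ (dirD y φ) :=
  ContDiff.sum fun i _ => contDiff_const.mul (contDiff_pderiv hφ i)

lemma contDiff_dirD_iter {φ : E d → ℝ} (hφ : ContDiff ℝ ∞ φ) (y : E d) (r : ℕ) :
    ContDiff ℝ ∞ ((dirD y)^[r] φ) := by
  induction r generalizing φ with
  | zero => exact hφ
  | succ r ih => exact ih (contDiff_dirD hφ y)

lemma SB.dirD_iter {φ : E d → ℝ} (hφ : SB φ) (y : E d) (r : ℕ) : SB ((dirD y)^[r] φ) := by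
  induction r generalizing φ with
  | zero => exact hφ
  | succ r ih => exact ih (SB.sum fun i _ => (hφ.pd i).const_mul _)

lemma Dw_dirD {φ : E d → ℝ} (hφ : ContDiff ℝ ∞ φ) (y : E d) (w : List (Fin d)) :
    Dw w (dirD y φ) = dirD y (Dw w φ) := by
  unfold dirD
  rw [Dw_sum fun i _ => contDiff_const.mul (contDiff_pderiv hφ i)]
  funext x
  refine Finset.sum_congr rfl fun i _ => ?_
  rw [Dw_const_mul (contDiff_pderiv hφ i), Dw_pderiv hφ]

lemma Dw_dirD_iter {φ : E d → ℝ} (hφ : ContDiff ℝ ∞ φ) (y : E d) (r : ℕ) (w : List (Fin d)) :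
    Dw w ((dirD y)^[r] φ) = (dirD y)^[r] (Dw w φ) := by
  induction r generalizing φ with
  | zero => rfl
  | succ r ih =>
    rw [Function.iterate_succ_apply, Function.iterate_succ_apply, ih (contDiff_dirD hφ y),
      Dw_dirD hφ]

lemma dirD_const_mul {φ : E d → ℝ} (hφ : ContDiff ℝ ∞ φ) (y : E d) (a : ℝ) :
    dirD y (fun x => a * φ x) = fun x => a * dirD y φ x := by
  funext x
  simp only [dirD, pderiv_const_mul (differentiable_of_smooth hφ), Finset.mul_sum]
  exact Finset.sum_congr rfl fun i _ => by ring

lemma dirD_iter_const_mul {φ : E d → ℝ} (hφ : ContDiff ℝ ∞ φ) (y : E d) (a : ℝ) (r : ℕ) :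
    (dirD y)^[r] (fun x => a * φ x) = fun x => a * (dirD y)^[r] φ x := by
  induction r generalizing φ with
  | zero => rfl
  | succ r ih =>
    simp only [Function.iterate_succ_apply]
    rw [dirD_const_mul hφ, ih (contDiff_dirD hφ y)]

lemma dirD_iter_sum {s : Finset ι} {φ : ι → E d → ℝ} (hφ : ∀ k ∈ s, ContDiff ℝ ∞ (φ k))
    (y : E d) (r : ℕ) :
    (dirD y)^[r] (fun x => ∑ k ∈ s, φ k x) = fun x => ∑ k ∈ s, (dirD y)^[r] (φ k) x := by
  induction r generalizing φ with
  | zero => rfl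
  | succ r ih =>
    have : dirD y (fun x => ∑ k ∈ s, φ k x) = fun x => ∑ k ∈ s, dirD y (φ k) x := by
      funext x
      simp only [dirD, pderiv_sum fun k hk => differentiable_of_smooth (hφ k hk), Finset.mul_sum]
      exact Finset.sum_comm
    simp only [Function.iterate_succ_apply]
    rw [this, ih fun k hk => contDiff_dirD (hφ k hk) y]

lemma dirD_smul (a : ℝ) (y : E d) (φ : E d → ℝ) :
    dirD (a • y) φ = fun x => a * dirD y φ x := by
  funext x
  simp [dirD, Finset.mul_sum, mul_assoc]

lemma dirD_iter_smul {φ : E d → ℝ} (hφ : ContDiff ℝ ∞ φ) (a : ℝ) (y : E d) (r : ℕ) :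
    (dirD (a • y))^[r] φ = fun x => a ^ r * (dirD y)^[r] φ x := by
  induction r generalizing φ with
  | zero => simp
  | succ r ih =>
    simp only [Function.iterate_succ_apply]
    rw [ih (contDiff_dirD hφ _), dirD_smul, dirD_iter_const_mul (contDiff_dirD hφ y)]
    funext x; ring

lemma CBf.dirD {n : ℕ} {B : ℝ} {s : Finset ι} {φ : ι → E d → ℝ} (h : CBf (n + 1) B s φ)
    (hφ : ∀ k ∈ s, ContDiff ℝ ∞ (φ k)) (y : E d) :
    CBf n (d * ‖y‖ ^ 2 * B) s (fun k => dirD y (φ k)) := by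
  intro w hw x
  have h1 : ∀ k ∈ s, (Dw w (FDRichardson.dirD y (φ k)) x) ^ 2
      ≤ ‖y‖ ^ 2 * ∑ i, (Dw w (pderiv i (φ k)) x) ^ 2 := by
    intro k hk
    rw [Dw_dirD (hφ k hk), EuclideanSpace.norm_sq_eq]
    simp only [Dw_pderiv (hφ k hk), Real.norm_eq_abs, sq_abs]
    exact Finset.sum_mul_sq_le_sq_mul_sq _ _ _
  refine (Finset.sum_le_sum h1).trans ?_
  rw [← Finset.mul_sum, Finset.sum_comm]
  have h2 : ∑ i : Fin d, ∑ k ∈ s, (Dw w (pderiv i (φ k)) x) ^ 2 ≤ ∑ _i : Fin d, B :=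
    Finset.sum_le_sum fun i _ => h.pd i w hw x
  rw [Finset.sum_const, Finset.card_univ, Fintype.card_fin, nsmul_eq_mul] at h2
  calc _ ≤ ‖y‖ ^ 2 * (d * B) := mul_le_mul_of_nonneg_left h2 (sq_nonneg _)
    _ = _ := by ring

lemma CBf.dirD_iter {n : ℕ} {B : ℝ} {s : Finset ι} {φ : ι → E d → ℝ} (r : ℕ)
    (h : CBf (n + r) B s φ) (hφ : ∀ k ∈ s, ContDiff ℝ ∞ (φ k)) (y : E d) :
    CBf n ((d * ‖y‖ ^ 2) ^ r * B) s (fun k => (FDRichardson.dirD y)^[r] (φ k)) := by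
  induction r generalizing φ B with
  | zero => simpa using h
  | succ r ih =>
    have := ih (CBf.dirD (n := n + r) h hφ y) fun k hk => contDiff_dirD (hφ k hk) y
    rw [pow_succ, mul_assoc]
    exact this

/-- The Taylor remainder `φ(x + y) - ∑_{i < r} (y·∇)^i φ(x) / i!`. -/
def taylorRem (r : ℕ) (y : E d) (φ : E d → ℝ) : E d → ℝ :=
  fun x => φ (x + y) - ∑ i ∈ Finset.range r, ((i.factorial : ℝ))⁻¹ * (dirD y)^[i] φ x

lemma hasDerivAt_line {φ : E d → ℝ} (hφ : ContDiff ℝ ∞ φ) (x y : E d) (t : ℝ) :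
    HasDerivAt (fun t : ℝ => φ (x + t • y)) (dirD y φ (x + t • y)) t := by
  rw [dirD_eq_fderiv]
  have h1 : HasDerivAt (fun t : ℝ => x + t • y) y t := by
    simpa using ((hasDerivAt_id t).smul_const y).const_add x
  exact ((differentiable_of_smooth hφ _).hasFDerivAt.comp_hasDerivAt t h1)

lemma abs_taylor_line_le (r : ℕ) {φ : E d → ℝ} (hφ : ContDiff ℝ ∞ φ) (y : E d) {B : ℝ}
    (hB : ∀ z, |(dirD y)^[r] φ z| ≤ B) (x : E d) {t : ℝ} (ht : t ∈ Set.Icc (0 : ℝ) 1) :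
    |φ (x + t • y) - ∑ i ∈ Finset.range r, (t ^ i * ((i.factorial : ℝ))⁻¹) * (dirD y)^[i] φ x|
      ≤ B := by
  induction r generalizing φ t with
  | zero => simpa using hB (x + t • y)
  | succ r ih =>
    set g : ℝ → ℝ := fun t => φ (x + t • y)
      - ∑ i ∈ Finset.range (r + 1), (t ^ i * ((i.factorial : ℝ))⁻¹) * (dirD y)^[i] φ x with hg
    have hder : ∀ t, HasDerivAt g (dirD y φ (x + t • y)
        - ∑ i ∈ Finset.range r, (t ^ i * ((i.factorial : ℝ))⁻¹) * (dirD y)^[i] (dirD y φ) x) t := by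
      intro t
      have h1 : HasDerivAt (fun t : ℝ => ∑ i ∈ Finset.range r,
          (t ^ (i + 1) * (((i + 1).factorial : ℝ))⁻¹) * (dirD y)^[i + 1] φ x)
          (∑ i ∈ Finset.range r, (t ^ i * ((i.factorial : ℝ))⁻¹) * (dirD y)^[i] (dirD y φ) x) t := by
        refine HasDerivAt.fun_sum fun i _ => ?_
        rw [Function.iterate_succ_apply]
        refine HasDerivAt.mul_const ?_ _
        have := (hasDerivAt_pow (i + 1) t).mul_const (((i + 1).factorial : ℝ))⁻¹
        refine this.congr_deriv ?_
        rw [Nat.factorial_succ]; push_cast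
        have : (i : ℝ) + 1 ≠ 0 := by positivity
        have : (i.factorial : ℝ) ≠ 0 := by positivity
        field_simp
      have h2 := h1.add_const (φ x)
      have h3 : HasDerivAt (fun t : ℝ => ∑ i ∈ Finset.range (r + 1),
          (t ^ i * ((i.factorial : ℝ))⁻¹) * (dirD y)^[i] φ x)
          (∑ i ∈ Finset.range r, (t ^ i * ((i.factorial : ℝ))⁻¹) * (dirD y)^[i] (dirD y φ) x) t := by
        simp only [Finset.sum_range_succ']
        simpa using h2
      exact (hasDerivAt_line hφ x y t).sub h3
    have hbd : ∀ s ∈ Set.Icc (0 : ℝ) 1, ‖dirD y φ (x + s • y)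
        - ∑ i ∈ Finset.range r, (s ^ i * ((i.factorial : ℝ))⁻¹) * (dirD y)^[i] (dirD y φ) x‖ ≤ B :=
      fun s hs => ih (contDiff_dirD hφ y) hB hs
    have h0 : g 0 = 0 := by
      simp [hg, Finset.sum_range_succ' _ r]
    have hBn : 0 ≤ B := (norm_nonneg _).trans (hbd t ht)
    have := norm_image_sub_le_of_norm_deriv_le_segment' (f := g) (a := 0) (b := 1)
      (fun s _ => (hder s).hasDerivWithinAt) (fun s hs => hbd s ⟨hs.1, hs.2.le⟩) t ht
    rw [h0, sub_zero, sub_zero, Real.norm_eq_abs] at this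
    exact this.trans (mul_le_of_le_one_right hBn ht.2)

lemma abs_taylorRem_le (r : ℕ) {φ : E d → ℝ} (hφ : ContDiff ℝ ∞ φ) (y : E d) {B : ℝ}
    (hB : ∀ z, |(dirD y)^[r] φ z| ≤ B) (x : E d) : |taylorRem r y φ x| ≤ B := by
  simpa [taylorRem] using abs_taylor_line_le r hφ y hB x (t := 1) (by simp)

lemma taylorRem_sum {s : Finset ι} {φ : ι → E d → ℝ} (hφ : ∀ k ∈ s, ContDiff ℝ ∞ (φ k))
    (r : ℕ) (y : E d) : taylorRem r y (fun x => ∑ k ∈ s, φ k x)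
      = fun x => ∑ k ∈ s, taylorRem r y (φ k) x := by
  funext x
  simp only [taylorRem, dirD_iter_sum hφ, Finset.mul_sum, Finset.sum_sub_distrib]
  rw [Finset.sum_comm]

lemma taylorRem_const_mul {φ : E d → ℝ} (hφ : ContDiff ℝ ∞ φ) (r : ℕ) (y : E d) (a : ℝ) :
    taylorRem r y (fun x => a * φ x) = fun x => a * taylorRem r y φ x := by
  funext x
  simp only [taylorRem, dirD_iter_const_mul hφ, mul_sub, Finset.mul_sum]
  congr 1
  exact Finset.sum_congr rfl fun i _ => by ring

lemma contDiff_taylorRem {φ : E d → ℝ} (hφ : ContDiff ℝ ∞ φ) (r : ℕ) (y : E d) :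
    ContDiff ℝ ∞ (taylorRem r y φ) :=
  (contDiff_tr hφ y).sub
    (ContDiff.sum fun i _ => contDiff_const.mul (contDiff_dirD_iter hφ y i))

lemma SB.taylorRem {φ : E d → ℝ} (hφ : SB φ) (r : ℕ) (y : E d) : SB (taylorRem r y φ) :=
  (hφ.tr y).sub (SB.sum fun i _ => (hφ.dirD_iter y i).const_mul _)

lemma Dw_taylorRem {φ : E d → ℝ} (hφ : ContDiff ℝ ∞ φ) (r : ℕ) (y : E d) (w : List (Fin d)) :
    Dw w (taylorRem r y φ) = taylorRem r y (Dw w φ) := by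
  unfold taylorRem
  rw [Dw_sub (contDiff_tr hφ y)
    (ContDiff.sum fun i _ => contDiff_const.mul (contDiff_dirD_iter hφ y i)), Dw_tr,
    Dw_sum fun i _ => contDiff_const.mul (contDiff_dirD_iter hφ y i)]
  funext x
  congr 1
  refine Finset.sum_congr rfl fun i _ => ?_
  rw [Dw_const_mul (contDiff_dirD_iter hφ y i), Dw_dirD_iter hφ]

lemma sum_taylorRem_sq_le {s : Finset ι} {φ : ι → E d → ℝ} (hφ : ∀ k ∈ s, ContDiff ℝ ∞ (φ k))
    (r : ℕ) (y : E d) {B : ℝ} (hB : ∀ z, ∑ k ∈ s, ((dirD y)^[r] (φ k) z) ^ 2 ≤ B) (x : E d) :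
    ∑ k ∈ s, (taylorRem r y (φ k) x) ^ 2 ≤ B := by
  set a : ι → ℝ := fun k => taylorRem r y (φ k) x with ha
  have hB0 : 0 ≤ B := (Finset.sum_nonneg fun _ _ => sq_nonneg _).trans (hB 0)
  have hs : ∀ k ∈ s, ContDiff ℝ ∞ (fun x => a k * φ k x) :=
    fun k hk => contDiff_const.mul (hφ k hk)
  have h1 := abs_taylorRem_le r (ContDiff.sum hs) y
    (B := Real.sqrt ((∑ k ∈ s, a k ^ 2) * B)) (fun z => by
      rw [dirD_iter_sum hs, ← Real.sqrt_sq_eq_abs]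
      refine Real.sqrt_le_sqrt ?_
      have : ∀ k ∈ s, (dirD y)^[r] (fun x => a k * φ k x) z = a k * (dirD y)^[r] (φ k) z :=
        fun k hk => by rw [dirD_iter_const_mul (hφ k hk)]
      beta_reduce
      rw [Finset.sum_congr rfl this]
      exact (Finset.sum_mul_sq_le_sq_mul_sq _ _ _).trans
        (mul_le_mul_of_nonneg_left (hB z) (Finset.sum_nonneg fun _ _ => sq_nonneg _))) x
  rw [taylorRem_sum hs] at h1
  have : ∀ k ∈ s, taylorRem r y (fun x => a k * φ k x) x = a k ^ 2 :=
    fun k hk => by rw [taylorRem_const_mul (hφ k hk), sq]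
  beta_reduce at h1
  rw [Finset.sum_congr rfl this] at h1
  set S := ∑ k ∈ s, a k ^ 2 with hS
  have hS0 : 0 ≤ S := Finset.sum_nonneg fun _ _ => sq_nonneg _
  have h2 := (le_abs_self S).trans h1
  have h3 : S ^ 2 ≤ S * B := by
    have := Real.le_sqrt' (x := S) (y := S * B)
    rcases hS0.eq_or_lt with h | h
    · rw [← h]; simp
    · exact (this h).1 h2
  rcases hS0.eq_or_lt with h | h
  · rw [← h]; exact hB0
  · nlinarith

lemma CBf.taylorRem {n r : ℕ} {B : ℝ} {s : Finset ι} {φ : ι → E d → ℝ} (h : CBf (n + r) B s φ)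
    (hφ : ∀ k ∈ s, ContDiff ℝ ∞ (φ k)) (y : E d) :
    CBf n ((d * ‖y‖ ^ 2) ^ r * B) s (fun k => taylorRem r y (φ k)) := by
  intro w hw x
  rw [Finset.sum_congr rfl fun k hk => by rw [Dw_taylorRem (hφ k hk)]]
  refine sum_taylorRem_sq_le (fun k hk => contDiff_Dw (hφ k hk) w) r y (fun z => ?_) x
  rw [Finset.sum_congr rfl fun k hk => by rw [← Dw_dirD_iter (hφ k hk)]]
  exact CBf.dirD_iter r h hφ y w hw z

lemma diffQ_eq_taylorRem (t : ℝ) (y : E d) (φ : E d → ℝ) :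
    diffQ t y φ = fun x => t⁻¹ * taylorRem 1 (t • y) φ x := by
  funext x; simp [diffQ, taylorRem]

lemma exists_tendstoUniformly {X : Type*} {φ : ℕ → X → ℝ}
    (h : ∀ ε > 0, ∃ N, ∀ i ≥ N, ∀ j ≥ N, ∀ x, |φ i x - φ j x| ≤ ε) :
    ∃ g, TendstoUniformly φ g Filter.atTop := by
  have hc : ∀ x, CauchySeq fun j => φ j x := by
    intro x
    refine Metric.cauchySeq_iff.2 fun ε hε => ?_
    obtain ⟨N, hN⟩ := h (ε / 2) (by positivity)
    exact ⟨N, fun i hi j hj => lt_of_le_of_lt (hN i hi j hj x) (by linarith)⟩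
  choose g hg using fun x => cauchySeq_tendsto_of_complete (hc x)
  refine ⟨g, Metric.tendstoUniformly_iff.2 fun ε hε => ?_⟩
  obtain ⟨N, hN⟩ := h (ε / 2) (by positivity)
  filter_upwards [Filter.eventually_ge_atTop N] with j hj x
  have : |g x - φ j x| ≤ ε / 2 := by
    refine le_of_tendsto (((hg x).sub_const _).abs) ?_
    filter_upwards [Filter.eventually_ge_atTop N] with i hi using hN i hi j hj x
  exact lt_of_le_of_lt this (by linarith)

/-- Interpolation: if the second derivatives are bounded and the function is small, then so are
its first derivatives. -/
lemma abs_pderiv_le_of_small {C ε : ℝ} (hC : 0 ≤ C) (hε : 0 < ε) :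
    ∃ η > 0, ∀ φ : E d → ℝ, ContDiff ℝ ∞ φ → CB 2 C φ → (∀ x, |φ x| ≤ η) →
      ∀ i x, |pderiv i φ x| ≤ ε := by
  set t := ε / (2 * (C + 1) * (d + 1)) with ht
  have ht0 : 0 < t := by positivity
  refine ⟨t * ε / 4, by positivity, fun φ hφ hCB hsm i x => ?_⟩
  have hf : CBf (0 + 2) (C ^ 2) {()} (fun _ : Unit => φ) := hCB.toCBf
  have h1 := hf.taylorRem (fun _ _ => hφ) (t • EuclideanSpace.single i (1 : ℝ)) [] le_rfl x
  have hd : dirD (t • EuclideanSpace.single i (1 : ℝ)) φ x = t * pderiv i φ x := by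
    rw [dirD_eq_fderiv]; simp [pderiv]
  have hn : ‖t • EuclideanSpace.single i (1 : ℝ)‖ = t := by
    rw [norm_smul]; simp [abs_of_pos ht0]
  rw [hn] at h1
  simp only [Dw_nil, Finset.sum_singleton, taylorRem, Finset.sum_range_succ, Finset.range_zero,
    Finset.sum_empty, Function.iterate_zero, Function.iterate_one, id, hd] at h1
  have h2 : (d * t ^ 2) ^ 2 * C ^ 2 = (d * t ^ 2 * C) ^ 2 := by ring
  rw [h2] at h1
  have h3 := abs_le_of_sq_le_sq h1 (by positivity)
  have h4 := hsm (x + t • EuclideanSpace.single i (1 : ℝ))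
  have h5 := hsm x
  have hd0 : (0 : ℝ) ≤ d := Nat.cast_nonneg d
  have h6 : d * t * C ≤ ε / 2 := by
    have : t * (2 * (C + 1) * (d + 1)) = ε := by rw [ht]; field_simp
    have h7 : (d : ℝ) * t * C = t * (d * C) := by ring
    rw [h7, le_div_iff₀ (by norm_num), ← this, mul_assoc]
    refine mul_le_mul_of_nonneg_left ?_ ht0.le
    nlinarith
  have h7 : |t * pderiv i φ x| ≤ t * ε := by
    simp only [Nat.factorial, Nat.cast_one, inv_one, one_mul, zero_add] at h3
    rw [abs_le] at h3 h4 h5 ⊢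
    have : d * t ^ 2 * C = t * (d * t * C) := by ring
    rw [this] at h3
    have h8 := mul_le_mul_of_nonneg_left h6 ht0.le
    norm_num at h3
    constructor <;> linarith [h3.1, h3.2, h4.1, h4.2, h5.1, h5.2]
  rw [abs_mul, abs_of_pos ht0] at h7
  exact le_of_mul_le_mul_left h7 ht0

/-- Uniform limits of functions with bounded derivatives up to order `n + 1`. -/
theorem limit_contDiff (n : ℕ) {C : ℝ} {φ : ℕ → E d → ℝ} {g : E d → ℝ}
    (hφ : ∀ j, ContDiff ℝ ∞ (φ j)) (hC : ∀ j, CB (n + 1) C (φ j))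
    (hg : TendstoUniformly φ g Filter.atTop) :
    ContDiff ℝ n g ∧ ∀ w : List (Fin d), w.length ≤ n →
      TendstoUniformly (fun j => Dw w (φ j)) (Dw w g) Filter.atTop := by
  induction n generalizing φ g with
  | zero =>
    refine ⟨?_, fun w hw => ?_⟩
    · exact contDiff_zero.2 (hg.continuous (Filter.Eventually.frequently
        (Filter.Eventually.of_forall fun j => (hφ j).continuous)))
    · obtain rfl : w = [] := List.length_eq_zero_iff.1 (Nat.le_zero.1 hw)
      exact hg
  | succ n ih =>
    have hlim : ∀ i : Fin d, ∃ gi,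
        TendstoUniformly (fun j => pderiv i (φ j)) gi Filter.atTop := by
      intro i
      refine exists_tendstoUniformly fun ε hε => ?_
      have hC0 := (hC 0).nonneg
      obtain ⟨η, hη, H⟩ := abs_pderiv_le_of_small (d := d) (C := C + C) (by linarith) hε
      obtain ⟨N, hN⟩ := Filter.eventually_atTop.1
        (Metric.tendstoUniformly_iff.1 hg (η / 2) (by positivity))
      refine ⟨N, fun j hj k hk x => ?_⟩
      have h2 := H (fun x => φ j x - φ k x) ((hφ j).sub (hφ k))
        (((hC j).mono (by omega) le_rfl).sub ((hC k).mono (by omega) le_rfl) (hφ j) (hφ k))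
        (fun x => by
          have h3 := hN j hj x
          have h4 := hN k hk x
          rw [Real.dist_eq] at h3 h4
          have : φ j x - φ k x = (g x - φ k x) - (g x - φ j x) := by ring
          rw [this]
          exact (abs_sub _ _).trans (by linarith)) i x
      rwa [pderiv_sub (differentiable_of_smooth (hφ j)) (differentiable_of_smooth (hφ k))] at h2
    choose G hG using hlim
    let P : (Fin d → ℝ) → (E d →L[ℝ] ℝ) := fun a => ∑ i, a i • (EuclideanSpace.proj i : E d →L[ℝ] ℝ)
    have hP : ∀ a y, P a y = ∑ i, y i * a i := by
      intro a y; simp [P, mul_comm]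
    have hfd : ∀ j x, fderiv ℝ (φ j) x = P fun i => pderiv i (φ j) x := by
      intro j x; ext y
      rw [hP, ← dirD_eq_fderiv]; rfl
    have hcont : UniformContinuous P := by
      have : P = (∑ i, (ContinuousLinearMap.proj i : (Fin d → ℝ) →L[ℝ] ℝ).smulRight
          (EuclideanSpace.proj i : E d →L[ℝ] ℝ)) := by
        funext a; simp [P]
      rw [this]
      exact ContinuousLinearMap.uniformContinuous _
    have hder : ∀ x, HasFDerivAt g (P fun i => G i x) x := by
      refine hasFDerivAt_of_tendstoUniformly (l := Filter.atTop) (f := φ)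
        (f' := fun j x => fderiv ℝ (φ j) x) ?_
        (fun j x => (differentiable_of_smooth (hφ j) x).hasFDerivAt)
        (fun x => hg.tendsto_at x)
      simp only [hfd]
      have : TendstoUniformly (fun j x i => pderiv i (φ j) x) (fun x i => G i x)
          Filter.atTop := by
        refine Metric.tendstoUniformly_iff.2 fun ε hε => ?_
        have := Filter.eventually_all.2 fun i => Metric.tendstoUniformly_iff.1 (hG i) ε hε
        filter_upwards [this] with j hj x
        exact (dist_pi_lt_iff hε).2 fun i => hj i x
      exact hcont.comp_tendstoUniformly this
    have hpd : ∀ i, pderiv i g = G i := by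
      intro i; funext x
      unfold pderiv
      rw [(hder x).fderiv, hP]
      simp [PiLp.single_apply]
    have IH := fun i => ih (fun j => contDiff_pderiv (hφ j) i) (fun j => (hC j).pd i) (hG i)
    refine ⟨?_, fun w hw => ?_⟩
    · have : ((n + 1 : ℕ) : WithTop ℕ∞) = (n : WithTop ℕ∞) + 1 := by push_cast; rfl
      rw [this, contDiff_succ_iff_fderiv]
      refine ⟨fun x => (hder x).differentiableAt, by simp, ?_⟩
      have e : fderiv ℝ g = fun x => ∑ i, G i x • (EuclideanSpace.proj i : E d →L[ℝ] ℝ) :=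
        funext fun x => (hder x).fderiv
      rw [e]
      exact ContDiff.sum fun i _ => (IH i).1.smul contDiff_const
    · cases w with
      | nil => exact hg
      | cons i w =>
        simp only [Dw_cons, hpd]
        exact (IH i).2 w (by simpa using hw)

end

end FDRichardson

open MeasureTheory
open scoped ContDiff

namespace FDRichardson

noncomputable section

variable {d : ℕ} {ι : Type*}

/-- The difference operator without its zeroth order term. -/
def opM (S : Coeffs d) (h : ℝ) (φ : E d → ℝ) (x : E d) : ℝ :=
  h⁻¹ * ∑ lam ∈ S.dirs, S.q lam x * diffQ h lam φ x
    + ∑ lam ∈ S.dirs, S.p lam x * diffQ h lam φ x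

lemma opLh_eq (S : Coeffs d) (h : ℝ) (φ : E d → ℝ) (x : E d) :
    opLh S h φ x = opM S h φ x - S.c x * φ x := rfl

lemma opM_eq (S : Coeffs d) {h : ℝ} (hh : h ≠ 0) (φ : E d → ℝ) (x : E d) :
    opM S h φ x = ∑ lam ∈ S.dirs, h⁻¹ ^ 2 * chi S h lam x * (φ (x + h • lam) - φ x) := by
  unfold opM chi diffQ
  rw [Finset.mul_sum, ← Finset.sum_add_distrib]
  refine Finset.sum_congr rfl fun lam _ => ?_
  field_simp

/-- Monotonicity of the difference scheme with step `h`. -/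
structure Mono (S : Coeffs d) (h c₀ : ℝ) : Prop where
  h_pos : 0 < h
  c₀_pos : 0 < c₀
  chi_nonneg : ∀ lam ∈ S.dirs, ∀ x, 0 ≤ chi S h lam x
  chi_bdd : ∃ X, ∀ x, ∑ lam ∈ S.dirs, chi S h lam x ≤ X
  c_ge : ∀ x, c₀ ≤ S.c x

lemma Mono.exists_near_max {S : Coeffs d} {h c₀ : ℝ} (hS : Mono S h c₀) {W G : E d → ℝ}
    (hW : ∃ C, ∀ x, W x ≤ C) (hG : ∀ x, G x ≤ opM S h W x) {η : ℝ} (hη : 0 < η) :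
    ∃ x, (∀ y, W y ≤ W x + η) ∧ G x ≤ η := by
  obtain ⟨X, hX⟩ := hS.chi_bdd
  have hh := hS.h_pos
  have hX0 : 0 ≤ X := (Finset.sum_nonneg fun lam hl => hS.chi_nonneg lam hl 0).trans (hX 0)
  set ε := min η (η / (h⁻¹ ^ 2 * X + 1)) with hε
  have hε0 : 0 < ε := by positivity
  obtain ⟨C, hC⟩ := hW
  have hbdd : BddAbove (Set.range W) := ⟨C, by rintro _ ⟨x, rfl⟩; exact hC x⟩
  obtain ⟨x, hx⟩ := exists_lt_of_lt_ciSup (f := W) (b := (⨆ x, W x) - ε) (by linarith)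
  have hmax : ∀ y, W y ≤ W x + ε := fun y => by linarith [le_ciSup hbdd y]
  refine ⟨x, fun y => (hmax y).trans (by linarith [min_le_left η (η / (h⁻¹ ^ 2 * X + 1))]), ?_⟩
  refine (hG x).trans ?_
  rw [opM_eq S hh.ne']
  have h1 : ∀ lam ∈ S.dirs, h⁻¹ ^ 2 * chi S h lam x * (W (x + h • lam) - W x)
      ≤ h⁻¹ ^ 2 * chi S h lam x * ε := fun lam hl =>
    mul_le_mul_of_nonneg_left (by linarith [hmax (x + h • lam)])
      (mul_nonneg (by positivity) (hS.chi_nonneg lam hl x))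
  refine (Finset.sum_le_sum h1).trans ?_
  rw [← Finset.sum_mul, ← Finset.mul_sum]
  have h2 : h⁻¹ ^ 2 * (∑ lam ∈ S.dirs, chi S h lam x) ≤ h⁻¹ ^ 2 * X :=
    mul_le_mul_of_nonneg_left (hX x) (by positivity)
  have h3 : ε ≤ η / (h⁻¹ ^ 2 * X + 1) := min_le_right _ _
  rw [le_div_iff₀ (by positivity)] at h3
  nlinarith

lemma opM_neg (S : Coeffs d) (h : ℝ) (φ : E d → ℝ) (x : E d) :
    opM S h (fun x => -φ x) x = -opM S h φ x := by
  have : ∀ lam, diffQ h lam (fun x => -φ x) x = -diffQ h lam φ x := fun lam => by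
    simp only [diffQ]; ring
  simp only [opM, this, mul_neg, Finset.sum_neg_distrib]; ring

lemma opM_sub (S : Coeffs d) (h : ℝ) (φ ψ : E d → ℝ) (x : E d) :
    opM S h (fun x => φ x - ψ x) x = opM S h φ x - opM S h ψ x := by
  have : ∀ lam, diffQ h lam (fun x => φ x - ψ x) x = diffQ h lam φ x - diffQ h lam ψ x :=
    fun lam => by simp only [diffQ]; ring
  simp only [opM, this, mul_sub, Finset.sum_sub_distrib]; ring

lemma opM_sum (S : Coeffs d) (h : ℝ) (s : Finset ι) (φ : ι → E d → ℝ) (x : E d) :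
    opM S h (fun x => ∑ k ∈ s, φ k x) x = ∑ k ∈ s, opM S h (φ k) x := by
  have : ∀ lam, diffQ h lam (fun x => ∑ k ∈ s, φ k x) x = ∑ k ∈ s, diffQ h lam (φ k) x :=
    fun lam => by simp only [diffQ, ← Finset.sum_sub_distrib, Finset.mul_sum]
  simp only [opM, this, Finset.mul_sum, Finset.sum_add_distrib]
  rw [Finset.sum_comm]
  congr 1
  rw [Finset.sum_comm]

lemma opM_const_mul (S : Coeffs d) (h a : ℝ) (φ : E d → ℝ) (x : E d) :
    opM S h (fun x => a * φ x) x = a * opM S h φ x := by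
  have : ∀ lam, diffQ h lam (fun x => a * φ x) x = a * diffQ h lam φ x :=
    fun lam => by simp only [diffQ]; ring
  simp only [opM, this, mul_add, Finset.mul_sum]
  congr 1 <;> exact Finset.sum_congr rfl fun _ _ => by ring

lemma opM_add (S : Coeffs d) (h : ℝ) (φ ψ : E d → ℝ) (x : E d) :
    opM S h (fun x => φ x + ψ x) x = opM S h φ x + opM S h ψ x := by
  have : ∀ lam, diffQ h lam (fun x => φ x + ψ x) x = diffQ h lam φ x + diffQ h lam ψ x :=
    fun lam => by simp only [diffQ]; ring
  simp only [opM, this, mul_add, Finset.sum_add_distrib]; ring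

lemma Mono.le_of_opLh_ge {S : Coeffs d} {h c₀ : ℝ} (hS : Mono S h c₀) {φ : E d → ℝ} {R : ℝ}
    (hφ : ∃ C, ∀ x, φ x ≤ C) (hR : 0 ≤ R) (hL : ∀ x, -R ≤ opLh S h φ x) (y : E d) :
    φ y ≤ R / c₀ := by
  have hc := hS.c₀_pos
  refine le_of_forall_pos_le_add fun ε hε => ?_
  set η := ε / (1 / c₀ + 1) with hη
  have hη0 : 0 < η := by positivity
  obtain ⟨x, hx, hG⟩ := hS.exists_near_max (W := φ) (G := fun x => S.c x * φ x - R) hφ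
    (fun x => by have := hL x; rw [opLh_eq] at this; linarith) hη0
  have h1 : η * (1 / c₀ + 1) = ε := by rw [hη]; field_simp
  have h2 : φ x ≤ (R + η) / c₀ := by
    rw [le_div_iff₀ hc]
    by_contra! hcon
    have h3 : 0 < φ x := by
      by_contra! h4
      nlinarith
    have := mul_le_mul_of_nonneg_right (hS.c_ge x) h3.le
    linarith
  have h3 := hx y
  calc φ y ≤ (R + η) / c₀ + η := by linarith
    _ = R / c₀ + η * (1 / c₀ + 1) := by ring
    _ = _ := by rw [h1]

/-- The maximum principle. -/
lemma Mono.abs_le_of_abs_opLh_le {S : Coeffs d} {h c₀ : ℝ} (hS : Mono S h c₀) {φ : E d → ℝ}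
    {R : ℝ} (hφ : ∃ C, ∀ x, |φ x| ≤ C) (hL : ∀ x, |opLh S h φ x| ≤ R) (y : E d) :
    |φ y| ≤ R / c₀ := by
  obtain ⟨C, hC⟩ := hφ
  have hR : 0 ≤ R := (abs_nonneg _).trans (hL 0)
  refine abs_le'.2 ⟨?_, ?_⟩
  · exact hS.le_of_opLh_ge ⟨C, fun x => (le_abs_self _).trans (hC x)⟩ hR
      (fun x => (abs_le.1 (hL x)).1) y
  · refine hS.le_of_opLh_ge (φ := fun x => -φ x) ⟨C, fun x => (neg_le_abs _).trans (hC x)⟩ hR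
      (fun x => ?_) y
    have := (abs_le.1 (hL x)).2
    rw [opLh_eq] at this ⊢
    rw [opM_neg]; linarith

lemma Mono.diffSol_unique {S : Coeffs d} {h c₀ : ℝ} (hS : Mono S h c₀) {f v w : E d → ℝ}
    (hv : IsDiffSol S f h v) (hw : IsDiffSol S f h w) : v = w := by
  obtain ⟨⟨C, hC⟩, hv⟩ := hv
  obtain ⟨⟨C', hC'⟩, hw⟩ := hw
  funext y
  have := hS.abs_le_of_abs_opLh_le (φ := fun x => v x - w x) (R := 0)
    ⟨C + C', fun x => (abs_sub _ _).trans (add_le_add (hC x) (hC' x))⟩ (fun x => by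
      have h1 := hv x
      have h2 := hw x
      rw [opLh_eq] at h1 h2 ⊢
      rw [opM_sub, show opM S h v x - opM S h w x - S.c x * (v x - w x) = 0 by linarith]
      simp) y
  rw [zero_div] at this
  linarith [abs_nonpos_iff.1 this]

/-- A positive contraction with smooth coefficients has a smooth fixed point. -/
theorem exists_smooth_fixedPoint {s : Finset ι} {a : ι → E d → ℝ} {y : ι → E d} {g : E d → ℝ}
    {θ : ℝ} (ha : ∀ k ∈ s, SB (a k)) (hg : SB g) (ha0 : ∀ k ∈ s, ∀ x, 0 ≤ a k x)
    (hθ : ∀ x, ∑ k ∈ s, a k x ≤ θ) (hθ1 : θ < 1) :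
    ∃ v, SB v ∧ ∀ x, v x = g x + ∑ k ∈ s, a k x * v (x + y k) := by
  have hθ0 : 0 ≤ θ := (Finset.sum_nonneg fun k hk => ha0 k hk 0).trans (hθ 0)
  let T : (E d → ℝ) → E d → ℝ := fun φ x => g x + ∑ k ∈ s, a k x * φ (x + y k)
  let v : ℕ → E d → ℝ := fun j => T^[j] (fun _ => 0)
  have hvs : ∀ j, v (j + 1) = T (v j) := fun j => Function.iterate_succ_apply' _ _ _
  have hT : ∀ φ, SB φ → SB (T φ) := fun φ hφ =>
    hg.add (SB.sum fun k hk => (ha k hk).mul (hφ.tr _))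
  have hv : ∀ j, SB (v j) := by
    intro j
    induction j with
    | zero => exact SB_zero
    | succ j ih => rw [hvs]; exact hT _ ih
  have hDw0 : ∀ w x, Dw w (v 0) x = 0 := fun w x => congrFun (Dw_zero w) x
  have hbound : ∀ n, ∃ C, ∀ j, CB n C (v j) := by
    intro n
    induction n with
    | zero =>
      obtain ⟨Cg, hCg⟩ := hg.exists_CB 0
      have hCg0 := hCg.nonneg
      refine ⟨Cg / (1 - θ), fun j => ?_⟩
      have h1 : 0 < 1 - θ := by linarith
      induction j with
      | zero => intro w hw x; rw [hDw0, abs_zero]; positivity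
      | succ j ih =>
        intro w hw x
        obtain rfl : w = [] := List.length_eq_zero_iff.1 (Nat.le_zero.1 hw)
        rw [hvs, Dw_nil]
        have h2 : |∑ k ∈ s, a k x * v j (x + y k)| ≤ θ * (Cg / (1 - θ)) := by
          have hnn : 0 ≤ Cg / (1 - θ) := by positivity
          calc _ ≤ ∑ k ∈ s, a k x * (Cg / (1 - θ)) := by
                refine (Finset.abs_sum_le_sum_abs _ _).trans (Finset.sum_le_sum fun k hk => ?_)
                rw [abs_mul, abs_of_nonneg (ha0 k hk x)]
                exact mul_le_mul_of_nonneg_left (ih.bound _) (ha0 k hk x)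
            _ ≤ _ := by
                rw [← Finset.sum_mul]
                exact mul_le_mul_of_nonneg_right (hθ x) hnn
        refine (abs_add_le _ _).trans ((add_le_add (hCg.bound x) h2).trans (le_of_eq ?_))
        field_simp; ring
    | succ n ih =>
      obtain ⟨C, hC⟩ := ih
      obtain ⟨Cg, hCg⟩ := hg.exists_CB (n + 1)
      have hA : ∀ k, ∃ A, k ∈ s → CB (n + 1) A (a k) := by
        intro k
        by_cases hk : k ∈ s
        · obtain ⟨A, hA⟩ := (ha k hk).exists_CB (n + 1)
          exact ⟨A, fun _ => hA⟩
        · exact ⟨0, fun h => absurd h hk⟩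
      choose A hA using hA
      set R := Cg + ∑ k ∈ s, 2 ^ (n + 1) * (A k * C) with hR
      have hR0 : 0 ≤ R := add_nonneg hCg.nonneg (Finset.sum_nonneg fun k hk =>
        mul_nonneg (by positivity) (mul_nonneg (hA k hk).nonneg (hC 0).nonneg))
      have h1 : 0 < 1 - θ := by linarith
      refine ⟨R / (1 - θ), fun j => ?_⟩
      induction j with
      | zero => intro w hw x; rw [hDw0, abs_zero]; positivity
      | succ j ih =>
        intro w hw x
        have hsm : ∀ k ∈ s, ContDiff ℝ ∞ (fun x => a k x * v j (x + y k)) := fun k hk =>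
          (ha k hk).1.mul ((hv j).tr _).1
        have e : Dw w (v (j + 1)) x
            = Dw w g x + ∑ k ∈ s, Dw w (fun x => a k x * v j (x + y k)) x := by
          rw [hvs]
          change Dw w (fun x => g x + ∑ k ∈ s, a k x * v j (x + y k)) x = _
          rw [Dw_add hg.1 (ContDiff.sum hsm), Dw_sum hsm]
        have h2 : ∀ k ∈ s, |Dw w (fun x => a k x * v j (x + y k)) x|
            ≤ 2 ^ (n + 1) * (A k * C) + a k x * (R / (1 - θ)) := by
          intro k hk
          have hCtr : CB n C (fun x => v j (x + y k)) := fun w' hw' x' => by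
            rw [Dw_tr]; exact hC j w' hw' _
          have h3 := Dw_mul_sub_leading (hA k hk) hCtr (ha k hk).1 ((hv j).tr _).1 w hw x
          have h4 : |a k x * Dw w (fun x => v j (x + y k)) x| ≤ a k x * (R / (1 - θ)) := by
            rw [abs_mul, abs_of_nonneg (ha0 k hk x), Dw_tr]
            exact mul_le_mul_of_nonneg_left (ih w hw _) (ha0 k hk x)
          have h5 := abs_add_le (Dw w (fun x => a k x * v j (x + y k)) x
            - a k x * Dw w (fun x => v j (x + y k)) x) (a k x * Dw w (fun x => v j (x + y k)) x)
          rw [sub_add_cancel] at h5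
          linarith
        rw [e]
        refine (abs_add_le _ _).trans ?_
        have h6 := (Finset.abs_sum_le_sum_abs _ _).trans (Finset.sum_le_sum h2)
        rw [Finset.sum_add_distrib, ← Finset.sum_mul] at h6
        have h7 : (∑ k ∈ s, a k x) * (R / (1 - θ)) ≤ θ * (R / (1 - θ)) :=
          mul_le_mul_of_nonneg_right (hθ x) (by positivity)
        have h8 : R + θ * (R / (1 - θ)) = R / (1 - θ) := by field_simp; ring
        have h9 := hCg w hw x
        linarith
  have hcontr : ∀ φ ψ : E d → ℝ, ∀ D, (∀ x, |φ x - ψ x| ≤ D) → ∀ x, |T φ x - T ψ x| ≤ θ * D := by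
    intro φ ψ D hD x
    have hD0 : 0 ≤ D := (abs_nonneg _).trans (hD 0)
    have : T φ x - T ψ x = ∑ k ∈ s, a k x * (φ (x + y k) - ψ (x + y k)) := by
      simp only [T, mul_sub, Finset.sum_sub_distrib]; ring
    rw [this]
    calc _ ≤ ∑ k ∈ s, a k x * D := by
          refine (Finset.abs_sum_le_sum_abs _ _).trans (Finset.sum_le_sum fun k hk => ?_)
          rw [abs_mul, abs_of_nonneg (ha0 k hk x)]
          exact mul_le_mul_of_nonneg_left (hD _) (ha0 k hk x)
      _ ≤ θ * D := by
          rw [← Finset.sum_mul]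
          exact mul_le_mul_of_nonneg_right (hθ x) hD0
  obtain ⟨C, hC⟩ := hbound 0
  have hC0 := (hC 0).nonneg
  have hdiff : ∀ N i x, |v (N + i) x - v N x| ≤ θ ^ N * C := by
    intro N
    induction N with
    | zero =>
      intro i x
      have : v 0 x = 0 := rfl
      rw [this, zero_add, sub_zero, pow_zero, one_mul]
      exact (hC i).bound x
    | succ N ih =>
      intro i x
      rw [show N + 1 + i = (N + i) + 1 by ring, hvs, hvs, pow_succ', mul_assoc]
      exact hcontr _ _ _ (ih i) x
  obtain ⟨u, hu⟩ := exists_tendstoUniformly (φ := v) fun ε hε => by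
    obtain ⟨N, hN⟩ := exists_pow_lt_of_lt_one (show 0 < ε / (2 * (C + 1)) by positivity) hθ1
    refine ⟨N, fun i hi j hj x => ?_⟩
    obtain ⟨i, rfl⟩ := Nat.exists_eq_add_of_le hi
    obtain ⟨j, rfl⟩ := Nat.exists_eq_add_of_le hj
    have h1 := hdiff N i x
    have h2 := hdiff N j x
    have h3 : θ ^ N * C ≤ ε / 2 := by
      rw [lt_div_iff₀ (by positivity)] at hN
      have : 0 ≤ θ ^ N := by positivity
      nlinarith
    have : v (N + i) x - v (N + j) x = (v (N + i) x - v N x) - (v (N + j) x - v N x) := by ring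
    rw [this]
    exact (abs_sub _ _).trans (by linarith)
  refine ⟨u, ⟨contDiff_infty.2 fun n => ?_, fun w => ?_⟩, fun x => ?_⟩
  · obtain ⟨C, hC⟩ := hbound (n + 1)
    exact (limit_contDiff n (fun j => (hv j).1) hC hu).1
  · obtain ⟨C, hC⟩ := hbound (w.length + 1)
    have := (limit_contDiff w.length (fun j => (hv j).1) hC hu).2 w le_rfl
    exact ⟨C, fun x => le_of_tendsto (this.tendsto_at x).abs
      (Filter.Eventually.of_forall fun j => hC j w (Nat.le_succ _) x)⟩
  · have h1 := (hu.tendsto_at x).comp (Filter.tendsto_add_atTop_nat 1)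
    have h2 : Filter.Tendsto (fun j => T (v j) x) Filter.atTop
        (nhds (g x + ∑ k ∈ s, a k x * u (x + y k))) :=
      tendsto_const_nhds.add (tendsto_finsetSum _ fun k _ =>
        (hu.tendsto_at (x + y k)).const_mul _)
    refine tendsto_nhds_unique h1 (h2.congr fun j => ?_)
    simp [hvs]

/-- Smooth solvability of the difference equation with smooth data. -/
theorem exists_smooth_diffSol {S : Coeffs d} {h c₀ : ℝ} (hS : Mono S h c₀)
    (hq : ∀ lam ∈ S.dirs, SB (S.q lam)) (hp : ∀ lam ∈ S.dirs, SB (S.p lam)) (hc : SB S.c)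
    {f : E d → ℝ} (hf : SB f) : ∃ v, SB v ∧ ∀ x, opLh S h v x + f x = 0 := by
  have hh := hS.h_pos
  have hchi : ∀ lam ∈ S.dirs, SB (chi S h lam) := fun lam hl =>
    (hq lam hl).add ((hp lam hl).const_mul h)
  obtain ⟨X, hX⟩ := hS.chi_bdd
  obtain ⟨C, hC⟩ := hc.bdd
  have hX0 : 0 ≤ X := (Finset.sum_nonneg fun lam hl => hS.chi_nonneg lam hl 0).trans (hX 0)
  set B := C + h⁻¹ ^ 2 * X with hB
  have hCc : c₀ ≤ C := (hS.c_ge 0).trans ((le_abs_self _).trans (hC 0))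
  have hB0 : 0 < B := add_pos_of_pos_of_nonneg (hS.c₀_pos.trans_le hCc) (by positivity)
  let a : Option (E d) → E d → ℝ := fun o => match o with
    | none => fun x => 1 - B⁻¹ * (S.c x + h⁻¹ ^ 2 * ∑ lam ∈ S.dirs, chi S h lam x)
    | some lam => fun x => (B⁻¹ * h⁻¹ ^ 2) * chi S h lam x
  let y : Option (E d) → E d := fun o => match o with
    | none => 0
    | some lam => h • lam
  obtain ⟨v, hv, hveq⟩ := exists_smooth_fixedPoint (s := Finset.insertNone S.dirs) (a := a) (y := y)
    (g := fun x => B⁻¹ * f x) (θ := 1 - B⁻¹ * c₀)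
    (by
      intro o ho
      cases o with
      | none =>
        exact (SB_const 1).sub ((hc.add ((SB.sum hchi).const_mul _)).const_mul _)
      | some lam => exact (hchi lam (by simpa using ho)).const_mul _)
    (hf.const_mul _)
    (by
      intro o ho x
      cases o with
      | none =>
        have h1 : S.c x + h⁻¹ ^ 2 * ∑ lam ∈ S.dirs, chi S h lam x ≤ B :=
          add_le_add ((le_abs_self _).trans (hC x))
            (mul_le_mul_of_nonneg_left (hX x) (by positivity))
        have h2 := mul_le_mul_of_nonneg_left h1 (inv_nonneg.2 hB0.le)
        rw [inv_mul_cancel₀ hB0.ne'] at h2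
        simpa [a] using h2
      | some lam =>
        exact mul_nonneg (by positivity) (hS.chi_nonneg lam (by simpa using ho) x))
    (by
      intro x
      rw [Finset.sum_insertNone]
      simp only [a, ← Finset.mul_sum]
      have := mul_le_mul_of_nonneg_left (hS.c_ge x) (inv_nonneg.2 hB0.le)
      linarith)
    (by
      have : 0 < B⁻¹ * c₀ := mul_pos (inv_pos.2 hB0) hS.c₀_pos
      linarith)
  refine ⟨v, hv, fun x => ?_⟩
  have h1 := hveq x
  rw [Finset.sum_insertNone] at h1
  simp only [a, y, add_zero] at h1
  rw [opLh_eq, opM_eq S hh.ne']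
  have h2 : ∑ lam ∈ S.dirs, B⁻¹ * h⁻¹ ^ 2 * chi S h lam x * v (x + h • lam)
      = B⁻¹ * ((∑ lam ∈ S.dirs, h⁻¹ ^ 2 * chi S h lam x * (v (x + h • lam) - v x))
        + (h⁻¹ ^ 2 * ∑ lam ∈ S.dirs, chi S h lam x) * v x) := by
    rw [Finset.mul_sum, Finset.sum_mul, ← Finset.sum_add_distrib, Finset.mul_sum]
    exact Finset.sum_congr rfl fun _ _ => by ring
  rw [h2] at h1
  have h3 : B⁻¹ * (((∑ lam ∈ S.dirs, h⁻¹ ^ 2 * chi S h lam x * (v (x + h • lam) - v x))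
      - S.c x * v x) + f x) = 0 := by linear_combination -h1
  exact (mul_eq_zero.1 h3).resolve_left (inv_ne_zero hB0.ne')

end

end FDRichardson

open MeasureTheory
open scoped ContDiff

namespace FDRichardson

noncomputable section

variable {d : ℕ} {ι : Type*}

/-- Linear operators on smooth functions that commute with translations and derivatives. -/
structure LTI (T : (E d → ℝ) → E d → ℝ) : Prop where
  smooth : ∀ {φ}, ContDiff ℝ ∞ φ → ContDiff ℝ ∞ (T φ)
  add : ∀ {φ ψ}, ContDiff ℝ ∞ φ → ContDiff ℝ ∞ ψ →
    T (fun x => φ x + ψ x) = fun x => T φ x + T ψ x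
  const_mul : ∀ {φ}, ContDiff ℝ ∞ φ → ∀ a : ℝ, T (fun x => a * φ x) = fun x => a * T φ x
  tr : ∀ {φ}, ContDiff ℝ ∞ φ → ∀ y, T (fun x => φ (x + y)) = fun x => T φ (x + y)
  pd : ∀ {φ}, ContDiff ℝ ∞ φ → ∀ i, T (pderiv i φ) = pderiv i (T φ)

namespace LTI
variable {T U : (E d → ℝ) → E d → ℝ} {φ ψ : E d → ℝ}

lemma sub (hT : LTI T) (hφ : ContDiff ℝ ∞ φ) (hψ : ContDiff ℝ ∞ ψ) :
    T (fun x => φ x - ψ x) = fun x => T φ x - T ψ x := by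
  have h1 := hT.add hφ ((contDiff_const (c := (-1 : ℝ))).mul hψ)
  rw [hT.const_mul hψ] at h1
  have e : (fun x => φ x - ψ x) = fun x => φ x + (-1) * ψ x := by funext x; ring
  rw [e, h1]; funext x; ring

lemma zero (hT : LTI T) : T (fun _ => 0) = fun _ => 0 := by
  have := hT.const_mul (φ := fun _ => 0) contDiff_const 0
  simpa using this

lemma sum (hT : LTI T) {s : Finset ι} {φ : ι → E d → ℝ} (hφ : ∀ k ∈ s, ContDiff ℝ ∞ (φ k)) :
    T (fun x => ∑ k ∈ s, φ k x) = fun x => ∑ k ∈ s, T (φ k) x := by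
  classical
  induction s using Finset.induction_on with
  | empty => simpa using hT.zero
  | insert a s ha ih =>
    have h1 : ∀ k ∈ s, ContDiff ℝ ∞ (φ k) := fun k hk => hφ k (Finset.mem_insert_of_mem hk)
    simp only [Finset.sum_insert ha]
    rw [hT.add (hφ a (Finset.mem_insert_self _ _)) (ContDiff.sum h1), ih h1]

lemma diffQ (hT : LTI T) (hφ : ContDiff ℝ ∞ φ) (t : ℝ) (y : E d) :
    T (diffQ t y φ) = FDRichardson.diffQ t y (T φ) := by
  unfold FDRichardson.diffQ
  rw [hT.const_mul ((contDiff_tr hφ _).sub hφ), hT.sub (contDiff_tr hφ _) hφ, hT.tr hφ]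

lemma shift (hT : LTI T) (hφ : ContDiff ℝ ∞ φ) (h : ℝ) (a : E d ⊕ Fin d) :
    T (shift h a φ) = FDRichardson.shift h a (T φ) := by
  cases a with
  | inl lam => exact hT.tr hφ _
  | inr i => rfl

lemma dbar (hT : LTI T) (hφ : ContDiff ℝ ∞ φ) (τ : E d → ℝ) (τ₀ h : ℝ) (a : E d ⊕ Fin d) :
    T (dbar τ τ₀ h a φ) = FDRichardson.dbar τ τ₀ h a (T φ) := by
  cases a with
  | inl lam =>
    unfold FDRichardson.dbar
    rw [hT.const_mul ((contDiff_tr hφ _).sub hφ), hT.sub (contDiff_tr hφ _) hφ, hT.tr hφ]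
  | inr i =>
    unfold FDRichardson.dbar
    rw [hT.const_mul (contDiff_pderiv hφ i), hT.pd hφ]

lemma comp (hT : LTI T) (hU : LTI U) : LTI (fun φ => T (U φ)) where
  smooth h := hT.smooth (hU.smooth h)
  add h h' := by rw [hU.add h h', hT.add (hU.smooth h) (hU.smooth h')]
  const_mul h a := by rw [hU.const_mul h, hT.const_mul (hU.smooth h)]
  tr h y := by rw [hU.tr h, hT.tr (hU.smooth h)]
  pd h i := by rw [hU.pd h, hT.pd (hU.smooth h)]

end LTI

lemma contDiff_dbar {φ : E d → ℝ} (hφ : ContDiff ℝ ∞ φ) (τ : E d → ℝ) (τ₀ h : ℝ)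
    (a : E d ⊕ Fin d) : ContDiff ℝ ∞ (dbar τ τ₀ h a φ) := by
  cases a with
  | inl lam => exact contDiff_const.mul ((contDiff_tr hφ _).sub hφ)
  | inr i => exact contDiff_const.mul (contDiff_pderiv hφ i)

lemma SB.dbar {φ : E d → ℝ} (hφ : SB φ) (τ : E d → ℝ) (τ₀ h : ℝ) (a : E d ⊕ Fin d) :
    SB (dbar τ τ₀ h a φ) := by
  cases a with
  | inl lam => exact ((hφ.tr _).sub hφ).const_mul _
  | inr i => exact (hφ.pd i).const_mul _

lemma lti_dbar (τ : E d → ℝ) (τ₀ h : ℝ) (a : E d ⊕ Fin d) : LTI (dbar τ τ₀ h a) where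
  smooth hφ := contDiff_dbar hφ τ τ₀ h a
  add {φ ψ} hφ hψ := by
    cases a with
    | inl lam => funext x; simp only [dbar]; ring
    | inr i =>
      funext x
      simp only [dbar, pderiv_add (differentiable_of_smooth hφ) (differentiable_of_smooth hψ)]
      ring
  const_mul hφ b := by
    cases a with
    | inl lam => funext x; simp only [dbar]; ring
    | inr i =>
      funext x
      simp only [dbar, pderiv_const_mul (differentiable_of_smooth hφ)]; ring
  tr {φ} hφ y := by
    cases a with
    | inl lam => funext x; simp only [dbar, add_right_comm]
    | inr i => funext x; simp only [dbar, pderiv_tr]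
  pd {φ} hφ i := by
    cases a with
    | inl lam =>
      simp only [dbar]
      rw [pderiv_const_mul (differentiable_of_smooth ((contDiff_tr hφ _).sub hφ)),
        pderiv_sub (differentiable_of_smooth (contDiff_tr hφ _)) (differentiable_of_smooth hφ),
        pderiv_tr]
    | inr j =>
      simp only [dbar]
      rw [pderiv_const_mul (differentiable_of_smooth (contDiff_pderiv hφ j)), pderiv_comm hφ]

lemma lti_id : LTI (fun φ : E d → ℝ => φ) := ⟨id, fun _ _ => rfl, fun _ _ => rfl,
  fun _ _ => rfl, fun _ _ => rfl⟩

/-- Iterated operators `δ̄` along a word, the head of the word acting first. -/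
def dwd (τ : E d → ℝ) (τ₀ h : ℝ) : List (E d ⊕ Fin d) → (E d → ℝ) → E d → ℝ
  | [], φ => φ
  | a :: w, φ => dwd τ τ₀ h w (dbar τ τ₀ h a φ)

/-- The displacement of the shift along a symbol. -/
def svec (h : ℝ) : E d ⊕ Fin d → E d
  | Sum.inl lam => h • lam
  | Sum.inr _ => 0

/-- The total displacement along a word. -/
def svecs (h : ℝ) (w : List (E d ⊕ Fin d)) : E d := (w.map (svec h)).sum

lemma shift_eq (h : ℝ) (a : E d ⊕ Fin d) (φ : E d → ℝ) :
    shift h a φ = fun x => φ (x + svec h a) := by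
  cases a with
  | inl lam => rfl
  | inr i => funext x; simp [shift, svec]

section words
variable {α : Type*}

/-- The words of length `n` over a finite alphabet. -/
def words (s : Finset α) : ℕ → Finset (List α)
  | 0 => {[]}
  | n + 1 => (s ×ˢ words s n).map
      ⟨fun p => p.1 :: p.2, fun p q h => by simpa [Prod.ext_iff] using h⟩

lemma sum_words_zero {M : Type*} [AddCommMonoid M] (s : Finset α) (F : List α → M) :
    ∑ w ∈ words s 0, F w = F [] := by simp [words]

lemma sum_words_succ {M : Type*} [AddCommMonoid M] (s : Finset α) (n : ℕ) (F : List α → M) :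
    ∑ w ∈ words s (n + 1), F w = ∑ a ∈ s, ∑ w ∈ words s n, F (a :: w) := by
  rw [words, Finset.sum_map, Finset.sum_product]; rfl

lemma sum_words_append {M : Type*} [AddCommMonoid M] (s : Finset α) (i j : ℕ) (F : List α → M) :
    ∑ I ∈ words s i, ∑ J ∈ words s j, F (I ++ J) = ∑ w ∈ words s (i + j), F w := by
  induction i generalizing F with
  | zero => simp [sum_words_zero]
  | succ i ih =>
    rw [sum_words_succ, Nat.succ_add, sum_words_succ]
    exact Finset.sum_congr rfl fun a _ => by simpa using ih fun w => F (a :: w)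

end words

section dwd
variable {τ : E d → ℝ} {τ₀ h : ℝ} {φ ψ : E d → ℝ}

lemma lti_dwd (w : List (E d ⊕ Fin d)) : LTI (dwd τ τ₀ h w) := by
  induction w with
  | nil => exact lti_id
  | cons a w ih => exact ih.comp (lti_dbar τ τ₀ h a)

lemma SB.dwd (hφ : SB φ) (w : List (E d ⊕ Fin d)) : SB (dwd τ τ₀ h w φ) := by
  induction w generalizing φ with
  | nil => exact hφ
  | cons a w ih => exact ih (hφ.dbar τ τ₀ h a)

lemma dbar_comm (hφ : ContDiff ℝ ∞ φ) (a b : E d ⊕ Fin d) :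
    dbar τ τ₀ h a (dbar τ τ₀ h b φ) = dbar τ τ₀ h b (dbar τ τ₀ h a φ) :=
  (lti_dbar τ τ₀ h a).dbar hφ τ τ₀ h b

lemma dwd_perm {w w' : List (E d ⊕ Fin d)} (hw : w.Perm w') (hφ : ContDiff ℝ ∞ φ) :
    dwd τ τ₀ h w φ = dwd τ τ₀ h w' φ := by
  induction hw generalizing φ with
  | nil => rfl
  | cons a _ ih => exact ih (contDiff_dbar hφ τ τ₀ h a)
  | swap a b w => simp only [dwd]; rw [dbar_comm hφ]
  | trans _ _ ih1 ih2 => rw [ih1 hφ, ih2 hφ]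

lemma dbar_mul (hφ : ContDiff ℝ ∞ φ) (hψ : ContDiff ℝ ∞ ψ) (a : E d ⊕ Fin d) :
    dbar τ τ₀ h a (fun x => φ x * ψ x)
      = fun x => φ x * dbar τ τ₀ h a ψ x + dbar τ τ₀ h a φ x * shift h a ψ x := by
  cases a with
  | inl lam => funext x; simp only [dbar, shift]; ring
  | inr i =>
    funext x
    simp only [dbar, shift,
      pderiv_mul (differentiable_of_smooth hφ) (differentiable_of_smooth hψ)]
    ring

/-- The Leibniz formula for symmetric sums over words. -/
theorem sum_words_leibniz (s : Finset (E d ⊕ Fin d)) (n : ℕ) (u : List (E d ⊕ Fin d) → ℝ)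
    (hu : ∀ w w', w.Perm w' → u w = u w') (hφ : ContDiff ℝ ∞ φ) (hψ : ContDiff ℝ ∞ ψ) (x : E d) :
    ∑ w ∈ words s n, u w * dwd τ τ₀ h w (fun x => φ x * ψ x) x
      = ∑ p ∈ Finset.HasAntidiagonal.antidiagonal n, n.choose p.1 •
          ∑ I ∈ words s p.1, ∑ J ∈ words s p.2,
            u (I ++ J) * (dwd τ τ₀ h I φ x * dwd τ τ₀ h J ψ (x + svecs h I)) := by
  induction n generalizing φ ψ u with
  | zero => simp [sum_words_zero, dwd, svecs]
  | succ n ih =>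
    rw [Finset.sum_antidiagonal_choose_succ_nsmul (fun i j => ∑ I ∈ words s i, ∑ J ∈ words s j,
            u (I ++ J) * (dwd τ τ₀ h I φ x * dwd τ τ₀ h J ψ (x + svecs h I)))]
    have h1 : ∀ a, ∀ w, dwd τ τ₀ h (a :: w) (fun x => φ x * ψ x) x
        = dwd τ τ₀ h w (fun x => φ x * dbar τ τ₀ h a ψ x) x
          + dwd τ τ₀ h w (fun x => dbar τ τ₀ h a φ x * shift h a ψ x) x := by
      intro a w
      have hs : ContDiff ℝ ∞ (shift h a ψ) := by rw [shift_eq]; exact contDiff_tr hψ _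
      rw [dwd, dbar_mul hφ hψ, (lti_dwd w).add (hφ.mul (contDiff_dbar hψ _ _ _ _))
        ((contDiff_dbar hφ _ _ _ _).mul hs)]
    rw [sum_words_succ]
    simp only [h1, mul_add, Finset.sum_add_distrib]
    have hua : ∀ a, ∀ w w', List.Perm w w' → u (a :: w) = u (a :: w') :=
      fun a w w' hw => hu _ _ (hw.cons a)
    congr 1
    · rw [Finset.sum_congr rfl fun a _ => ih (fun w => u (a :: w)) (hua a) hφ
        (contDiff_dbar hψ τ τ₀ h a), Finset.sum_comm]
      refine Finset.sum_congr rfl fun p _ => ?_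
      rw [← Finset.smul_sum]
      congr 1
      rw [Finset.sum_comm]
      refine Finset.sum_congr rfl fun I _ => ?_
      rw [sum_words_succ]
      refine Finset.sum_congr rfl fun a _ => Finset.sum_congr rfl fun J _ => ?_
      rw [hu _ _ (List.perm_middle (a := a) (l₁ := I) (l₂ := J)).symm, dwd]
    · have hs : ∀ a, ContDiff ℝ ∞ (shift h a ψ) := fun a => by
        rw [shift_eq]; exact contDiff_tr hψ _
      rw [Finset.sum_congr rfl fun a _ => ih (fun w => u (a :: w)) (hua a)
        (contDiff_dbar hφ τ τ₀ h a) (hs a), Finset.sum_comm]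
      refine Finset.sum_congr rfl fun p hp => ?_
      rw [← Finset.smul_sum]
      congr 1
      · exact Nat.choose_symm_of_eq_add
          (Finset.HasAntidiagonal.mem_antidiagonal.1 hp).symm
      rw [sum_words_succ]
      refine Finset.sum_congr rfl fun a _ => Finset.sum_congr rfl fun I _ =>
        Finset.sum_congr rfl fun J _ => ?_
      rw [(lti_dwd J).shift hψ, shift_eq, List.cons_append, dwd]
      simp only [svecs, List.map_cons, List.sum_cons]
      rw [add_assoc, add_comm (List.sum _)]

end dwd

/-- The weight of a symbol in `Λ`. -/
def wt (τ : E d → ℝ) (τ₀ : ℝ) : E d ⊕ Fin d → ℝ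
  | Sum.inl lam => d * (τ lam ^ 2 * ‖lam‖ ^ 2)
  | Sum.inr _ => τ₀ ^ 2

section bounds
variable {τ : E d → ℝ} {τ₀ h : ℝ} {n : ℕ} {B : ℝ} {s : Finset ι} {φ : ι → E d → ℝ}

lemma wt_nonneg (a : E d ⊕ Fin d) : 0 ≤ wt τ τ₀ a := by
  cases a with
  | inl lam => simp only [wt]; positivity
  | inr i => simp only [wt]; positivity

lemma CBf.const_mul (hB : CBf n B s φ) (hφ : ∀ k ∈ s, ContDiff ℝ ∞ (φ k)) (a : ℝ) :
    CBf n (a ^ 2 * B) s (fun k x => a * φ k x) := by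
  intro w hw x
  rw [Finset.sum_congr rfl fun k hk => by rw [Dw_const_mul (hφ k hk), mul_pow], ← Finset.mul_sum]
  exact mul_le_mul_of_nonneg_left (hB w hw x) (sq_nonneg a)

lemma CBf.dq (hh : h ≠ 0) (hB : CBf (n + 1) B s φ) (hφ : ∀ k ∈ s, ContDiff ℝ ∞ (φ k))
    (y : E d) : CBf n (d * ‖y‖ ^ 2 * B) s (fun k => diffQ h y (φ k)) := by
  have h1 := (hB.taylorRem (r := 1) hφ (h • y)).const_mul
    (fun k hk => contDiff_taylorRem (hφ k hk) 1 (h • y)) h⁻¹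
  simp only [diffQ_eq_taylorRem]
  refine h1.mono le_rfl (le_of_eq ?_)
  rw [pow_one, norm_smul, mul_pow, Real.norm_eq_abs, sq_abs]
  field_simp

lemma CBf.dbar (hh : h ≠ 0) (hB : CBf (n + 1) B s φ) (hφ : ∀ k ∈ s, ContDiff ℝ ∞ (φ k))
    (a : E d ⊕ Fin d) : CBf n (wt τ τ₀ a * B) s (fun k => dbar τ τ₀ h a (φ k)) := by
  cases a with
  | inl lam =>
    have h1 := (hB.dq hh hφ lam).const_mul
      (fun k hk => contDiff_const.mul ((contDiff_tr (hφ k hk) _).sub (hφ k hk))) (τ lam)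
    have e : (fun k => FDRichardson.dbar τ τ₀ h (Sum.inl lam) (φ k))
        = fun k x => τ lam * diffQ h lam (φ k) x := by
      funext k x; simp only [FDRichardson.dbar, diffQ]; ring
    rw [e]
    refine h1.mono le_rfl (le_of_eq ?_)
    simp only [wt]; ring
  | inr i =>
    exact (hB.pd i).const_mul (fun k hk => contDiff_pderiv (hφ k hk) i) τ₀

/-- Bounds for all `δ̄_w` with `w` of a given length. -/
lemma CBf.dwd (hh : h ≠ 0) (Λ : Finset (E d ⊕ Fin d)) (j : ℕ) (hB : CBf (n + j) B s φ)
    (hφ : ∀ k ∈ s, ContDiff ℝ ∞ (φ k)) :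
    CBf n ((∑ a ∈ Λ, wt τ τ₀ a) ^ j * B) (words Λ j ×ˢ s)
      (fun p => dwd τ τ₀ h p.1 (φ p.2)) := by
  intro w hw x
  rw [Finset.sum_product]
  induction j generalizing φ B with
  | zero => simpa [sum_words_zero, FDRichardson.dwd] using hB w hw x
  | succ j ih =>
    rw [sum_words_succ]
    have h1 : ∀ a ∈ Λ, ∑ I ∈ words Λ j, ∑ k ∈ s,
        (Dw w (FDRichardson.dwd τ τ₀ h (a :: I) (φ k)) x) ^ 2
          ≤ (∑ a ∈ Λ, wt τ τ₀ a) ^ j * (wt τ τ₀ a * B) := by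
      intro a _
      have hB' : CBf (n + j + 1) B s φ := hB
      have h2 := ih (φ := fun k => FDRichardson.dbar τ τ₀ h a (φ k)) (B := wt τ τ₀ a * B)
        (CBf.dbar hh hB' hφ a) (fun k hk => contDiff_dbar (hφ k hk) τ τ₀ h a)
      exact h2
    refine (Finset.sum_le_sum h1).trans (le_of_eq ?_)
    rw [← Finset.mul_sum, ← Finset.sum_mul]; ring

end bounds

lemma abs_sum_mul_le_sqrt {s : Finset ι} {u t : ι → ℝ} {V T : ℝ} (hu : ∑ i ∈ s, u i ^ 2 ≤ V)
    (ht : ∑ i ∈ s, t i ^ 2 ≤ T) : |∑ i ∈ s, u i * t i| ≤ Real.sqrt V * Real.sqrt T := by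
  have hV : 0 ≤ V := (Finset.sum_nonneg fun _ _ => sq_nonneg _).trans hu
  rw [← Real.sqrt_mul hV, ← Real.sqrt_sq_eq_abs]
  exact Real.sqrt_le_sqrt ((Finset.sum_mul_sq_le_sq_mul_sq _ _ _).trans
    (mul_le_mul hu ht (Finset.sum_nonneg fun _ _ => sq_nonneg _) hV))

lemma abs_bilinear_sum_le {α β γ : Type*} {s : Finset α} {t : Finset β} {r : Finset γ}
    {u : α → β → ℝ} {A : α → γ → ℝ} {B : α → β → γ → ℝ} {V A₀ B₀ : ℝ}
    (hu : ∑ i ∈ s, ∑ j ∈ t, u i j ^ 2 ≤ V) (hA : ∑ i ∈ s, ∑ k ∈ r, A i k ^ 2 ≤ A₀)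
    (hB : ∀ i ∈ s, ∑ j ∈ t, ∑ k ∈ r, B i j k ^ 2 ≤ B₀) (hB₀ : 0 ≤ B₀) :
    |∑ i ∈ s, ∑ j ∈ t, u i j * ∑ k ∈ r, A i k * B i j k|
      ≤ Real.sqrt V * Real.sqrt (A₀ * B₀) := by
  rw [← Finset.sum_product']
  rw [← Finset.sum_product'] at hu
  refine abs_sum_mul_le_sqrt (u := fun p : α × β => u p.1 p.2)
    (t := fun p => ∑ k ∈ r, A p.1 k * B p.1 p.2 k) hu ?_
  rw [Finset.sum_product]
  have h1 : ∀ i ∈ s, ∑ j ∈ t, (∑ k ∈ r, A i k * B i j k) ^ 2 ≤ (∑ k ∈ r, A i k ^ 2) * B₀ := by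
    intro i hi
    refine (Finset.sum_le_sum fun j _ => Finset.sum_mul_sq_le_sq_mul_sq _ _ _).trans ?_
    rw [← Finset.mul_sum]
    exact mul_le_mul_of_nonneg_left (hB i hi) (Finset.sum_nonneg fun _ _ => sq_nonneg _)
  refine (Finset.sum_le_sum h1).trans ?_
  rw [← Finset.sum_mul]
  exact mul_le_mul_of_nonneg_right hA hB₀

end

end FDRichardson

open MeasureTheory
open scoped ContDiff

namespace FDRichardson

noncomputable section

variable {d : ℕ} {ι : Type*}

/-- The parameters on which the constants of the estimates depend. -/
structure Params where
  m : ℕ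
  δ : ℝ
  K : ℝ
  τ₀ : ℝ
  c₀ : ℝ
  a : ℝ
  b : ℝ
  Mb : ℝ
  one_le_m : 1 ≤ m
  δ_pos : 0 < δ
  δ_le : δ ≤ 1
  K_pos : 0 < K
  τ₀_pos : 0 < τ₀
  c₀_pos : 0 < c₀

/-- Difference schemes with smooth coefficients that satisfy the structural conditions in the form
in which they enter the estimates. -/
structure Scheme (P : Params) (h₀ : ℝ) (S : Coeffs d) (τ : E d → ℝ) : Prop where
  q_sb : ∀ lam ∈ S.dirs, SB (S.q lam)
  p_sb : ∀ lam ∈ S.dirs, SB (S.p lam)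
  c_sb : SB S.c
  q_bd : CBf P.m (P.Mb ^ 2) S.dirs S.q
  p_bd : CBf P.m (P.Mb ^ 2) S.dirs S.p
  c_bd : CB P.m P.Mb S.c
  sum_sq : ∑ lam ∈ S.dirs, ‖lam‖ ^ 2 ≤ P.a ^ 2
  wsum_sq : ∑ lam ∈ S.dirs, τ lam ^ 2 * ‖lam‖ ^ 2 ≤ P.b ^ 2
  chi_nonneg : ∀ h, 0 < h → h ≤ h₀ → ∀ lam ∈ S.dirs, ∀ x, 0 ≤ chi S h lam x
  drift : ∀ x, ∑ lam ∈ S.dirs, S.q lam x • lam = 0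
  c_ge : ∀ x, P.c₀ ≤ S.c x
  cond1 : ∀ h, 0 < h → h ≤ h₀ → ∀ φ : E d → ℝ, SB φ → ∀ B,
    (∀ y, ∑ lam ∈ fullDirs S, |dbar τ P.τ₀ h lam φ y| ^ 2 ≤ B) → ∀ x,
      (P.m : ℝ) * formA S τ P.τ₀ h φ x
        ≤ (1 - P.δ) * ∑ lam ∈ fullDirs S, formQ S h (dbar τ P.τ₀ h lam φ) x
          + P.K * formQ S h φ x + 2 * (1 - P.δ) * S.c x * B
  cond2 : ∀ h, 0 < h → h ≤ h₀ → ∀ n : ℕ, 1 ≤ n → n ≤ P.m →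
    ∀ (s : Finset (List (E d ⊕ Fin d))) (φ : List (E d ⊕ Fin d) → E d → ℝ),
    (∀ k ∈ s, SB (φ k)) → ∀ B B',
    (∀ y, ∑ k ∈ s, ∑ μ ∈ fullDirs S ×ˢ fullDirs S, |dbar2 τ P.τ₀ h μ (φ k) y| ^ 2 ≤ B) →
    (∀ y, ∑ k ∈ s, ∑ lam ∈ fullDirs S, |dbar τ P.τ₀ h lam (φ k) y| ^ 2 ≤ B') → ∀ x,
      ∑ k ∈ s, ((n : ℝ) * ∑ ν ∈ fullDirs S, formA S τ P.τ₀ h (dbar τ P.τ₀ h ν (φ k)) x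
          + (n : ℝ) * ((n : ℝ) - 1) * ∑ μ ∈ fullDirs S ×ˢ fullDirs S,
              dbar2 τ P.τ₀ h μ (φ k) x * opQ2 S τ P.τ₀ h μ (shift2 h μ (φ k)) x)
        ≤ (1 - P.δ) * ∑ k ∈ s, ∑ μ ∈ fullDirs S ×ˢ fullDirs S,
              formQ S h (dbar2 τ P.τ₀ h μ (φ k)) x
          + P.K * ∑ k ∈ s, ∑ lam ∈ fullDirs S, formQ S h (dbar τ P.τ₀ h lam (φ k)) x
          + 2 * (1 - P.δ) * S.c x * B + P.K * B'

/-- A bound for the sum of the weights of the symbols. -/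
def Params.W (P : Params) (d : ℕ) : ℝ := d * P.b ^ 2 + d * P.τ₀ ^ 2

lemma Params.W_nonneg (P : Params) (d : ℕ) : 0 ≤ P.W d := by
  unfold Params.W; positivity

lemma opM_sq (S : Coeffs d) {h : ℝ} (hh : h ≠ 0) (φ : E d → ℝ) (x : E d) :
    opM S h (fun x => φ x ^ 2) x = 2 * φ x * opM S h φ x + formQ S h φ x := by
  rw [opM_eq S hh, opM_eq S hh]
  unfold formQ diffQ
  rw [Finset.mul_sum, ← Finset.sum_add_distrib]
  exact Finset.sum_congr rfl fun lam _ => by ring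

namespace Scheme
variable {P : Params} {h₀ h : ℝ} {S : Coeffs d} {τ : E d → ℝ}

lemma mono (hS : Scheme P h₀ S τ) (hh : 0 < h) (hh₀ : h ≤ h₀) : Mono S h P.c₀ where
  h_pos := hh
  c₀_pos := P.c₀_pos
  chi_nonneg := hS.chi_nonneg h hh hh₀
  chi_bdd := by
    have : SB (fun x => ∑ lam ∈ S.dirs, chi S h lam x) :=
      SB.sum fun lam hl => (hS.q_sb lam hl).add ((hS.p_sb lam hl).const_mul h)
    obtain ⟨C, hC⟩ := this.bdd
    exact ⟨C, fun x => (le_abs_self _).trans (hC x)⟩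
  c_ge := hS.c_ge

lemma sum_wt_le (hS : Scheme P h₀ S τ) : ∑ a ∈ fullDirs S, wt τ P.τ₀ a ≤ P.W d := by
  unfold fullDirs Params.W
  rw [Finset.sum_disjSum]
  simp only [wt, Finset.sum_const, Finset.card_univ, Fintype.card_fin, nsmul_eq_mul]
  rw [← Finset.mul_sum]
  exact add_le_add (mul_le_mul_of_nonneg_left hS.wsum_sq (Nat.cast_nonneg d)) le_rfl

lemma sum_wt_nonneg : 0 ≤ ∑ a ∈ fullDirs S, wt τ P.τ₀ a :=
  Finset.sum_nonneg fun a _ => wt_nonneg a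

lemma formQ_nonneg (hS : Scheme P h₀ S τ) (hh : 0 < h) (hh₀ : h ≤ h₀) (φ : E d → ℝ) (x : E d) :
    0 ≤ formQ S h φ x :=
  Finset.sum_nonneg fun lam hl => mul_nonneg (hS.chi_nonneg h hh hh₀ lam hl x) (sq_nonneg _)

lemma c_le (hS : Scheme P h₀ S τ) (x : E d) : S.c x ≤ P.Mb :=
  (le_abs_self _).trans (hS.c_bd.bound x)

lemma sum_dwd_sq_le (hS : Scheme P h₀ S τ) (hh : 0 < h) {j n : ℕ} {B : ℝ} {s : Finset ι}
    {φ : ι → E d → ℝ} (hB : CBf (n + j) B s φ) (hφ : ∀ k ∈ s, ContDiff ℝ ∞ (φ k)) :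
    CBf n (P.W d ^ j * B) (words (fullDirs S) j ×ˢ s) (fun p => dwd τ P.τ₀ h p.1 (φ p.2)) :=
  (CBf.dwd hh.ne' (fullDirs S) j hB hφ).mono le_rfl
    (mul_le_mul_of_nonneg_right (pow_le_pow_left₀ sum_wt_nonneg hS.sum_wt_le _) hB.nonneg)

end Scheme

section terms
variable (S : Coeffs d) (τ : E d → ℝ) (τ₀ h : ℝ) (v : E d → ℝ) (x : E d)

/-- The contribution of the `p_λ` to the Leibniz formula. -/
def leibP (i j : ℕ) : ℝ := ∑ I ∈ words (fullDirs S) i, ∑ J ∈ words (fullDirs S) j,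
  dwd τ τ₀ h (I ++ J) v x * ∑ ν ∈ S.dirs,
    dwd τ τ₀ h I (S.p ν) x * diffQ h ν (dwd τ τ₀ h J v) (x + svecs h I)

/-- The contribution of the `q_λ` to the Leibniz formula. -/
def leibQ (i j : ℕ) : ℝ := ∑ I ∈ words (fullDirs S) i, ∑ J ∈ words (fullDirs S) j,
  dwd τ τ₀ h (I ++ J) v x * (h⁻¹ * ∑ ν ∈ S.dirs,
    dwd τ τ₀ h I (S.q ν) x * diffQ h ν (dwd τ τ₀ h J v) (x + svecs h I))

/-- The second order term of the Leibniz formula. -/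
def secondQ (j : ℕ) : ℝ := ∑ J ∈ words (fullDirs S) j, ∑ μ ∈ fullDirs S ×ˢ fullDirs S,
  dbar2 τ τ₀ h μ (dwd τ τ₀ h J v) x * opQ2 S τ τ₀ h μ (shift2 h μ (dwd τ τ₀ h J v)) x

variable {S τ τ₀ h v x}

lemma sum_leibniz_aux (hv : ContDiff ℝ ∞ v) {r : E d → E d → ℝ}
    (hr : ∀ ν ∈ S.dirs, ContDiff ℝ ∞ (r ν)) (n : ℕ) :
    ∑ w ∈ words (fullDirs S) n, dwd τ τ₀ h w v x *
        dwd τ τ₀ h w (fun x => ∑ ν ∈ S.dirs, r ν x * diffQ h ν v x) x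
      = ∑ p ∈ Finset.HasAntidiagonal.antidiagonal n, n.choose p.1 •
        ∑ I ∈ words (fullDirs S) p.1, ∑ J ∈ words (fullDirs S) p.2,
          dwd τ τ₀ h (I ++ J) v x * ∑ ν ∈ S.dirs,
            dwd τ τ₀ h I (r ν) x * diffQ h ν (dwd τ τ₀ h J v) (x + svecs h I) := by
  have hd : ∀ ν, ContDiff ℝ ∞ (diffQ h ν v) := fun ν =>
    contDiff_const.mul ((contDiff_tr hv _).sub hv)
  have h1 : ∀ w, dwd τ τ₀ h w (fun x => ∑ ν ∈ S.dirs, r ν x * diffQ h ν v x) x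
      = ∑ ν ∈ S.dirs, dwd τ τ₀ h w (fun x => r ν x * diffQ h ν v x) x := fun w =>
    congrFun ((lti_dwd w).sum fun ν hν => (hr ν hν).mul (hd ν)) x
  simp only [h1, Finset.mul_sum]
  rw [Finset.sum_comm, Finset.sum_congr rfl fun ν hν => sum_words_leibniz (fullDirs S) n
    (fun w => dwd τ τ₀ h w v x) (fun w w' hw => by rw [dwd_perm hw hv]) (hr ν hν) (hd ν) x,
    Finset.sum_comm]
  refine Finset.sum_congr rfl fun p _ => ?_
  rw [← Finset.smul_sum, Finset.sum_comm]
  congr 1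
  refine Finset.sum_congr rfl fun I _ => ?_
  rw [Finset.sum_comm]
  refine Finset.sum_congr rfl fun J _ => Finset.sum_congr rfl fun ν _ => ?_
  rw [(lti_dwd J).diffQ hv]

lemma sum_leibniz_opM (hv : ContDiff ℝ ∞ v) (hq : ∀ ν ∈ S.dirs, ContDiff ℝ ∞ (S.q ν))
    (hp : ∀ ν ∈ S.dirs, ContDiff ℝ ∞ (S.p ν)) (n : ℕ) :
    ∑ w ∈ words (fullDirs S) n, dwd τ τ₀ h w v x * dwd τ τ₀ h w (opM S h v) x
      = ∑ p ∈ Finset.HasAntidiagonal.antidiagonal n, (n.choose p.1 : ℝ) *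
        (leibQ S τ τ₀ h v x p.1 p.2 + leibP S τ τ₀ h v x p.1 p.2) := by
  have hd : ∀ ν, ContDiff ℝ ∞ (diffQ h ν v) := fun ν =>
    contDiff_const.mul ((contDiff_tr hv _).sub hv)
  have hQ : ContDiff ℝ ∞ (fun x => ∑ ν ∈ S.dirs, S.q ν x * diffQ h ν v x) :=
    ContDiff.sum fun ν hν => (hq ν hν).mul (hd ν)
  have hP : ContDiff ℝ ∞ (fun x => ∑ ν ∈ S.dirs, S.p ν x * diffQ h ν v x) :=
    ContDiff.sum fun ν hν => (hp ν hν).mul (hd ν)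
  have h1 : ∀ w, dwd τ τ₀ h w (opM S h v) x
      = h⁻¹ * dwd τ τ₀ h w (fun x => ∑ ν ∈ S.dirs, S.q ν x * diffQ h ν v x) x
        + dwd τ τ₀ h w (fun x => ∑ ν ∈ S.dirs, S.p ν x * diffQ h ν v x) x := by
    intro w
    have e : opM S h v = fun x => h⁻¹ * (∑ ν ∈ S.dirs, S.q ν x * diffQ h ν v x)
      + ∑ ν ∈ S.dirs, S.p ν x * diffQ h ν v x := rfl
    rw [e, (lti_dwd w).add (contDiff_const.mul hQ) hP, (lti_dwd w).const_mul hQ]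
  simp only [h1, mul_add, Finset.sum_add_distrib]
  congr 1
  · have := sum_leibniz_aux (τ := τ) (τ₀ := τ₀) (h := h) (x := x) hv hq n
    have h2 := congrArg (fun t => h⁻¹ * t) this
    simp only [Finset.mul_sum] at h2
    refine Eq.trans (Finset.sum_congr rfl fun w _ => ?_) (h2.trans ?_)
    · ring
    · refine Finset.sum_congr rfl fun p _ => ?_
      rw [nsmul_eq_mul, leibQ]
      simp only [Finset.mul_sum]
      refine Finset.sum_congr rfl fun I _ => Finset.sum_congr rfl fun J _ =>
        Finset.sum_congr rfl fun ν _ => ?_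
      ring
  · rw [sum_leibniz_aux hv hp n]
    simp only [nsmul_eq_mul, leibP]

lemma leib_zero (n : ℕ) : leibQ S τ τ₀ h v x 0 n + leibP S τ τ₀ h v x 0 n
    = ∑ w ∈ words (fullDirs S) n, dwd τ τ₀ h w v x * opM S h (dwd τ τ₀ h w v) x := by
  unfold leibQ leibP opM
  simp only [sum_words_zero, List.nil_append, dwd, svecs, List.map_nil, List.sum_nil, add_zero,
    mul_add, Finset.sum_add_distrib]

lemma leib_one (hv : ContDiff ℝ ∞ v) (n : ℕ) :
    leibQ S τ τ₀ h v x 1 n + leibP S τ τ₀ h v x 1 n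
    = (1 / 2) * ∑ J ∈ words (fullDirs S) n, formA S τ τ₀ h (dwd τ τ₀ h J v) x := by
  unfold leibQ leibP formA
  rw [← Finset.mul_sum, ← mul_assoc, show (1 / 2 : ℝ) * 2 = 1 by norm_num, one_mul,
    ← Finset.sum_add_distrib, Finset.sum_comm, sum_words_succ]
  refine Finset.sum_congr rfl fun a _ => ?_
  rw [sum_words_zero, ← Finset.sum_add_distrib]
  refine Finset.sum_congr rfl fun J _ => ?_
  rw [← mul_add]
  have e1 : dwd τ τ₀ h ([a] ++ J) v x = dbar τ τ₀ h a (dwd τ τ₀ h J v) x := by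
    rw [← (lti_dwd J).dbar hv]; rfl
  have e2 : ∀ ν, diffQ h ν (dwd τ τ₀ h J v) (x + svecs h [a])
      = diffQ h ν (shift h a (dwd τ τ₀ h J v)) x := by
    intro ν
    simp only [svecs, List.map_cons, List.map_nil, List.sum_cons, List.sum_nil, add_zero,
      shift_eq, diffQ]
    rw [add_right_comm]
  rw [e1]
  congr 1
  simp only [e2, opL0]
  rfl

lemma leibQ_two (hv : ContDiff ℝ ∞ v) (hq : ∀ ν ∈ S.dirs, ContDiff ℝ ∞ (S.q ν)) (n : ℕ) :
    leibQ S τ τ₀ h v x 2 n = secondQ S τ τ₀ h v x n := by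
  unfold leibQ secondQ
  rw [Finset.sum_comm (s := words (fullDirs S) n), Finset.sum_product, sum_words_succ]
  refine Finset.sum_congr rfl fun a _ => ?_
  rw [sum_words_succ]
  refine Finset.sum_congr rfl fun b _ => ?_
  rw [sum_words_zero]
  refine Finset.sum_congr rfl fun J _ => ?_
  have e1 : dwd τ τ₀ h ([a, b] ++ J) v x = dbar2 τ τ₀ h (a, b) (dwd τ τ₀ h J v) x := by
    rw [dbar2, ← (lti_dwd J).dbar hv, ← (lti_dwd J).dbar (contDiff_dbar hv _ _ _ _), dbar_comm hv]
    rfl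
  have e2 : ∀ ν, diffQ h ν (dwd τ τ₀ h J v) (x + svecs h [a, b])
      = diffQ h ν (shift2 h (a, b) (dwd τ τ₀ h J v)) x := by
    intro ν
    simp only [svecs, List.map_cons, List.map_nil, List.sum_cons, List.sum_nil, add_zero,
      shift2, shift_eq, diffQ]
    simp only [add_assoc, add_left_comm, add_comm]
  rw [e1, opQ2]
  congr 2
  refine Finset.sum_congr rfl fun ν hν => ?_
  rw [e2]
  congr 1
  rw [dbar2, dbar_comm (hq ν hν)]; rfl

end terms

section estimates
variable {P : Params} {h₀ h : ℝ} {S : Coeffs d} {τ : E d → ℝ} {v : E d → ℝ}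

lemma sum_words_append_sq (v : E d → ℝ) (x : E d) {i j n : ℕ} (hij : i + j = n) (τ₀ : ℝ) :
    ∑ I ∈ words (fullDirs S) i, ∑ J ∈ words (fullDirs S) j, dwd τ τ₀ h (I ++ J) v x ^ 2
      = ∑ w ∈ words (fullDirs S) n, dwd τ τ₀ h w v x ^ 2 := by
  subst hij
  exact sum_words_append (fullDirs S) i j fun w => dwd τ τ₀ h w v x ^ 2

lemma sum_norm_pow_four_le {s : Finset (E d)} {a : ℝ} (hs : ∑ lam ∈ s, ‖lam‖ ^ 2 ≤ a ^ 2) :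
    ∑ lam ∈ s, ‖lam‖ ^ 4 ≤ a ^ 4 := by
  have h1 : ∀ lam ∈ s, ‖lam‖ ^ 4 ≤ ‖lam‖ ^ 2 * a ^ 2 := fun lam hl => by
    have : ‖lam‖ ^ 2 ≤ a ^ 2 :=
      (Finset.single_le_sum (f := fun lam : E d => ‖lam‖ ^ 2) (fun _ _ => by positivity) hl).trans hs
    nlinarith [sq_nonneg ‖lam‖]
  refine (Finset.sum_le_sum h1).trans ?_
  rw [← Finset.sum_mul]
  nlinarith [sq_nonneg a]

lemma Scheme.sum_dwd_sq_le_at (hS : Scheme P h₀ S τ) (hh : 0 < h) {j : ℕ} {B : ℝ} {s : Finset ι}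
    {φ : ι → E d → ℝ} (hB : CBf j B s φ) (hφ : ∀ k ∈ s, ContDiff ℝ ∞ (φ k)) (x : E d) :
    ∑ I ∈ words (fullDirs S) j, ∑ k ∈ s, dwd τ P.τ₀ h I (φ k) x ^ 2 ≤ P.W d ^ j * B := by
  have := hS.sum_dwd_sq_le hh (n := 0) (j := j) (by simpa using hB) hφ [] le_rfl x
  rwa [Finset.sum_product] at this

lemma Scheme.abs_leibP_le (hS : Scheme P h₀ S τ) (hh : 0 < h) (hv : SB v) {i j n : ℕ}
    {e : ℝ} (hE : CB (j + 1) e v) (hij : i + j = n) (him : i ≤ P.m) (x : E d) :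
    |leibP S τ P.τ₀ h v x i j|
      ≤ Real.sqrt (∑ w ∈ words (fullDirs S) n, dwd τ P.τ₀ h w v x ^ 2)
        * (Real.sqrt (P.W d ^ n * P.Mb ^ 2 * (d * P.a ^ 2)) * e) := by
  have hW := P.W_nonneg d
  have hfam : CBf 1 (P.W d ^ j * e ^ 2) (words (fullDirs S) j ×ˢ ({()} : Finset Unit))
      (fun p => dwd τ P.τ₀ h p.1 v) :=
    hS.sum_dwd_sq_le hh (n := 1) (j := j) (φ := fun _ : Unit => v)
      (hE.toCBf.mono (by omega) le_rfl) (fun _ _ => hv.1)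
  have hB : ∀ I ∈ words (fullDirs S) i, ∑ J ∈ words (fullDirs S) j, ∑ ν ∈ S.dirs,
      diffQ h ν (dwd τ P.τ₀ h J v) (x + svecs h I) ^ 2 ≤ d * P.a ^ 2 * (P.W d ^ j * e ^ 2) := by
    intro I _
    rw [Finset.sum_comm]
    have h1 : ∀ ν ∈ S.dirs, ∑ J ∈ words (fullDirs S) j,
        diffQ h ν (dwd τ P.τ₀ h J v) (x + svecs h I) ^ 2
          ≤ d * ‖ν‖ ^ 2 * (P.W d ^ j * e ^ 2) := by
      intro ν _
      have := CBf.dq hh.ne' (n := 0) hfam (fun p _ => (hv.dwd p.1).1) ν [] le_rfl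
        (x + svecs h I)
      rw [Finset.sum_product] at this
      simpa using this
    refine (Finset.sum_le_sum h1).trans ?_
    rw [← Finset.sum_mul, ← Finset.mul_sum]
    exact mul_le_mul_of_nonneg_right (mul_le_mul_of_nonneg_left hS.sum_sq (Nat.cast_nonneg d))
      (by positivity)
  have := abs_bilinear_sum_le (le_of_eq (sum_words_append_sq (S := S) (τ := τ) (h := h) v x hij P.τ₀))
    (hS.sum_dwd_sq_le_at hh (hS.p_bd.mono him le_rfl) (fun k hk => (hS.p_sb k hk).1) x) hB
    (by positivity)
  refine this.trans (le_of_eq ?_)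
  congr 1
  rw [← Real.sqrt_sq hE.nonneg, ← Real.sqrt_mul (by positivity), Real.sqrt_sq hE.nonneg, ← hij,
    pow_add]
  congr 1; ring

lemma Scheme.sum_dwd_q_dirD (hS : Scheme P h₀ S τ) (I : List (E d ⊕ Fin d)) (x z : E d)
    (ψ : E d → ℝ) : ∑ ν ∈ S.dirs, dwd τ P.τ₀ h I (S.q ν) x * dirD ν ψ z = 0 := by
  have h1 : ∀ k : Fin d, ∑ ν ∈ S.dirs, ν k * dwd τ P.τ₀ h I (S.q ν) x = 0 := by
    intro k
    have hf : (fun x => ∑ ν ∈ S.dirs, ν k * S.q ν x) = fun _ => 0 := by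
      funext x
      have := congrArg (fun y : E d => y k) (hS.drift x)
      simpa [mul_comm] using this
    have h2 := (lti_dwd (τ := τ) (τ₀ := P.τ₀) (h := h) I).sum (s := S.dirs)
      (φ := fun ν x => ν k * S.q ν x) fun ν hν => contDiff_const.mul (hS.q_sb ν hν).1
    rw [hf, (lti_dwd I).zero] at h2
    have h3 := congrFun h2 x
    rw [h3]
    exact Finset.sum_congr rfl fun ν hν => by rw [(lti_dwd I).const_mul (hS.q_sb ν hν).1]
  simp only [dirD, Finset.mul_sum]
  rw [Finset.sum_comm]
  refine Finset.sum_eq_zero fun k _ => ?_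
  have := congrArg (fun t => t * pderiv k ψ z) (h1 k)
  simp only [Finset.sum_mul, zero_mul] at this
  rw [← this]
  exact Finset.sum_congr rfl fun ν _ => by ring

lemma Scheme.abs_leibQ_le (hS : Scheme P h₀ S τ) (hh : 0 < h) (hv : SB v) {i j n : ℕ}
    {e : ℝ} (hE : CB (j + 2) e v) (hij : i + j = n) (him : i ≤ P.m) (x : E d) :
    |leibQ S τ P.τ₀ h v x i j|
      ≤ Real.sqrt (∑ w ∈ words (fullDirs S) n, dwd τ P.τ₀ h w v x ^ 2)
        * (Real.sqrt (P.W d ^ n * P.Mb ^ 2 * (d ^ 2 * P.a ^ 4)) * e) := by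
  have hW := P.W_nonneg d
  have hfam : CBf 2 (P.W d ^ j * e ^ 2) (words (fullDirs S) j ×ˢ ({()} : Finset Unit))
      (fun p => dwd τ P.τ₀ h p.1 v) :=
    hS.sum_dwd_sq_le hh (n := 2) (j := j) (φ := fun _ : Unit => v)
      (hE.toCBf.mono (by omega) le_rfl) (fun _ _ => hv.1)
  have hB : ∀ I ∈ words (fullDirs S) i, ∑ J ∈ words (fullDirs S) j, ∑ ν ∈ S.dirs,
      (h⁻¹ ^ 2 * taylorRem 2 (h • ν) (dwd τ P.τ₀ h J v) (x + svecs h I)) ^ 2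
        ≤ d ^ 2 * P.a ^ 4 * (P.W d ^ j * e ^ 2) := by
    intro I _
    rw [Finset.sum_comm]
    have h1 : ∀ ν ∈ S.dirs, ∑ J ∈ words (fullDirs S) j,
        (h⁻¹ ^ 2 * taylorRem 2 (h • ν) (dwd τ P.τ₀ h J v) (x + svecs h I)) ^ 2
          ≤ d ^ 2 * ‖ν‖ ^ 4 * (P.W d ^ j * e ^ 2) := by
      intro ν _
      have := (CBf.taylorRem (n := 0) (r := 2) hfam (fun p _ => (hv.dwd p.1).1) (h • ν)).const_mul
        (fun p _ => contDiff_taylorRem (hv.dwd p.1).1 2 (h • ν)) (h⁻¹ ^ 2) [] le_rfl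
        (x + svecs h I)
      rw [Finset.sum_product] at this
      simp only [Dw_nil, Finset.sum_singleton] at this
      refine this.trans (le_of_eq ?_)
      rw [norm_smul, Real.norm_eq_abs, abs_of_pos hh]
      field_simp
    refine (Finset.sum_le_sum h1).trans ?_
    rw [← Finset.sum_mul, ← Finset.mul_sum]
    exact mul_le_mul_of_nonneg_right (mul_le_mul_of_nonneg_left
      (sum_norm_pow_four_le hS.sum_sq) (by positivity)) (by positivity)
  have key : leibQ S τ P.τ₀ h v x i j = ∑ I ∈ words (fullDirs S) i, ∑ J ∈ words (fullDirs S) j,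
      dwd τ P.τ₀ h (I ++ J) v x * ∑ ν ∈ S.dirs, dwd τ P.τ₀ h I (S.q ν) x
        * (h⁻¹ ^ 2 * taylorRem 2 (h • ν) (dwd τ P.τ₀ h J v) (x + svecs h I)) := by
    unfold leibQ
    refine Finset.sum_congr rfl fun I _ => Finset.sum_congr rfl fun J _ => ?_
    congr 1
    have h0 := hS.sum_dwd_q_dirD (h := h) I x (x + svecs h I) (dwd τ P.τ₀ h J v)
    have h1 : ∀ ν, h⁻¹ ^ 2 * taylorRem 2 (h • ν) (dwd τ P.τ₀ h J v) (x + svecs h I)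
        = h⁻¹ * diffQ h ν (dwd τ P.τ₀ h J v) (x + svecs h I)
          - h⁻¹ * dirD ν (dwd τ P.τ₀ h J v) (x + svecs h I) := by
      intro ν
      simp only [taylorRem, Finset.sum_range_succ, Finset.range_zero, Finset.sum_empty,
        Function.iterate_zero, Function.iterate_one, id, dirD_smul, diffQ, Nat.factorial]
      have := hh.ne'
      field_simp
      norm_num
      ring
    simp only [h1, mul_sub, Finset.sum_sub_distrib]
    have h2 : ∑ ν ∈ S.dirs, dwd τ P.τ₀ h I (S.q ν) x
        * (h⁻¹ * dirD ν (dwd τ P.τ₀ h J v) (x + svecs h I)) = 0 := by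
      rw [← mul_zero h⁻¹, ← h0, Finset.mul_sum]
      exact Finset.sum_congr rfl fun ν _ => by ring
    rw [h2, sub_zero, Finset.mul_sum]
    exact Finset.sum_congr rfl fun ν _ => by ring
  rw [key]
  have := abs_bilinear_sum_le (le_of_eq (sum_words_append_sq (S := S) (τ := τ) (h := h) v x hij P.τ₀))
    (hS.sum_dwd_sq_le_at hh (hS.q_bd.mono him le_rfl) (fun k hk => (hS.q_sb k hk).1) x) hB
    (by positivity)
  refine this.trans (le_of_eq ?_)
  congr 1
  rw [← Real.sqrt_sq hE.nonneg, ← Real.sqrt_mul (by positivity), Real.sqrt_sq hE.nonneg, ← hij,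
    pow_add]
  congr 1; ring

end estimates

end

end FDRichardson

open MeasureTheory
open scoped ContDiff

namespace FDRichardson

noncomputable section

variable {d : ℕ} {P : Params} {h₀ h : ℝ} {S : Coeffs d} {τ : E d → ℝ} {v f : E d → ℝ}

/-- The sum of squares of all `δ̄_w v` with `w` of length `n`. -/
def sqSum (S : Coeffs d) (τ : E d → ℝ) (τ₀ h : ℝ) (n : ℕ) (v : E d → ℝ) (x : E d) : ℝ :=
  ∑ w ∈ words (fullDirs S) n, dwd τ τ₀ h w v x ^ 2

/-- The sum of all `𝒬_h(δ̄_w v)` with `w` of length `n`. -/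
def formQSum (S : Coeffs d) (τ : E d → ℝ) (τ₀ h : ℝ) (n : ℕ) (v : E d → ℝ) (x : E d) : ℝ :=
  ∑ w ∈ words (fullDirs S) n, formQ S h (dwd τ τ₀ h w v) x

lemma sqSum_nonneg (n : ℕ) (x : E d) : 0 ≤ sqSum S τ P.τ₀ h n v x :=
  Finset.sum_nonneg fun _ _ => sq_nonneg _

/-- The constant in the bound of the lower order terms. -/
def Params.kPQ (P : Params) (d n : ℕ) : ℝ :=
  Real.sqrt (P.W d ^ n * P.Mb ^ 2 * (d * P.a ^ 2))
    + Real.sqrt (P.W d ^ n * P.Mb ^ 2 * (d ^ 2 * P.a ^ 4))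

lemma abs_sum_choose_mul_le (n : ℕ) (F : ℕ → ℝ) {B : ℝ} (hF : ∀ k ∈ Finset.range (n + 1), |F k| ≤ B) :
    |∑ k ∈ Finset.range (n + 1), (n.choose k : ℝ) * F k| ≤ 2 ^ n * B := by
  calc _ ≤ ∑ k ∈ Finset.range (n + 1), (n.choose k : ℝ) * B := by
        refine (Finset.abs_sum_le_sum_abs _ _).trans (Finset.sum_le_sum fun k hk => ?_)
        rw [abs_mul, abs_of_nonneg (Nat.cast_nonneg _)]
        exact mul_le_mul_of_nonneg_left (hF k hk) (Nat.cast_nonneg _)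
    _ = 2 ^ n * B := by
        rw [← Finset.sum_mul]
        congr 1
        exact_mod_cast Nat.sum_range_choose n

lemma Scheme.sum_opM_main (hS : Scheme P h₀ S τ) (hh : 0 < h) (hv : SB v) {n : ℕ}
    (hn : n + 1 ≤ P.m) {e : ℝ} (hE : CB n e v) (x : E d) :
    |∑ w ∈ words (fullDirs S) (n + 1), dwd τ P.τ₀ h w v x * dwd τ P.τ₀ h w (opM S h v) x
      - (∑ w ∈ words (fullDirs S) (n + 1), dwd τ P.τ₀ h w v x * opM S h (dwd τ P.τ₀ h w v) x
        + (n + 1) / 2 * ∑ J ∈ words (fullDirs S) n, formA S τ P.τ₀ h (dwd τ P.τ₀ h J v) x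
        + ((n + 1).choose 2 : ℝ) * secondQ S τ P.τ₀ h v x (n - 1))|
      ≤ 2 ^ (n + 1) * (Real.sqrt (sqSum S τ P.τ₀ h (n + 1) v x) * (P.kPQ d (n + 1) * e)) := by
  set F : ℕ → ℝ := fun k => leibQ S τ P.τ₀ h v x k (n + 1 - k)
    + leibP S τ P.τ₀ h v x k (n + 1 - k) with hF
  set M : ℕ → ℝ := fun k => if k = 0 then F 0 else if k = 1 then F 1 else
    if k = 2 then leibQ S τ P.τ₀ h v x 2 (n + 1 - 2) else 0 with hM
  have hq : ∀ ν ∈ S.dirs, ContDiff ℝ ∞ (S.q ν) := fun ν hν => (hS.q_sb ν hν).1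
  have h1 : ∑ w ∈ words (fullDirs S) (n + 1),
      dwd τ P.τ₀ h w v x * dwd τ P.τ₀ h w (opM S h v) x
      = ∑ k ∈ Finset.range (n + 1 + 1), ((n + 1).choose k : ℝ) * F k := by
    rw [sum_leibniz_opM hv.1 hq (fun ν hν => (hS.p_sb ν hν).1),
      Finset.Nat.sum_antidiagonal_eq_sum_range_succ_mk]
  have h2 : ∑ k ∈ Finset.range (n + 1 + 1), ((n + 1).choose k : ℝ) * M k
      = ∑ w ∈ words (fullDirs S) (n + 1), dwd τ P.τ₀ h w v x * opM S h (dwd τ P.τ₀ h w v) x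
        + (n + 1) / 2 * ∑ J ∈ words (fullDirs S) n, formA S τ P.τ₀ h (dwd τ P.τ₀ h J v) x
        + ((n + 1).choose 2 : ℝ) * secondQ S τ P.τ₀ h v x (n - 1) := by
    rw [Finset.sum_range_succ', Finset.sum_range_succ']
    have e0 : M 0 = ∑ w ∈ words (fullDirs S) (n + 1),
        dwd τ P.τ₀ h w v x * opM S h (dwd τ P.τ₀ h w v) x := leib_zero (n + 1)
    have e1 : M (0 + 1) = 1 / 2 * ∑ J ∈ words (fullDirs S) n,
        formA S τ P.τ₀ h (dwd τ P.τ₀ h J v) x := leib_one hv.1 n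
    have e2 : ∑ k ∈ Finset.range n, ((n + 1).choose (k + 1 + 1) : ℝ) * M (k + 1 + 1)
        = ((n + 1).choose 2 : ℝ) * secondQ S τ P.τ₀ h v x (n - 1) := by
      cases n with
      | zero => simp
      | succ n =>
        rw [Finset.sum_range_succ', Finset.sum_eq_zero (fun k _ => by simp [hM]), zero_add]
        rw [← leibQ_two hv.1 hq]
        simp [hM]
    rw [e0, e1, e2]
    simp only [Nat.choose_zero_right, zero_add, Nat.choose_one_right]
    push_cast
    ring
  rw [h1, ← h2, ← Finset.sum_sub_distrib]
  simp only [← mul_sub]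
  refine abs_sum_choose_mul_le (n + 1) (fun k => F k - M k) fun k hk => ?_
  have hk' : k ≤ n + 1 := Nat.lt_succ_iff.1 (Finset.mem_range.1 hk)
  have he := hE.nonneg
  have hs : 0 ≤ Real.sqrt (sqSum S τ P.τ₀ h (n + 1) v x) := Real.sqrt_nonneg _
  have hbP : 2 ≤ k → |leibP S τ P.τ₀ h v x k (n + 1 - k)|
      ≤ Real.sqrt (sqSum S τ P.τ₀ h (n + 1) v x)
        * (Real.sqrt (P.W d ^ (n + 1) * P.Mb ^ 2 * (d * P.a ^ 2)) * e) := fun h2 =>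
    hS.abs_leibP_le hh hv (hE.mono (by omega) le_rfl) (by omega) (by omega) x
  have hbQ : 3 ≤ k → |leibQ S τ P.τ₀ h v x k (n + 1 - k)|
      ≤ Real.sqrt (sqSum S τ P.τ₀ h (n + 1) v x)
        * (Real.sqrt (P.W d ^ (n + 1) * P.Mb ^ 2 * (d ^ 2 * P.a ^ 4)) * e) := fun h3 =>
    hS.abs_leibQ_le hh hv (hE.mono (by omega) le_rfl) (by omega) (by omega) x
  have hnn1 : 0 ≤ Real.sqrt (sqSum S τ P.τ₀ h (n + 1) v x)
        * (Real.sqrt (P.W d ^ (n + 1) * P.Mb ^ 2 * (d * P.a ^ 2)) * e) := by positivity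
  have hnn2 : 0 ≤ Real.sqrt (sqSum S τ P.τ₀ h (n + 1) v x)
        * (Real.sqrt (P.W d ^ (n + 1) * P.Mb ^ 2 * (d ^ 2 * P.a ^ 4)) * e) := by positivity
  rw [Params.kPQ, add_mul, mul_add]
  rcases Nat.lt_or_ge k 2 with h2 | h2
  · have : F k - M k = 0 := by interval_cases k <;> simp [hM]
    rw [this, abs_zero]; linarith
  rcases eq_or_lt_of_le h2 with rfl | h3
  · have : F 2 - M 2 = leibP S τ P.τ₀ h v x 2 (n + 1 - 2) := by simp [hM, hF]
    rw [this]; linarith [hbP le_rfl]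
  · have : F k - M k = leibQ S τ P.τ₀ h v x k (n + 1 - k) + leibP S τ P.τ₀ h v x k (n + 1 - k) := by
      simp only [hM, hF]
      rw [if_neg (by omega), if_neg (by omega), if_neg (by omega), sub_zero]
    rw [this]
    refine (abs_add_le _ _).trans ?_
    linarith [hbP h2, hbQ h3]

lemma Scheme.sum_c_main (hS : Scheme P h₀ S τ) (hh : 0 < h) (hv : SB v) {n : ℕ}
    (hn : n + 1 ≤ P.m) {e : ℝ} (hE : CB n e v) (x : E d) :
    |∑ w ∈ words (fullDirs S) (n + 1), dwd τ P.τ₀ h w v x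
        * dwd τ P.τ₀ h w (fun x => S.c x * v x) x - S.c x * sqSum S τ P.τ₀ h (n + 1) v x|
      ≤ 2 ^ (n + 1) * (Real.sqrt (sqSum S τ P.τ₀ h (n + 1) v x)
        * (Real.sqrt (P.W d ^ (n + 1) * P.Mb ^ 2) * e)) := by
  have hW := P.W_nonneg d
  have he := hE.nonneg
  set F : ℕ → ℝ := fun k => ∑ I ∈ words (fullDirs S) k, ∑ J ∈ words (fullDirs S) (n + 1 - k),
    dwd τ P.τ₀ h (I ++ J) v x * (dwd τ P.τ₀ h I S.c x * dwd τ P.τ₀ h J v (x + svecs h I)) with hF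
  set M : ℕ → ℝ := fun k => if k = 0 then F 0 else 0 with hM
  have h1 : ∑ w ∈ words (fullDirs S) (n + 1), dwd τ P.τ₀ h w v x
        * dwd τ P.τ₀ h w (fun x => S.c x * v x) x
      = ∑ k ∈ Finset.range (n + 1 + 1), ((n + 1).choose k : ℝ) * F k := by
    rw [sum_words_leibniz (fullDirs S) (n + 1) (fun w => dwd τ P.τ₀ h w v x)
      (fun w w' hw => by rw [dwd_perm hw hv.1]) hS.c_sb.1 hv.1 x,
      Finset.Nat.sum_antidiagonal_eq_sum_range_succ_mk]
    simp only [nsmul_eq_mul]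
    rfl
  have h2 : ∑ k ∈ Finset.range (n + 1 + 1), ((n + 1).choose k : ℝ) * M k
      = S.c x * sqSum S τ P.τ₀ h (n + 1) v x := by
    rw [Finset.sum_range_succ', Finset.sum_eq_zero (fun k _ => by simp [hM]), zero_add]
    simp only [hM, hF, Nat.choose_zero_right, if_true, sum_words_zero, List.nil_append, dwd,
      svecs, List.map_nil, List.sum_nil, add_zero, sqSum, Finset.mul_sum, Nat.cast_one, one_mul,
      Nat.sub_zero]
    exact Finset.sum_congr rfl fun w _ => by ring
  rw [h1, ← h2, ← Finset.sum_sub_distrib]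
  simp only [← mul_sub]
  refine abs_sum_choose_mul_le (n + 1) (fun k => F k - M k) fun k hk => ?_
  have hk' : k ≤ n + 1 := Nat.lt_succ_iff.1 (Finset.mem_range.1 hk)
  rcases Nat.eq_zero_or_pos k with rfl | hk0
  · simp only [hM, if_true, sub_self, abs_zero]; positivity
  have e0 : F k - M k = F k := by simp [hM, hk0.ne']
  have hB : ∀ I ∈ words (fullDirs S) k, ∑ J ∈ words (fullDirs S) (n + 1 - k),
      ∑ _u ∈ ({()} : Finset Unit), dwd τ P.τ₀ h J v (x + svecs h I) ^ 2
        ≤ P.W d ^ (n + 1 - k) * e ^ 2 := fun I _ =>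
    hS.sum_dwd_sq_le_at hh (s := ({()} : Finset Unit)) (φ := fun _ => v)
      (hE.toCBf.mono (by omega) le_rfl) (fun _ _ => hv.1) _
  have hA : ∑ I ∈ words (fullDirs S) k, ∑ _u ∈ ({()} : Finset Unit), dwd τ P.τ₀ h I S.c x ^ 2
      ≤ P.W d ^ k * P.Mb ^ 2 :=
    hS.sum_dwd_sq_le_at hh (s := ({()} : Finset Unit)) (φ := fun _ => S.c)
      (hS.c_bd.toCBf.mono (by omega) le_rfl) (fun _ _ => hS.c_sb.1) _
  have := abs_bilinear_sum_le (u := fun I J => dwd τ P.τ₀ h (I ++ J) v x)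
    (le_of_eq (sum_words_append_sq (S := S) (τ := τ) (h := h) v x
    (show k + (n + 1 - k) = n + 1 by omega) P.τ₀)) hA hB (by positivity)
  simp only [Finset.sum_singleton] at this
  rw [e0]
  refine this.trans (le_of_eq ?_)
  unfold sqSum
  congr 1
  rw [← Real.sqrt_sq he, ← Real.sqrt_mul (by positivity), Real.sqrt_sq he]
  congr 1
  rw [show P.W d ^ (n + 1) = P.W d ^ k * P.W d ^ (n + 1 - k) by rw [← pow_add]; congr 1; omega]
  ring

lemma Scheme.abs_sum_f_le (hS : Scheme P h₀ S τ) (hh : 0 < h) (hf : SB f) {n : ℕ} {F : ℝ}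
    (hF : CB n F f) (x : E d) :
    |∑ w ∈ words (fullDirs S) n, dwd τ P.τ₀ h w v x * dwd τ P.τ₀ h w f x|
      ≤ Real.sqrt (sqSum S τ P.τ₀ h n v x) * (Real.sqrt (P.W d ^ n) * F) := by
  have hW := P.W_nonneg d
  have h1 := hS.sum_dwd_sq_le_at hh (s := ({()} : Finset Unit)) (φ := fun _ => f)
      hF.toCBf (fun _ _ => hf.1) x
  simp only [Finset.sum_singleton] at h1
  refine (abs_sum_mul_le_sqrt (le_of_eq rfl) h1).trans (le_of_eq ?_)
  rw [Real.sqrt_mul (by positivity), Real.sqrt_sq hF.nonneg]; rfl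

/-- The structural conditions for the family `δ̄_w v`. -/
lemma Scheme.structural (hS : Scheme P h₀ S τ) (hh : 0 < h) (hh₀ : h ≤ h₀) (hv : SB v) {n : ℕ}
    (hn : n + 1 ≤ P.m) {B B' : ℝ} (hB : ∀ y, sqSum S τ P.τ₀ h (n + 1) v y ≤ B)
    (hB' : ∀ y, sqSum S τ P.τ₀ h n v y ≤ B') (x : E d) :
    (n + 1) * ∑ J ∈ words (fullDirs S) n, formA S τ P.τ₀ h (dwd τ P.τ₀ h J v) x
        + (n + 1) * n * secondQ S τ P.τ₀ h v x (n - 1)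
      ≤ (1 - P.δ) * formQSum S τ P.τ₀ h (n + 1) v x + P.K * formQSum S τ P.τ₀ h n v x
        + 2 * (1 - P.δ) * S.c x * B + P.K * B' := by
  have hδ := P.δ_le
  have hK := P.K_pos
  have hc : 0 < S.c x := P.c₀_pos.trans_le (hS.c_ge x)
  have hB0 : 0 ≤ B := (sqSum_nonneg _ 0).trans (hB 0)
  have hB0' : 0 ≤ B' := (sqSum_nonneg _ 0).trans (hB' 0)
  cases n with
  | zero =>
    have hs : ∀ y, ∑ lam ∈ fullDirs S, |dbar τ P.τ₀ h lam v y| ^ 2 ≤ B := fun y => by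
      have := hB y
      rw [sqSum, sum_words_succ] at this
      simpa [sum_words_zero, dwd] using this
    have h1 := hS.cond1 h hh hh₀ v hv B hs x
    simp only [formQSum, zero_add, sum_words_succ, sum_words_zero, dwd, CharP.cast_eq_zero,
      one_mul, mul_zero, zero_mul, add_zero]
    set R := (1 - P.δ) * ∑ lam ∈ fullDirs S, formQ S h (dbar τ P.τ₀ h lam v) x
          + P.K * formQ S h v x + 2 * (1 - P.δ) * S.c x * B with hR
    have hR0 : 0 ≤ R := by
      have a1 : 0 ≤ 1 - P.δ := by linarith
      have a2 : 0 ≤ ∑ lam ∈ fullDirs S, formQ S h (dbar τ P.τ₀ h lam v) x :=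
        Finset.sum_nonneg fun _ _ => hS.formQ_nonneg hh hh₀ _ x
      have a3 := hS.formQ_nonneg hh hh₀ v x
      positivity
    have hm : (1 : ℝ) ≤ P.m := by exact_mod_cast P.one_le_m
    have h2 : formA S τ P.τ₀ h v x ≤ R := by
      by_contra! hlt
      nlinarith
    have h3 : 0 ≤ P.K * B' := by positivity
    linarith
  | succ n =>
    have hcomm : ∀ (a : E d ⊕ Fin d) J, dbar τ P.τ₀ h a (dwd τ P.τ₀ h J v)
        = dwd τ P.τ₀ h (a :: J) v := fun a J => ((lti_dwd J).dbar hv.1 _ _ _ a).symm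
    have hcomm2 : ∀ (μ : (E d ⊕ Fin d) × (E d ⊕ Fin d)) J, dbar2 τ P.τ₀ h μ (dwd τ P.τ₀ h J v)
        = dwd τ P.τ₀ h (μ.1 :: μ.2 :: J) v := fun μ J => by
      rw [dbar2, hcomm, hcomm]
    have hsq2 : ∀ F : List (E d ⊕ Fin d) → ℝ, ∑ J ∈ words (fullDirs S) n,
        ∑ μ ∈ fullDirs S ×ˢ fullDirs S, F (μ.1 :: μ.2 :: J)
          = ∑ w ∈ words (fullDirs S) (n + 1 + 1), F w := fun F => by
      rw [Finset.sum_comm, Finset.sum_product, sum_words_succ]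
      refine Finset.sum_congr rfl fun a _ => ?_
      rw [sum_words_succ]
    have hsq1 : ∀ F : List (E d ⊕ Fin d) → ℝ, ∑ J ∈ words (fullDirs S) n,
        ∑ a ∈ fullDirs S, F (a :: J) = ∑ w ∈ words (fullDirs S) (n + 1), F w := fun F => by
      rw [Finset.sum_comm, sum_words_succ]
    have h1 := hS.cond2 h hh hh₀ (n + 1 + 1) (by omega) hn (words (fullDirs S) n)
      (fun J => dwd τ P.τ₀ h J v) (fun J _ => hv.dwd J) B B'
      (fun y => by
        simp only [hcomm2, sq_abs]
        rw [hsq2 fun w => dwd τ P.τ₀ h w v y ^ 2]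
        exact hB y)
      (fun y => by
        simp only [hcomm, sq_abs]
        rw [hsq1 fun w => dwd τ P.τ₀ h w v y ^ 2]
        exact hB' y) x
    rw [Finset.sum_add_distrib, ← Finset.mul_sum, ← Finset.mul_sum] at h1
    have e1 : ∑ J ∈ words (fullDirs S) n, ∑ ν ∈ fullDirs S,
        formA S τ P.τ₀ h (dbar τ P.τ₀ h ν (dwd τ P.τ₀ h J v)) x
        = ∑ J ∈ words (fullDirs S) (n + 1), formA S τ P.τ₀ h (dwd τ P.τ₀ h J v) x := by
      simp only [hcomm]
      exact hsq1 fun w => formA S τ P.τ₀ h (dwd τ P.τ₀ h w v) x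
    have e2 : ∑ J ∈ words (fullDirs S) n, ∑ μ ∈ fullDirs S ×ˢ fullDirs S,
        formQ S h (dbar2 τ P.τ₀ h μ (dwd τ P.τ₀ h J v)) x
        = formQSum S τ P.τ₀ h (n + 1 + 1) v x := by
      simp only [hcomm2]
      exact hsq2 fun w => formQ S h (dwd τ P.τ₀ h w v) x
    have e3 : ∑ J ∈ words (fullDirs S) n, ∑ a ∈ fullDirs S,
        formQ S h (dbar τ P.τ₀ h a (dwd τ P.τ₀ h J v)) x
        = formQSum S τ P.τ₀ h (n + 1) v x := by
      simp only [hcomm]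
      exact hsq1 fun w => formQ S h (dwd τ P.τ₀ h w v) x
    rw [e1, e2, e3] at h1
    simp only [secondQ, Nat.add_sub_cancel]
    push_cast at h1 ⊢
    convert h1 using 3
    ring

/-- The differential inequality for the sum of squares of derivatives. -/
lemma Scheme.opM_sqSum_ge (hS : Scheme P h₀ S τ) (hh : 0 < h) (hh₀ : h ≤ h₀) (hv : SB v)
    (hf : SB f) (heq : ∀ x, opLh S h v x + f x = 0) {n : ℕ} (hn : n + 1 ≤ P.m) {e F B : ℝ}
    (hE : CB n e v) (hF : CB (n + 1) F f) (hB : ∀ y, sqSum S τ P.τ₀ h (n + 1) v y ≤ B) (x : E d) :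
    2 * S.c x * sqSum S τ P.τ₀ h (n + 1) v x - 2 * (1 - P.δ) * S.c x * B
      + P.δ * formQSum S τ P.τ₀ h (n + 1) v x - P.K * formQSum S τ P.τ₀ h n v x
      - P.K * (P.W d ^ n * e ^ 2)
      - 2 * Real.sqrt B * ((2 ^ (n + 1) * (P.kPQ d (n + 1)
          + Real.sqrt (P.W d ^ (n + 1) * P.Mb ^ 2))) * e + Real.sqrt (P.W d ^ (n + 1)) * F)
      ≤ opM S h (sqSum S τ P.τ₀ h (n + 1) v) x := by
  have hW := P.W_nonneg d
  have he := hE.nonneg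
  have hF0 := hF.nonneg
  have hcv : ContDiff ℝ ∞ (fun x => S.c x * v x) := hS.c_sb.1.mul hv.1
  have hM : opM S h v = fun x => S.c x * v x - f x := by
    funext x; have := heq x; rw [opLh_eq] at this; linarith
  have h1 : opM S h (sqSum S τ P.τ₀ h (n + 1) v) x
      = 2 * ∑ w ∈ words (fullDirs S) (n + 1),
          dwd τ P.τ₀ h w v x * opM S h (dwd τ P.τ₀ h w v) x
        + formQSum S τ P.τ₀ h (n + 1) v x := by
    have : sqSum S τ P.τ₀ h (n + 1) v = fun x => ∑ w ∈ words (fullDirs S) (n + 1),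
      (fun x => dwd τ P.τ₀ h w v x ^ 2) x := rfl
    rw [this, opM_sum, Finset.sum_congr rfl fun w _ => opM_sq S hh.ne' _ x,
      Finset.sum_add_distrib, Finset.mul_sum]
    congr 1
    exact Finset.sum_congr rfl fun w _ => by ring
  have h2 := hS.sum_opM_main hh hv hn hE x
  have h3 := hS.sum_c_main hh hv hn hE x
  have h4 := hS.abs_sum_f_le (v := v) hh hf hF x
  have h5 : ∑ w ∈ words (fullDirs S) (n + 1), dwd τ P.τ₀ h w v x * dwd τ P.τ₀ h w (opM S h v) x
      = ∑ w ∈ words (fullDirs S) (n + 1), dwd τ P.τ₀ h w v x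
        * dwd τ P.τ₀ h w (fun x => S.c x * v x) x
        - ∑ w ∈ words (fullDirs S) (n + 1), dwd τ P.τ₀ h w v x * dwd τ P.τ₀ h w f x := by
    rw [hM, ← Finset.sum_sub_distrib]
    refine Finset.sum_congr rfl fun w _ => ?_
    rw [(lti_dwd w).sub hcv hf.1, mul_sub]
  have hlow : ∀ y, sqSum S τ P.τ₀ h n v y ≤ P.W d ^ n * e ^ 2 := fun y => by
    have := hS.sum_dwd_sq_le_at hh (s := ({()} : Finset Unit)) (φ := fun _ => v)
      hE.toCBf (fun _ _ => hv.1) y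
    simpa [sqSum] using this
  have h6 := hS.structural hh hh₀ hv hn hB hlow x
  have hch : ((n + 1).choose 2 : ℝ) = (n + 1) * n / 2 := by
    rw [Nat.cast_choose_two]; push_cast; ring
  rw [hch] at h2
  have hsq : Real.sqrt (sqSum S τ P.τ₀ h (n + 1) v x) ≤ Real.sqrt B := Real.sqrt_le_sqrt (hB x)
  have hk : 0 ≤ P.kPQ d (n + 1) := by unfold Params.kPQ; positivity
  have g2 : 2 ^ (n + 1) * (Real.sqrt (sqSum S τ P.τ₀ h (n + 1) v x) * (P.kPQ d (n + 1) * e))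
      ≤ 2 ^ (n + 1) * (Real.sqrt B * (P.kPQ d (n + 1) * e)) := by gcongr
  have g3 : 2 ^ (n + 1) * (Real.sqrt (sqSum S τ P.τ₀ h (n + 1) v x)
        * (Real.sqrt (P.W d ^ (n + 1) * P.Mb ^ 2) * e))
      ≤ 2 ^ (n + 1) * (Real.sqrt B * (Real.sqrt (P.W d ^ (n + 1) * P.Mb ^ 2) * e)) := by gcongr
  have g4 : Real.sqrt (sqSum S τ P.τ₀ h (n + 1) v x) * (Real.sqrt (P.W d ^ (n + 1)) * F)
      ≤ Real.sqrt B * (Real.sqrt (P.W d ^ (n + 1)) * F) := by gcongr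
  have h2' := (abs_le.1 (h2.trans g2)).2
  have h3' := (abs_le.1 (h3.trans g3)).1
  have h4' := (abs_le.1 (h4.trans g4)).2
  rw [h1]
  rw [h5] at h2'
  linarith

lemma dwd_map_inr (w : List (Fin d)) (hv : ContDiff ℝ ∞ v) (x : E d) :
    dwd τ P.τ₀ h (w.map Sum.inr) v x = P.τ₀ ^ w.length * Dw w v x := by
  induction w generalizing v with
  | nil => simp [dwd]
  | cons i w ih =>
    have : dbar τ P.τ₀ h (Sum.inr i) v = fun x => P.τ₀ * pderiv i v x := rfl
    rw [List.map_cons, dwd, ih (contDiff_dbar hv _ _ _ _), this,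
      Dw_const_mul (contDiff_pderiv hv i), List.length_cons, Dw_cons, pow_succ]
    ring

lemma mem_words_map_inr (S : Coeffs d) (w : List (Fin d)) :
    w.map Sum.inr ∈ words (fullDirs S) w.length := by
  induction w with
  | nil => simp [words]
  | cons i w ih =>
    simp only [words, List.map_cons, List.length_cons, Finset.mem_map, Finset.mem_product]
    exact ⟨(Sum.inr i, w.map Sum.inr), ⟨by simp [fullDirs], ih⟩, rfl⟩

set_option maxHeartbeats 1000000 in
/-- Interior form of the a priori estimate: a bound for the derivatives up to order `n` together
with a function that absorbs `𝒬_h` of the derivatives of order `n`. -/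
lemma exists_derivative_estimate (P : Params) (d n : ℕ) (hn : n ≤ P.m) :
    ∃ N, 0 ≤ N ∧ ∀ (h₀ : ℝ) (S : Coeffs d) (τ : E d → ℝ), Scheme P h₀ S τ →
      ∀ h, 0 < h → h ≤ h₀ → ∀ (f v : E d → ℝ) (F : ℝ), SB f → SB v → CB n F f →
        (∀ x, opLh S h v x + f x = 0) → CB n (N * F) v ∧ ∃ Wf : E d → ℝ,
          (∀ x, 0 ≤ Wf x ∧ Wf x ≤ N * F ^ 2) ∧
          ∀ x, P.δ * formQSum S τ P.τ₀ h n v x - N * F ^ 2 ≤ opM S h Wf x := by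
  have hδ := P.δ_pos
  have hδ1 := P.δ_le
  have hK := P.K_pos
  have hc0 := P.c₀_pos
  have hτ := P.τ₀_pos
  have hW := P.W_nonneg d
  induction n with
  | zero =>
    refine ⟨P.c₀⁻¹ + P.c₀⁻¹ ^ 2 + 2 * P.c₀⁻¹, by positivity, ?_⟩
    intro h₀ S τ hS h hh hh₀ f v F hf hv hF heq
    have hF0 := hF.nonneg
    have hvb : ∀ x, |v x| ≤ P.c₀⁻¹ * F := by
      intro x
      have := (hS.mono hh hh₀).abs_le_of_abs_opLh_le hv.bdd (R := F) (fun x => by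
        rw [show opLh S h v x = -f x by linarith [heq x], abs_neg]; exact hF.bound x) x
      rwa [div_eq_inv_mul] at this
    have hsq : ∀ x, v x ^ 2 ≤ P.c₀⁻¹ ^ 2 * F ^ 2 := fun x => by
      rw [← mul_pow, sq_le_sq, abs_of_nonneg (a := P.c₀⁻¹ * F) (by positivity)]
      exact hvb x
    refine ⟨fun w hw x => ?_, fun x => v x ^ 2, fun x => ⟨sq_nonneg _, ?_⟩, fun x => ?_⟩
    · obtain rfl : w = [] := List.length_eq_zero_iff.1 (Nat.le_zero.1 hw)
      refine (hvb x).trans (mul_le_mul_of_nonneg_right ?_ hF0)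
      have : 0 ≤ P.c₀⁻¹ ^ 2 + 2 * P.c₀⁻¹ := by positivity
      linarith
    · refine (hsq x).trans (mul_le_mul_of_nonneg_right ?_ (sq_nonneg _))
      have : 0 ≤ P.c₀⁻¹ := by positivity
      linarith
    · rw [opM_sq S hh.ne']
      have h1 : opM S h v x = S.c x * v x - f x := by
        have := heq x; rw [opLh_eq] at this; linarith
      have h2 : formQSum S τ P.τ₀ h 0 v x = formQ S h v x := by
        simp [formQSum, sum_words_zero, dwd]
      have h3 := hS.formQ_nonneg hh hh₀ v x
      have h4 : v x * f x ≤ P.c₀⁻¹ * F ^ 2 := by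
        refine (le_abs_self _).trans ?_
        rw [abs_mul, sq, ← mul_assoc]
        exact mul_le_mul (hvb x) (hF.bound x) (abs_nonneg _) (by positivity)
      have h5 : 0 ≤ S.c x * v x ^ 2 := mul_nonneg (hc0.le.trans (hS.c_ge x)) (sq_nonneg _)
      have h6 : 0 ≤ (P.c₀⁻¹ + P.c₀⁻¹ ^ 2) * F ^ 2 := by positivity
      rw [h1, h2]
      nlinarith
  | succ n ih =>
    obtain ⟨N, hN, ih⟩ := ih (by omega)
    set κ := P.K / P.δ with hκ
    have hκ0 : 0 < κ := by positivity
    set C2 := 2 * ((2 ^ (n + 1) * (P.kPQ d (n + 1)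
          + Real.sqrt (P.W d ^ (n + 1) * P.Mb ^ 2))) * N + Real.sqrt (P.W d ^ (n + 1))) with hC2
    have hkPQ : 0 ≤ P.kPQ d (n + 1) := by unfold Params.kPQ; positivity
    have hC20 : 0 ≤ C2 := by positivity
    set C1 := P.K * (P.W d ^ n * N ^ 2) + κ * N with hC1
    have hC10 : 0 ≤ C1 := by positivity
    set C3 := (C1 + 2 * |P.Mb| * (κ * N) + C2 ^ 2 / (4 * (P.c₀ * P.δ))) / (P.c₀ * P.δ) with hC3
    have hC30 : 0 ≤ C3 := by positivity
    set N' := N + Real.sqrt C3 / P.τ₀ ^ (n + 1) + (C3 + κ * N)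
      + (2 * |P.Mb| * C3 + C1 + C2 * Real.sqrt C3) with hN'
    have hN'0 : 0 ≤ N' := by positivity
    refine ⟨N', hN'0, ?_⟩
    intro h₀ S τ hS h hh hh₀ f v F hf hv hF heq
    have hF0 := hF.nonneg
    obtain ⟨hE, Wf, hWf, hWfL⟩ := ih h₀ S τ hS h hh hh₀ f v F hf hv (hF.mono (Nat.le_succ n) le_rfl) heq
    set V := sqSum S τ P.τ₀ h (n + 1) v with hV
    have hV0 : ∀ x, 0 ≤ V x := fun x => sqSum_nonneg _ x
    have hVb : BddAbove (Set.range V) := by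
      obtain ⟨C, hC⟩ := (SB.sum (s := words (fullDirs S) (n + 1))
        (φ := fun w x => dwd τ P.τ₀ h w v x * dwd τ P.τ₀ h w v x)
        fun w _ => (hv.dwd w).mul (hv.dwd w)).bdd
      refine ⟨C, ?_⟩
      rintro _ ⟨x, rfl⟩
      refine le_trans (le_of_eq ?_) ((le_abs_self _).trans (hC x))
      exact Finset.sum_congr rfl fun w _ => sq _
    set B := ⨆ x, V x with hB
    have hVB : ∀ x, V x ≤ B := fun x => le_ciSup hVb x
    have hB0 : 0 ≤ B := (hV0 0).trans (hVB 0)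
    have hc : ∀ x, 0 < S.c x := fun x => hc0.trans_le (hS.c_ge x)
    have hcM : ∀ x, S.c x ≤ |P.Mb| := fun x => (hS.c_le x).trans (le_abs_self _)
    have hL : ∀ x, 2 * S.c x * V x - 2 * (1 - P.δ) * S.c x * B
        + P.δ * formQSum S τ P.τ₀ h (n + 1) v x - C1 * F ^ 2 - C2 * (Real.sqrt B * F)
        ≤ opM S h (fun x => V x + κ * Wf x) x := by
      intro x
      have h1 := hS.opM_sqSum_ge hh hh₀ hv hf heq hn hE hF hVB x
      have h2 := mul_le_mul_of_nonneg_left (hWfL x) hκ0.le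
      have h3 : κ * (P.δ * formQSum S τ P.τ₀ h n v x)
          = P.K * formQSum S τ P.τ₀ h n v x := by
        rw [hκ]; field_simp
      rw [opM_add, opM_const_mul]
      rw [mul_sub, h3] at h2
      rw [hC1, hC2]
      linarith
    have hfin : B ≤ C3 * F ^ 2 := by
      have key : 2 * (P.c₀ * P.δ) * B ≤ C1 * F ^ 2 + C2 * (Real.sqrt B * F)
          + 2 * |P.Mb| * (κ * N * F ^ 2) := by
        refine le_of_forall_pos_le_add fun ε hε => ?_
        set η := ε / (1 + 2 * |P.Mb|) with hη
        have hη0 : 0 < η := by positivity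
        have hηε : η + 2 * |P.Mb| * η = ε := by rw [hη]; field_simp
        obtain ⟨x, hx, hG⟩ := (hS.mono hh hh₀).exists_near_max
          (W := fun x => V x + κ * Wf x)
          ⟨B + κ * (N * F ^ 2), fun x =>
            add_le_add (hVB x) (mul_le_mul_of_nonneg_left (hWf x).2 hκ0.le)⟩ hL hη0
        have hVx : B ≤ V x + κ * (N * F ^ 2) + η := by
          refine ciSup_le fun y => ?_
          have h1 := hx y
          have h2 := mul_nonneg hκ0.le (hWf y).1
          have h3 := mul_le_mul_of_nonneg_left (hWf x).2 hκ0.le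
          linarith
        have hQ : 0 ≤ P.δ * formQSum S τ P.τ₀ h (n + 1) v x :=
          mul_nonneg hδ.le (Finset.sum_nonneg fun _ _ => hS.formQ_nonneg hh hh₀ _ x)
        have h1 : S.c x * (B - κ * (N * F ^ 2) - η) ≤ S.c x * V x :=
          mul_le_mul_of_nonneg_left (by linarith) (hc x).le
        have h2 : P.c₀ * (P.δ * B) ≤ S.c x * (P.δ * B) :=
          mul_le_mul_of_nonneg_right (hS.c_ge x) (by positivity)
        have h3 : S.c x * (κ * (N * F ^ 2) + η) ≤ |P.Mb| * (κ * (N * F ^ 2) + η) :=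
          mul_le_mul_of_nonneg_right (hcM x) (by positivity)
        rw [← hηε]
        nlinarith
      have h1 : C2 * (Real.sqrt B * F) ≤ P.c₀ * P.δ * B + C2 ^ 2 / (4 * (P.c₀ * P.δ)) * F ^ 2 := by
        have hs : Real.sqrt B ^ 2 = B := Real.sq_sqrt hB0
        have hcd : 0 < P.c₀ * P.δ := by positivity
        have h2 := sq_nonneg (2 * (P.c₀ * P.δ) * Real.sqrt B - C2 * F)
        have h3 : C2 ^ 2 / (4 * (P.c₀ * P.δ)) * F ^ 2 = C2 ^ 2 * F ^ 2 / (4 * (P.c₀ * P.δ)) := by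
          ring
        rw [h3, ← sub_le_iff_le_add', le_div_iff₀ (by positivity)]
        have h4 : (2 * (P.c₀ * P.δ) * Real.sqrt B - C2 * F) ^ 2
            = 4 * (P.c₀ * P.δ) ^ 2 * Real.sqrt B ^ 2
              - 4 * (P.c₀ * P.δ) * (C2 * (Real.sqrt B * F)) + C2 ^ 2 * F ^ 2 := by ring
        rw [h4, hs] at h2
        linarith
      rw [hC3, div_mul_eq_mul_div, le_div_iff₀ (by positivity)]
      linarith
    have hsB : Real.sqrt B ≤ Real.sqrt C3 * F := by
      rw [← Real.sqrt_sq hF0, ← Real.sqrt_mul hC30]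
      exact Real.sqrt_le_sqrt hfin
    have hN1 : N ≤ N' := by
      have : 0 ≤ Real.sqrt C3 / P.τ₀ ^ (n + 1) + (C3 + κ * N)
        + (2 * |P.Mb| * C3 + C1 + C2 * Real.sqrt C3) := by positivity
      rw [hN']; linarith
    have hN2 : Real.sqrt C3 / P.τ₀ ^ (n + 1) ≤ N' := by
      have : 0 ≤ N + (C3 + κ * N) + (2 * |P.Mb| * C3 + C1 + C2 * Real.sqrt C3) := by positivity
      rw [hN']; linarith
    have hN3 : C3 + κ * N ≤ N' := by
      have : 0 ≤ N + Real.sqrt C3 / P.τ₀ ^ (n + 1)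
        + (2 * |P.Mb| * C3 + C1 + C2 * Real.sqrt C3) := by positivity
      rw [hN']; linarith
    have hN4 : 2 * |P.Mb| * C3 + C1 + C2 * Real.sqrt C3 ≤ N' := by
      have : 0 ≤ N + Real.sqrt C3 / P.τ₀ ^ (n + 1) + (C3 + κ * N) := by positivity
      rw [hN']; linarith
    refine ⟨fun w hw x => ?_, fun x => V x + κ * Wf x, fun x => ⟨?_, ?_⟩, fun x => ?_⟩
    · rcases Nat.lt_or_ge n w.length with hlt | hle
      · have hl : w.length = n + 1 := le_antisymm hw hlt
        have h1 : dwd τ P.τ₀ h (w.map Sum.inr) v x ^ 2 ≤ V x :=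
          Finset.single_le_sum (f := fun w => dwd τ P.τ₀ h w v x ^ 2) (fun _ _ => sq_nonneg _)
            (hl ▸ mem_words_map_inr S w)
        rw [dwd_map_inr w hv.1] at h1
        have h2 := Real.abs_le_sqrt (h1.trans (hVB x))
        rw [abs_mul, abs_of_pos (by positivity), hl] at h2
        have h3 : |Dw w v x| ≤ Real.sqrt C3 / P.τ₀ ^ (n + 1) * F := by
          rw [div_mul_eq_mul_div, le_div_iff₀ (by positivity), mul_comm]
          exact h2.trans hsB
        exact h3.trans (mul_le_mul_of_nonneg_right hN2 hF0)
      · exact (hE w hle x).trans (mul_le_mul_of_nonneg_right hN1 hF0)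
    · have := mul_nonneg hκ0.le (hWf x).1
      have := hV0 x
      positivity
    · have h1 := mul_le_mul_of_nonneg_left (hWf x).2 hκ0.le
      have h2 := mul_le_mul_of_nonneg_right hN3 (sq_nonneg F)
      have h3 := (hVB x).trans hfin
      linarith
    · refine le_trans ?_ (hL x)
      have h1 : 0 ≤ 2 * S.c x * V x := by have := hV0 x; have := hc x; positivity
      have h2 : 2 * (1 - P.δ) * S.c x * B ≤ 2 * |P.Mb| * (C3 * F ^ 2) := by
        have a1 : (1 - P.δ) * S.c x ≤ |P.Mb| := by
          have := hcM x; have := hc x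
          nlinarith
        have a2 : (1 - P.δ) * S.c x * B ≤ |P.Mb| * (C3 * F ^ 2) :=
          mul_le_mul a1 hfin hB0 (abs_nonneg _)
        linarith
      have h3 : C2 * (Real.sqrt B * F) ≤ C2 * (Real.sqrt C3 * F ^ 2) := by
        refine mul_le_mul_of_nonneg_left ?_ hC20
        rw [sq, ← mul_assoc]
        exact mul_le_mul_of_nonneg_right hsB hF0
      have h4 := mul_le_mul_of_nonneg_right hN4 (sq_nonneg F)
      linarith

/-- The a priori estimate for the derivatives of the solution of the difference equation. -/
theorem exists_apriori (P : Params) (d : ℕ) : ∃ N, 0 ≤ N ∧ ∀ n ≤ P.m,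
    ∀ (h₀ : ℝ) (S : Coeffs d) (τ : E d → ℝ), Scheme P h₀ S τ →
      ∀ h, 0 < h → h ≤ h₀ → ∀ (f v : E d → ℝ) (F : ℝ), SB f → SB v → CB n F f →
        (∀ x, opLh S h v x + f x = 0) → CB n (N * F) v := by
  have : ∀ n, ∃ N, 0 ≤ N ∧ (n ≤ P.m → ∀ (h₀ : ℝ) (S : Coeffs d) (τ : E d → ℝ), Scheme P h₀ S τ →
      ∀ h, 0 < h → h ≤ h₀ → ∀ (f v : E d → ℝ) (F : ℝ), SB f → SB v → CB n F f →
        (∀ x, opLh S h v x + f x = 0) → CB n (N * F) v) := by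
    intro n
    by_cases hn : n ≤ P.m
    · obtain ⟨N, hN, H⟩ := exists_derivative_estimate P d n hn
      exact ⟨N, hN, fun _ h₀ S τ hS h hh hh₀ f v F hf hv hF heq =>
        (H h₀ S τ hS h hh hh₀ f v F hf hv hF heq).1⟩
    · exact ⟨0, le_rfl, fun h => absurd h hn⟩
  choose N hN H using this
  refine ⟨∑ n ∈ Finset.range (P.m + 1), N n, Finset.sum_nonneg fun n _ => hN n, ?_⟩
  intro n hn h₀ S τ hS h hh hh₀ f v F hf hv hF heq
  refine (H n hn h₀ S τ hS h hh hh₀ f v F hf hv hF heq).mono le_rfl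
    (mul_le_mul_of_nonneg_right ?_ hF.nonneg)
  exact Finset.single_le_sum (fun n _ => hN n) (Finset.mem_range.2 (Nat.lt_succ_of_le hn))

end

end FDRichardson

open MeasureTheory
open scoped ContDiff

namespace FDRichardson

noncomputable section

variable {d : ℕ} {P : Params} {h₀ h : ℝ} {S : Coeffs d} {τ : E d → ℝ}

/-- The coefficient of `h^i` in the expansion of the difference operator (without `c`). -/
def Lop (S : Coeffs d) (i : ℕ) (ψ : E d → ℝ) (x : E d) : ℝ :=
  ∑ lam ∈ S.dirs, S.q lam x * (((i + 2).factorial : ℝ)⁻¹ * (dirD lam)^[i + 2] ψ x)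
    + ∑ lam ∈ S.dirs, S.p lam x * (((i + 1).factorial : ℝ)⁻¹ * (dirD lam)^[i + 1] ψ x)

/-- The remainder of the expansion of the difference operator to order `r`. -/
def Lrem (S : Coeffs d) (r : ℕ) (h : ℝ) (ψ : E d → ℝ) (x : E d) : ℝ :=
  ∑ lam ∈ S.dirs, S.q lam x * (h⁻¹ ^ 2 * taylorRem (r + 3) (h • lam) ψ x)
    + ∑ lam ∈ S.dirs, S.p lam x * (h⁻¹ * taylorRem (r + 2) (h • lam) ψ x)

lemma sum_q_dirD_eq_zero (hdr : ∀ x, ∑ lam ∈ S.dirs, S.q lam x • lam = 0) (ψ : E d → ℝ)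
    (x z : E d) : ∑ lam ∈ S.dirs, S.q lam x * dirD lam ψ z = 0 := by
  simp only [dirD, Finset.mul_sum]
  rw [Finset.sum_comm]
  refine Finset.sum_eq_zero fun k _ => ?_
  have h1 := congrArg (fun y : E d => y k * pderiv k ψ z) (hdr x)
  simp only [PiLp.zero_apply, zero_mul, WithLp.ofLp_sum, WithLp.ofLp_smul, Finset.sum_apply,
    Pi.smul_apply, smul_eq_mul, Finset.sum_mul] at h1
  rw [← h1]
  exact Finset.sum_congr rfl fun ν _ => by ring

lemma opM_expansion (hdr : ∀ x, ∑ lam ∈ S.dirs, S.q lam x • lam = 0) (hh : h ≠ 0) {ψ : E d → ℝ}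
    (hψ : ContDiff ℝ ∞ ψ) (r : ℕ) (x : E d) :
    opM S h ψ x = ∑ i ∈ Finset.range (r + 1), h ^ i * Lop S i ψ x + Lrem S r h ψ x := by
  have hq : ∀ lam : E d, h⁻¹ ^ 2 * taylorRem (r + 3) (h • lam) ψ x
      = h⁻¹ * diffQ h lam ψ x - h⁻¹ * dirD lam ψ x
        - ∑ i ∈ Finset.range (r + 1),
          h ^ i * (((i + 2).factorial : ℝ)⁻¹ * (dirD lam)^[i + 2] ψ x) := by
    intro lam
    simp only [taylorRem, Finset.sum_range_succ' _ (r + 2), Finset.sum_range_succ' _ (r + 1)]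
    rw [Finset.sum_congr rfl fun i _ => by rw [dirD_iter_smul hψ]]
    rw [dirD_iter_smul hψ, dirD_iter_smul hψ]
    simp only [Function.iterate_zero, id, zero_add, Nat.factorial, Nat.cast_one, inv_one, one_mul,
      pow_one, pow_zero, Function.iterate_one, diffQ]
    have : ∑ i ∈ Finset.range (r + 1), h ^ i * ((((i + 1 + 1) * ((i + 1) * i.factorial) : ℕ) : ℝ)⁻¹
        * (dirD lam)^[i + 2] ψ x) = h⁻¹ ^ 2 * ∑ i ∈ Finset.range (r + 1),
        (((i + 1 + 1) * ((i + 1) * i.factorial) : ℕ) : ℝ)⁻¹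
        * (h ^ (i + 1 + 1) * (dirD lam)^[i + 1 + 1] ψ x) := by
      rw [Finset.mul_sum]
      refine Finset.sum_congr rfl fun i _ => ?_
      field_simp
      ring
    rw [this]
    field_simp
    ring
  have hp : ∀ lam : E d, h⁻¹ * taylorRem (r + 2) (h • lam) ψ x
      = diffQ h lam ψ x - ∑ i ∈ Finset.range (r + 1),
          h ^ i * (((i + 1).factorial : ℝ)⁻¹ * (dirD lam)^[i + 1] ψ x) := by
    intro lam
    simp only [taylorRem, Finset.sum_range_succ' _ (r + 1)]
    rw [Finset.sum_congr rfl fun i _ => by rw [dirD_iter_smul hψ]]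
    simp only [Function.iterate_zero, id, Nat.factorial, Nat.cast_one, inv_one, one_mul, diffQ]
    have : ∑ i ∈ Finset.range (r + 1), h ^ i * ((((i + 1) * i.factorial : ℕ) : ℝ)⁻¹
        * (dirD lam)^[i + 1] ψ x) = h⁻¹ * ∑ i ∈ Finset.range (r + 1),
        (((i + 1) * i.factorial : ℕ) : ℝ)⁻¹ * (h ^ (i + 1) * (dirD lam)^[i + 1] ψ x) := by
      rw [Finset.mul_sum]
      refine Finset.sum_congr rfl fun i _ => ?_
      rw [pow_succ]
      field_simp
    rw [this]
    ring
  have h0 := sum_q_dirD_eq_zero hdr ψ x x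
  have h0' : ∑ lam ∈ S.dirs, S.q lam x * (h⁻¹ * dirD lam ψ x) = 0 := by
    rw [← mul_zero h⁻¹, ← h0, Finset.mul_sum]
    exact Finset.sum_congr rfl fun _ _ => by ring
  unfold Lrem
  simp only [hq, hp, mul_sub, Finset.sum_sub_distrib]
  rw [h0', sub_zero]
  have e : ∑ i ∈ Finset.range (r + 1), h ^ i * Lop S i ψ x
      = ∑ lam ∈ S.dirs, S.q lam x * ∑ i ∈ Finset.range (r + 1),
          h ^ i * (((i + 2).factorial : ℝ)⁻¹ * (dirD lam)^[i + 2] ψ x)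
        + ∑ lam ∈ S.dirs, S.p lam x * ∑ i ∈ Finset.range (r + 1),
          h ^ i * (((i + 1).factorial : ℝ)⁻¹ * (dirD lam)^[i + 1] ψ x) := by
    simp only [Lop, mul_add, Finset.sum_add_distrib, Finset.mul_sum]
    congr 1 <;>
    · rw [Finset.sum_comm]
      exact Finset.sum_congr rfl fun _ _ => Finset.sum_congr rfl fun _ _ => by ring
  rw [e]
  unfold opM
  rw [Finset.mul_sum]
  have e2 : ∑ lam ∈ S.dirs, h⁻¹ * (S.q lam x * diffQ h lam ψ x)
      = ∑ lam ∈ S.dirs, S.q lam x * (h⁻¹ * diffQ h lam ψ x) :=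
    Finset.sum_congr rfl fun _ _ => by ring
  rw [e2]
  ring

lemma SB_Lop (hS : Scheme P h₀ S τ) (i : ℕ) {ψ : E d → ℝ} (hψ : SB ψ) : SB (Lop S i ψ) :=
  (SB.sum fun lam hl => (hS.q_sb lam hl).mul ((hψ.dirD_iter lam (i + 2)).const_mul _)).add
    (SB.sum fun lam hl => (hS.p_sb lam hl).mul ((hψ.dirD_iter lam (i + 1)).const_mul _))

lemma SB_Lrem (hS : Scheme P h₀ S τ) (r : ℕ) (h : ℝ) {ψ : E d → ℝ} (hψ : SB ψ) :
    SB (Lrem S r h ψ) :=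
  (SB.sum fun lam hl => (hS.q_sb lam hl).mul ((hψ.taylorRem (r + 3) (h • lam)).const_mul _)).add
    (SB.sum fun lam hl => (hS.p_sb lam hl).mul ((hψ.taylorRem (r + 2) (h • lam)).const_mul _))

lemma sum_norm_pow_le {s : Finset (E d)} {a : ℝ} (hs : ∑ lam ∈ s, ‖lam‖ ^ 2 ≤ a ^ 2) {r : ℕ}
    (hr : 1 ≤ r) : ∑ lam ∈ s, (d * ‖lam‖ ^ 2) ^ r ≤ (d * a ^ 2) ^ r := by
  obtain ⟨r, rfl⟩ := Nat.exists_eq_add_of_le' hr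
  have h1 : ∀ lam ∈ s, (d * ‖lam‖ ^ 2) ^ (r + 1) ≤ (d * a ^ 2) ^ r * (d * ‖lam‖ ^ 2) :=
    fun lam hl => by
      have : ‖lam‖ ^ 2 ≤ a ^ 2 :=
        (Finset.single_le_sum (f := fun lam : E d => ‖lam‖ ^ 2)
          (fun _ _ => by positivity) hl).trans hs
      rw [pow_succ]
      gcongr
  refine (Finset.sum_le_sum h1).trans ?_
  rw [← Finset.mul_sum, ← Finset.mul_sum, pow_succ]
  have h2 : 0 ≤ (d * a ^ 2) ^ r := by positivity
  exact mul_le_mul_of_nonneg_left (mul_le_mul_of_nonneg_left hs (Nat.cast_nonneg d)) h2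

/-- Sums of products of coefficients with a family of functions. -/
lemma CB_coef_sum {s : Finset (E d)} {a A C t : ℝ} {n r : ℕ} (hr : 1 ≤ r)
    (hs : ∑ lam ∈ s, ‖lam‖ ^ 2 ≤ a ^ 2) {q b : E d → E d → ℝ} (hq : CBf n (A ^ 2) s q)
    (hqs : ∀ lam ∈ s, ContDiff ℝ ∞ (q lam)) (hbs : ∀ lam ∈ s, ContDiff ℝ ∞ (b lam))
    (ht : 0 ≤ t) (hC : 0 ≤ C)
    (hb : ∀ lam ∈ s, CBf n (t ^ 2 * ((d * ‖lam‖ ^ 2) ^ r * C ^ 2)) ({()} : Finset Unit)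
      (fun _ => b lam)) :
    CB n (2 ^ n * (|A| * Real.sqrt ((d * a ^ 2) ^ r)) * t * C)
      (fun x => ∑ lam ∈ s, q lam x * b lam x) := by
  have hb' : CBf n ((d * a ^ 2) ^ r * (t * C) ^ 2) s b := by
    intro w hw x
    have h1 : ∀ lam ∈ s, (Dw w (b lam) x) ^ 2 ≤ (d * ‖lam‖ ^ 2) ^ r * (t * C) ^ 2 :=
      fun lam hl => by
        have := hb lam hl w hw x
        rw [Finset.sum_singleton] at this
        exact this.trans (le_of_eq (by ring))
    refine (Finset.sum_le_sum h1).trans ?_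
    rw [← Finset.sum_mul]
    exact mul_le_mul_of_nonneg_right (sum_norm_pow_le hs hr) (sq_nonneg _)
  refine (hq.sum_mul hb' hqs hbs).mono le_rfl (le_of_eq ?_)
  rw [Real.sqrt_sq_eq_abs, Real.sqrt_mul (by positivity), Real.sqrt_sq (by positivity)]
  ring

/-- The constant in the bounds for `Lop` and `Lrem`. -/
def Params.kL (P : Params) (d n r : ℕ) : ℝ :=
  2 ^ n * (|P.Mb| * Real.sqrt ((d * P.a ^ 2) ^ r))

lemma Params.kL_nonneg (P : Params) (d n r : ℕ) : 0 ≤ P.kL d n r := by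
  unfold Params.kL; positivity

lemma inv_factorial_sq_le (n : ℕ) : ((n.factorial : ℝ)⁻¹) ^ 2 ≤ 1 := by
  have h1 : (1 : ℝ) ≤ n.factorial := by exact_mod_cast Nat.one_le_iff_ne_zero.2 n.factorial_ne_zero
  exact pow_le_one₀ (by positivity) (inv_le_one_of_one_le₀ h1)

lemma CB_dirD_part {s : Finset (E d)} {a A C : ℝ} {n r : ℕ} (hr : 1 ≤ r)
    (hs : ∑ lam ∈ s, ‖lam‖ ^ 2 ≤ a ^ 2) {q : E d → E d → ℝ} (hq : CBf n (A ^ 2) s q)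
    (hqs : ∀ lam ∈ s, ContDiff ℝ ∞ (q lam)) {ψ : E d → ℝ} (hψ : SB ψ) (hC : CB (n + r) C ψ) :
    CB n (2 ^ n * (|A| * Real.sqrt ((d * a ^ 2) ^ r)) * C)
      (fun x => ∑ lam ∈ s, q lam x * ((r.factorial : ℝ)⁻¹ * (dirD lam)^[r] ψ x)) := by
  have := CB_coef_sum (t := 1) hr hs hq hqs
    (b := fun lam x => (r.factorial : ℝ)⁻¹ * (dirD lam)^[r] ψ x)
    (fun lam _ => contDiff_const.mul (contDiff_dirD_iter hψ.1 lam r)) zero_le_one hC.nonneg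
    (fun lam _ => ((CBf.dirD_iter r hC.toCBf (fun _ _ => hψ.1) lam).const_mul
      (fun _ _ => contDiff_dirD_iter hψ.1 lam r) _).mono le_rfl (by
        rw [one_pow]
        exact mul_le_mul_of_nonneg_right (inv_factorial_sq_le r) (by positivity)))
  rwa [mul_one] at this

lemma CB_taylor_part {s : Finset (E d)} {a A C : ℝ} {n r e : ℕ} (hh : 0 < h) (hr : 1 ≤ r)
    (he : e ≤ r) (hs : ∑ lam ∈ s, ‖lam‖ ^ 2 ≤ a ^ 2) {q : E d → E d → ℝ}
    (hq : CBf n (A ^ 2) s q) (hqs : ∀ lam ∈ s, ContDiff ℝ ∞ (q lam)) {ψ : E d → ℝ} (hψ : SB ψ)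
    (hC : CB (n + r) C ψ) :
    CB n (2 ^ n * (|A| * Real.sqrt ((d * a ^ 2) ^ r)) * h ^ (r - e) * C)
      (fun x => ∑ lam ∈ s, q lam x * (h⁻¹ ^ e * taylorRem r (h • lam) ψ x)) := by
  refine CB_coef_sum hr hs hq hqs
    (b := fun lam x => h⁻¹ ^ e * taylorRem r (h • lam) ψ x)
    (fun lam _ => contDiff_const.mul (contDiff_taylorRem hψ.1 _ _)) (by positivity) hC.nonneg
    (fun lam _ => ((CBf.taylorRem hC.toCBf (fun _ _ => hψ.1) (h • lam)).const_mul
      (fun _ _ => contDiff_taylorRem hψ.1 _ _) _).mono le_rfl (le_of_eq ?_))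
  obtain ⟨j, rfl⟩ := Nat.exists_eq_add_of_le he
  rw [norm_smul, Real.norm_eq_abs, abs_of_pos hh, Nat.add_sub_cancel_left]
  have : (d * (h * ‖lam‖) ^ 2) ^ (e + j) = (h ^ e) ^ 2 * (h ^ j) ^ 2 * (d * ‖lam‖ ^ 2) ^ (e + j) := by
    rw [mul_pow h, mul_left_comm, mul_pow]
    congr 1
    rw [← mul_pow, ← pow_add, ← pow_mul, ← pow_mul, mul_comm]
  rw [this, inv_pow]
  field_simp

lemma CB_Lop (hS : Scheme P h₀ S τ) {n i : ℕ} (hn : n ≤ P.m) {C : ℝ} {ψ : E d → ℝ} (hψ : SB ψ)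
    (hC : CB (n + (i + 2)) C ψ) :
    CB n ((P.kL d n (i + 2) + P.kL d n (i + 1)) * C) (Lop S i ψ) := by
  rw [add_mul]
  exact (CB_dirD_part (by omega) hS.sum_sq (hS.q_bd.mono hn le_rfl) (fun lam hl => (hS.q_sb lam hl).1)
    hψ hC).add (CB_dirD_part (by omega) hS.sum_sq (hS.p_bd.mono hn le_rfl)
      (fun lam hl => (hS.p_sb lam hl).1) hψ (hC.mono (by omega) le_rfl))
    (ContDiff.sum fun lam hl => (hS.q_sb lam hl).1.mul
      (contDiff_const.mul (contDiff_dirD_iter hψ.1 _ _)))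
    (ContDiff.sum fun lam hl => (hS.p_sb lam hl).1.mul
      (contDiff_const.mul (contDiff_dirD_iter hψ.1 _ _)))

lemma CB_Lrem (hS : Scheme P h₀ S τ) (hh : 0 < h) {n r : ℕ} (hn : n ≤ P.m) {C : ℝ}
    {ψ : E d → ℝ} (hψ : SB ψ) (hC : CB (n + (r + 3)) C ψ) :
    CB n ((P.kL d n (r + 3) + P.kL d n (r + 2)) * h ^ (r + 1) * C) (Lrem S r h ψ) := by
  rw [add_mul, add_mul]
  have h1 := CB_taylor_part (e := 2) hh (by omega) (by omega) hS.sum_sq (hS.q_bd.mono hn le_rfl)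
    (fun lam hl => (hS.q_sb lam hl).1) hψ hC
  have h2 := CB_taylor_part (e := 1) hh (r := r + 2) (by omega) (by omega) hS.sum_sq
    (hS.p_bd.mono hn le_rfl) (fun lam hl => (hS.p_sb lam hl).1) hψ (hC.mono (by omega) le_rfl)
  simp only [pow_one] at h2
  exact h1.add h2
    (ContDiff.sum fun lam hl => (hS.q_sb lam hl).1.mul
      (contDiff_const.mul (contDiff_taylorRem hψ.1 _ _)))
    (ContDiff.sum fun lam hl => (hS.p_sb lam hl).1.mul
      (contDiff_const.mul (contDiff_taylorRem hψ.1 _ _)))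

section symmetry

lemma sum_eq_zero_of_neg {s : Finset (E d)} (hs : ∀ lam ∈ s, -lam ∈ s) {g : E d → ℝ}
    (hg : ∀ lam ∈ s, g (-lam) = -g lam) : ∑ lam ∈ s, g lam = 0 := by
  have h1 : ∑ lam ∈ s, g lam = ∑ lam ∈ s, g (-lam) :=
    Finset.sum_bij' (fun lam _ => -lam) (fun lam _ => -lam) hs hs (by simp) (by simp) (by simp)
  rw [Finset.sum_congr rfl hg, Finset.sum_neg_distrib] at h1
  linarith

lemma dirD_iter_neg {ψ : E d → ℝ} (hψ : ContDiff ℝ ∞ ψ) (lam : E d) (r : ℕ) (x : E d) :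
    (dirD (-lam))^[r] ψ x = (-1) ^ r * (dirD lam)^[r] ψ x := by
  have := congrFun (dirD_iter_smul hψ (-1) lam r) x
  simpa using this

lemma Lop_odd_of_symm (hsy : SymmCond S) {i : ℕ} (hi : Odd i) {ψ : E d → ℝ}
    (hψ : ContDiff ℝ ∞ ψ) (x : E d) : Lop S i ψ x
      = ∑ lam ∈ S.dirs, S.p lam x * (((i + 1).factorial : ℝ)⁻¹ * (dirD lam)^[i + 1] ψ x) := by
  unfold Lop
  rw [sum_eq_zero_of_neg (fun lam hl => (hsy lam hl).1), zero_add]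
  intro lam hl
  rw [(hsy lam hl).2, dirD_iter_neg hψ, (hi.add_even even_two).neg_one_pow]
  ring

lemma Lop_odd_of_antisymm (hsy : SymmCond S) (han : AntisymmCond S) {i : ℕ} (hi : Odd i)
    {ψ : E d → ℝ} (hψ : ContDiff ℝ ∞ ψ) (x : E d) : Lop S i ψ x = 0 := by
  rw [Lop_odd_of_symm hsy hi hψ]
  refine sum_eq_zero_of_neg (fun lam hl => (hsy lam hl).1) fun lam hl => ?_
  rw [han lam hl, dirD_iter_neg hψ, (hi.add_odd odd_one).neg_one_pow]
  ring

lemma CB_Lop_odd (hS : Scheme P h₀ S τ) (hsy : SymmCond S) {n i : ℕ} (hi : Odd i) (hn : n ≤ P.m)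
    {C : ℝ} {ψ : E d → ℝ} (hψ : SB ψ) (hC : CB (n + (i + 1)) C ψ) :
    CB n ((P.kL d n (i + 2) + P.kL d n (i + 1)) * C) (Lop S i ψ) := by
  have e : Lop S i ψ = fun x => ∑ lam ∈ S.dirs,
      S.p lam x * (((i + 1).factorial : ℝ)⁻¹ * (dirD lam)^[i + 1] ψ x) :=
    funext fun x => Lop_odd_of_symm hsy hi hψ.1 x
  rw [e]
  refine (CB_dirD_part (by omega) hS.sum_sq (hS.p_bd.mono hn le_rfl)
      (fun lam hl => (hS.p_sb lam hl).1) hψ hC).mono le_rfl ?_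
  exact mul_le_mul_of_nonneg_right (le_add_of_nonneg_left (P.kL_nonneg d n _)) hC.nonneg

end symmetry

/-- Control of the loss of derivatives in the expansion coefficients: `r j` is the number of
derivatives of the `j`-th coefficient that are under control. -/
def LossCond (S : Coeffs d) (r : ℕ → ℕ) (k : ℕ) (N : ℝ) : Prop :=
  ∀ i j, 1 ≤ i → i + j ≤ k → ∀ (ψ : E d → ℝ) (C : ℝ), SB ψ → CB (r j) C ψ →
    (Odd j → Odd k → SymmCond S → AntisymmCond S → ∀ x, ψ x = 0) →
    CB (r (i + j)) (N * C) (Lop S i ψ)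

/-- The equations for the coefficients of the expansion in which the elliptic operator is
replaced by the difference operator with step `ε`. -/
def IsExpansion (S : Coeffs d) (f : E d → ℝ) (ε : ℝ) (u : ℕ → E d → ℝ) : Prop :=
  ∀ j, SB (u j) ∧ ∀ x, opLh S ε (u j) x
    + ((if j = 0 then f x else 0) + ∑ i ∈ Finset.range j, Lop S (j - i) (u i) x) = 0

/-- Recursive construction of the coefficients of the expansion from a solution operator. -/
def expansionSeq (S : Coeffs d) (f : E d → ℝ) (sol : (E d → ℝ) → E d → ℝ) (j : ℕ) : E d → ℝ :=
  sol fun x => (if j = 0 then f x else 0)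
    + ∑ i : Fin j, Lop S (j - i) (expansionSeq S f sol i) x
termination_by j
decreasing_by exact i.2

lemma Scheme.exists_expansion (hS : Scheme P h₀ S τ) {ε : ℝ} (hε : 0 < ε) (hε₀ : ε ≤ h₀)
    {f : E d → ℝ} (hf : SB f) : ∃ u, IsExpansion S f ε u := by
  have hsol : ∀ g : E d → ℝ, ∃ v, SB g → SB v ∧ ∀ x, opLh S ε v x + g x = 0 := by
    intro g
    by_cases hg : SB g
    · obtain ⟨v, hv⟩ := exists_smooth_diffSol (hS.mono hε hε₀) hS.q_sb hS.p_sb hS.c_sb hg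
      exact ⟨v, fun _ => hv⟩
    · exact ⟨0, fun h => absurd h hg⟩
  choose sol hsol using hsol
  refine ⟨expansionSeq S f sol, fun j => ?_⟩
  induction j using Nat.strong_induction_on with
  | _ j ih =>
    have hg : SB (fun x => (if j = 0 then f x else 0)
        + ∑ i : Fin j, Lop S (j - i) (expansionSeq S f sol i) x) := by
      refine SB.add ?_ (SB.sum fun i _ => SB_Lop hS _ (ih i i.2).1)
      split_ifs
      · exact hf
      · exact SB_zero
    have h1 := hsol _ hg
    have e : expansionSeq S f sol j = sol fun x => (if j = 0 then f x else 0)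
        + ∑ i : Fin j, Lop S (j - i) (expansionSeq S f sol i) x := by rw [expansionSeq]
    rw [← e] at h1
    refine ⟨h1.1, fun x => ?_⟩
    rw [Finset.sum_range]
    exact h1.2 x

lemma IsExpansion.odd_eq_zero {ε : ℝ} {f : E d → ℝ} {u : ℕ → E d → ℝ}
    (hu : IsExpansion S f ε u) (hS : Mono S ε P.c₀) (hsy : SymmCond S) (han : AntisymmCond S)
    (j : ℕ) (hj : Odd j) : ∀ x, u j x = 0 := by
  induction j using Nat.strong_induction_on with
  | _ j ih =>
    have h0 : ∀ x, opLh S ε (u j) x = 0 := by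
      intro x
      have h1 := (hu j).2 x
      rw [if_neg (by rintro rfl; simp at hj), zero_add, Finset.sum_eq_zero, add_zero] at h1
      · exact h1
      intro i hi
      have hij := Finset.mem_range.1 hi
      rcases Nat.even_or_odd i with he | ho
      · exact Lop_odd_of_antisymm hsy han (Nat.Odd.sub_even hij.le hj he) (hu i).1.1 x
      · have : u i = fun _ => 0 := funext (ih i hij ho)
        rw [this]
        have hz : ∀ lam : E d, ∀ r, (dirD lam)^[r] (fun _ : E d => (0 : ℝ)) = fun _ => 0 := by
          intro lam r
          have := dirD_iter_const_mul (φ := fun _ : E d => (0 : ℝ)) contDiff_const lam 0 r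
          simpa using this
        simp [Lop, hz]
    intro x
    have := hS.abs_le_of_abs_opLh_le (hu j).1.bdd (R := 0) (fun x => by rw [h0 x, abs_zero]) x
    rw [zero_div] at this
    exact abs_nonpos_iff.1 this

lemma sum_triangle (G : ℕ → ℕ → ℝ) (k : ℕ) :
    ∑ j ∈ Finset.range (k + 1), ∑ i ∈ Finset.range (k - j), G j (i + 1)
      = ∑ j ∈ Finset.range (k + 1), ∑ i ∈ Finset.range j, G i (j - i) := by
  induction k with
  | zero => simp
  | succ k ih =>
    rw [Finset.sum_range_succ _ (k + 1), Finset.sum_range_succ _ (k + 1), ← ih, Nat.sub_self,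
      Finset.sum_range_zero, add_zero, ← Finset.sum_add_distrib]
    refine Finset.sum_congr rfl fun j hj => ?_
    have : j ≤ k := Nat.lt_succ_iff.1 (Finset.mem_range.1 hj)
    rw [Nat.succ_sub this, Finset.sum_range_succ]

/-- Bounds for the coefficients of the expansion. -/
lemma exists_expansion_bound (P : Params) (d k : ℕ) (r : ℕ → ℕ) (N₀ : ℝ) (hN₀ : 0 ≤ N₀)
    (hr : ∀ j, j ≤ k → r j ≤ P.m) (J : ℕ) (hJ : J ≤ k) :
    ∃ N, 0 ≤ N ∧ ∀ (h₀ : ℝ) (S : Coeffs d) (τ : E d → ℝ), Scheme P h₀ S τ → LossCond S r k N₀ →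
      ∀ (f : E d → ℝ) (F ε : ℝ) (u : ℕ → E d → ℝ), SB f → CB P.m F f → 0 < ε → ε ≤ h₀ →
        IsExpansion S f ε u → ∀ j ≤ J, CB (r j) (N * F) (u j) := by
  obtain ⟨NA, hNA, HA⟩ := exists_apriori P d
  induction J with
  | zero =>
    refine ⟨NA, hNA, ?_⟩
    intro h₀ S τ hS hL f F ε u hf hF hε hε₀ hu j hj
    obtain rfl := Nat.le_zero.1 hj
    have h1 := (hu 0).2
    simp only [if_true, Finset.sum_range_zero, add_zero] at h1
    exact HA (r 0) (hr 0 hJ) h₀ S τ hS ε hε hε₀ f (u 0) F hf (hu 0).1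
      (hF.mono (hr 0 hJ) le_rfl) h1
  | succ J ih =>
    obtain ⟨N, hN, ih⟩ := ih (by omega)
    refine ⟨N + NA * ((J + 1) * (N₀ * N)), by positivity, ?_⟩
    intro h₀ S τ hS hL f F ε u hf hF hε hε₀ hu j hj
    have hF0 := hF.nonneg
    have IH := ih h₀ S τ hS hL f F ε u hf hF hε hε₀ hu
    rcases Nat.lt_or_ge J j with hlt | hle
    · obtain rfl : j = J + 1 := le_antisymm hj hlt
      have h1 := (hu (J + 1)).2
      simp only [Nat.succ_ne_zero, if_false, zero_add] at h1
      have h2 : CB (r (J + 1)) (∑ i ∈ Finset.range (J + 1), N₀ * (N * F))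
          (fun x => ∑ i ∈ Finset.range (J + 1), Lop S (J + 1 - i) (u i) x) := by
        refine CB.sum (fun i hi => ?_) fun i _ => (SB_Lop hS _ (hu i).1).1
        have hi' : i < J + 1 := Finset.mem_range.1 hi
        have := hL (J + 1 - i) i (by omega) (by omega) (u i) (N * F) (hu i).1 (IH i (by omega))
          (fun ho _ hsy han => hu.odd_eq_zero (hS.mono hε hε₀) hsy han i ho)
        rwa [Nat.sub_add_cancel hi'.le] at this
      have h3 := HA (r (J + 1)) (hr _ hJ) h₀ S τ hS ε hε hε₀ _ (u (J + 1)) _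
        (SB.sum fun i _ => SB_Lop hS _ (hu i).1) (hu (J + 1)).1 h2 h1
      refine h3.mono le_rfl ?_
      rw [Finset.sum_const, Finset.card_range, nsmul_eq_mul]
      push_cast
      have : 0 ≤ N * F := by positivity
      linarith
    · refine (IH j hle).mono le_rfl (mul_le_mul_of_nonneg_right ?_ hF0)
      have : 0 ≤ NA * ((J + 1) * (N₀ * N)) := by positivity
      linarith

/-- The expansion of the solutions of the difference equation in powers of the step. -/
theorem exists_expansion_estimate (P : Params) (d k l : ℕ) (r : ℕ → ℕ) (N₀ : ℝ) (hN₀ : 0 ≤ N₀)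
    (hr : ∀ j, j ≤ k → r j ≤ P.m) (hrl : ∀ j, j ≤ k → l + (k - j + 3) ≤ r j) :
    ∃ N, 0 ≤ N ∧ ∀ (h₀ : ℝ) (S : Coeffs d) (τ : E d → ℝ), Scheme P h₀ S τ → LossCond S r k N₀ →
      ∀ (f : E d → ℝ) (F ε : ℝ) (u : ℕ → E d → ℝ), SB f → CB P.m F f → 0 < ε → ε ≤ h₀ →
        IsExpansion S f ε u → ∀ h, 0 < h → h ≤ h₀ → ∀ v : E d → ℝ, SB v →
        (∀ x, opLh S h v x + f x = 0) →
        CB l (N * F * (h ^ (k + 1) + ε * (1 + h) ^ k))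
          (fun x => v x - ∑ j ∈ Finset.range (k + 1), h ^ j * u j x) := by
  obtain ⟨NA, hNA, HA⟩ := exists_apriori P d
  obtain ⟨NB, hNB, HB⟩ := exists_expansion_bound P d k r N₀ hN₀ hr k le_rfl
  have hl : l ≤ P.m := by have := hrl 0 (Nat.zero_le _); have := hr 0 (Nat.zero_le _); omega
  set κ : ℕ → ℝ := fun s => P.kL d l (s + 3) + P.kL d l (s + 2) with hκ
  have hκ0 : ∀ s, 0 ≤ κ s := fun s => add_nonneg (P.kL_nonneg _ _ _) (P.kL_nonneg _ _ _)
  refine ⟨NA * ∑ j ∈ Finset.range (k + 1), (κ (k - j) + κ 0) * NB,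
    mul_nonneg hNA (Finset.sum_nonneg fun j _ => mul_nonneg (add_nonneg (hκ0 _) (hκ0 _)) hNB), ?_⟩
  intro h₀ S τ hS hL f F ε u hf hF hε hε₀ hu h hh hh₀ v hv hveq
  have hF0 := hF.nonneg
  have hub := HB h₀ S τ hS hL f F ε u hf hF hε hε₀ hu
  set g : E d → ℝ := fun x => ∑ j ∈ Finset.range (k + 1),
    h ^ j * (Lrem S (k - j) h (u j) x - Lrem S 0 ε (u j) x) with hg
  have hgs : ∀ j, SB (fun x => h ^ j * (Lrem S (k - j) h (u j) x - Lrem S 0 ε (u j) x)) := fun j =>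
    ((SB_Lrem hS _ _ (hu j).1).sub (SB_Lrem hS _ _ (hu j).1)).const_mul _
  have hρs : SB (fun x => ∑ j ∈ Finset.range (k + 1), h ^ j * u j x) :=
    SB.sum fun j _ => (hu j).1.const_mul _
  have hgb : CB l (∑ j ∈ Finset.range (k + 1),
      (κ (k - j) + κ 0) * NB * F * (h ^ (k + 1) + ε * (1 + h) ^ k)) g := by
    refine CB.sum (fun j hj => ?_) fun j _ => (hgs j).1
    have hj' : j ≤ k := Nat.lt_succ_iff.1 (Finset.mem_range.1 hj)
    have h1 := CB_Lrem hS hh hl (hu j).1 ((hub j hj').mono (hrl j hj') le_rfl)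
    have h2 := CB_Lrem hS hε (r := 0) hl (hu j).1
      ((hub j hj').mono (by have := hrl j hj'; omega) le_rfl)
    refine ((h1.sub h2 (SB_Lrem hS _ _ (hu j).1).1 (SB_Lrem hS _ _ (hu j).1).1).const_mul
      ((SB_Lrem hS _ _ (hu j).1).sub (SB_Lrem hS _ _ (hu j).1)).1 _).mono le_rfl ?_
    rw [abs_of_nonneg (by positivity), zero_add, pow_one, mul_add]
    have e1 : h ^ j * ((P.kL d l (k - j + 3) + P.kL d l (k - j + 2)) * h ^ (k - j + 1) * (NB * F))
        = κ (k - j) * NB * F * h ^ (k + 1) := by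
      have e3 : h ^ (k + 1) = h ^ j * h ^ (k - j + 1) := by
        rw [← pow_add]
        congr 1
        omega
      rw [e3]
      simp only [hκ]
      ring
    have e2 : h ^ j * ((P.kL d l (0 + 3) + P.kL d l (0 + 2)) * ε * (NB * F))
        ≤ κ 0 * NB * F * (ε * (1 + h) ^ k) := by
      have h3 : h ^ j ≤ (1 + h) ^ k :=
        (pow_le_pow_left₀ hh.le (by linarith) j).trans (pow_le_pow_right₀ (by linarith) hj')
      have h4 : 0 ≤ κ 0 * ε * (NB * F) := by have := hκ0 0; positivity
      have := mul_le_mul_of_nonneg_right h3 h4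
      simp only [hκ] at this ⊢
      linarith
    rw [e1]
    have h5 : 0 ≤ κ 0 * NB * F * h ^ (k + 1) := by have := hκ0 0; positivity
    have h6 : 0 ≤ κ (k - j) * NB * F * (ε * (1 + h) ^ k) := by have := hκ0 (k - j); positivity
    simp only [zero_add] at e2
    linarith
  have heq : ∀ x, opLh S h (fun x => v x - ∑ j ∈ Finset.range (k + 1), h ^ j * u j x) x
      + g x = 0 := by
    intro x
    have hM : ∀ j ∈ Finset.range (k + 1), h ^ j * (opM S h (u j) x - S.c x * u j x)
        = h ^ j * (Lrem S (k - j) h (u j) x - Lrem S 0 ε (u j) x)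
          - h ^ j * (if j = 0 then f x else 0)
          + (∑ i ∈ Finset.range (k - j), h ^ (j + (i + 1)) * Lop S (i + 1) (u j) x
            - ∑ i ∈ Finset.range j, h ^ (i + (j - i)) * Lop S (j - i) (u i) x) := by
      intro j _
      have h1 := opM_expansion hS.drift hh.ne' (hu j).1.1 (k - j) x
      have h2 := opM_expansion hS.drift hε.ne' (hu j).1.1 0 x
      have h3 := (hu j).2 x
      rw [opLh_eq] at h3
      rw [Finset.sum_range_succ'] at h1
      simp only [zero_add, Finset.sum_range_one, pow_zero, one_mul] at h1 h2
      have e1 : ∑ i ∈ Finset.range (k - j), h ^ (j + (i + 1)) * Lop S (i + 1) (u j) x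
          = h ^ j * ∑ i ∈ Finset.range (k - j), h ^ (i + 1) * Lop S (i + 1) (u j) x := by
        rw [Finset.mul_sum]
        exact Finset.sum_congr rfl fun i _ => by rw [pow_add]; ring
      have e2 : ∑ i ∈ Finset.range j, h ^ (i + (j - i)) * Lop S (j - i) (u i) x
          = h ^ j * ∑ i ∈ Finset.range j, Lop S (j - i) (u i) x := by
        rw [Finset.mul_sum]
        refine Finset.sum_congr rfl fun i hi => ?_
        rw [Nat.add_sub_cancel' (Finset.mem_range.1 hi).le]
      rw [e1, e2, ← mul_sub, ← mul_sub, ← mul_add]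
      congr 1
      linarith
    have hsum := Finset.sum_congr rfl hM
    rw [Finset.sum_add_distrib, Finset.sum_sub_distrib, Finset.sum_sub_distrib,
      sum_triangle (fun j i => h ^ (j + i) * Lop S i (u j) x), sub_self, add_zero] at hsum
    have e0 : ∑ j ∈ Finset.range (k + 1), h ^ j * (if j = 0 then f x else 0) = f x := by
      rw [Finset.sum_range_succ', Finset.sum_eq_zero (fun i _ => by simp)]
      simp
    rw [e0] at hsum
    have h4 := hveq x
    rw [opLh_eq] at h4 ⊢
    rw [opM_sub, opM_sum]
    simp only [opM_const_mul]
    have e3 : ∑ j ∈ Finset.range (k + 1), h ^ j * (opM S h (u j) x - S.c x * u j x)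
        = ∑ j ∈ Finset.range (k + 1), h ^ j * opM S h (u j) x
          - S.c x * ∑ j ∈ Finset.range (k + 1), h ^ j * u j x := by
      rw [Finset.mul_sum, ← Finset.sum_sub_distrib]
      exact Finset.sum_congr rfl fun j _ => by ring
    rw [e3] at hsum
    have e4 : g x = ∑ j ∈ Finset.range (k + 1),
      h ^ j * (Lrem S (k - j) h (u j) x - Lrem S 0 ε (u j) x) := rfl
    rw [e4]
    linarith
  refine (HA l hl h₀ S τ hS h hh hh₀ g _ _ (SB.sum fun j _ => hgs j) (hv.sub hρs) hgb heq).mono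
    le_rfl (le_of_eq ?_)
  simp only [← Finset.sum_mul]
  ring

end

end FDRichardson

open MeasureTheory
open scoped ContDiff

namespace FDRichardson

noncomputable section

variable {d : ℕ} {P : Params} {h₀ h : ℝ} {S : Coeffs d} {τ : E d → ℝ}

lemma sum_weights {r : ℝ} (hr0 : 0 < r) (hr1 : r < 1) (n : ℕ) (i : ℕ) (hi : i ≤ n) :
    ∑ j : Fin (n + 1), weights r n j * (r ^ (j : ℕ)) ^ i = if i = 0 then 1 else 0 := by
  have hV : vand r n = Matrix.vandermonde fun i : Fin (n + 1) => r ^ (i : ℕ) := by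
    ext i j
    simp [vand, Matrix.vandermonde_apply, pow_mul]
  have hdet : IsUnit (vand r n).det := by
    rw [hV, isUnit_iff_ne_zero, Matrix.det_vandermonde_ne_zero_iff]
    intro i j hij
    exact Fin.ext (pow_right_injective₀ hr0 hr1.ne hij)
  have h1 : Matrix.vecMul (weights r n) (vand r n) = Pi.single 0 1 := by
    rw [weights, Matrix.vecMul_vecMul, Matrix.nonsing_inv_mul _ hdet, Matrix.vecMul_one]
  have h2 := congrFun h1 ⟨i, Nat.lt_succ_of_le hi⟩
  rw [Matrix.vecMul, dotProduct, hV] at h2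
  simp only [Matrix.vandermonde_apply] at h2
  rw [h2, Pi.single_apply]
  simp [Fin.ext_iff]

/-- A common constant for the operators in the expansion. -/
def Params.lossConst (P : Params) (d : ℕ) : ℝ :=
  ∑ n ∈ Finset.range (P.m + 1), ∑ i ∈ Finset.range (P.m + 1),
    (P.kL d n (i + 2) + P.kL d n (i + 1))

lemma Params.lossConst_nonneg (P : Params) (d : ℕ) : 0 ≤ P.lossConst d :=
  Finset.sum_nonneg fun _ _ => Finset.sum_nonneg fun _ _ =>
    add_nonneg (P.kL_nonneg _ _ _) (P.kL_nonneg _ _ _)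

lemma Params.le_lossConst (P : Params) (d : ℕ) {n i : ℕ} (hn : n ≤ P.m) (hi : i ≤ P.m) :
    P.kL d n (i + 2) + P.kL d n (i + 1) ≤ P.lossConst d := by
  have h1 := Finset.single_le_sum (f := fun i => P.kL d n (i + 2) + P.kL d n (i + 1))
    (fun _ _ => add_nonneg (P.kL_nonneg _ _ _) (P.kL_nonneg _ _ _))
    (Finset.mem_range.2 (Nat.lt_succ_of_le hi))
  refine h1.trans (Finset.single_le_sum (f := fun n => ∑ i ∈ Finset.range (P.m + 1),
    (P.kL d n (i + 2) + P.kL d n (i + 1))) (fun _ _ => Finset.sum_nonneg fun _ _ =>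
    add_nonneg (P.kL_nonneg _ _ _) (P.kL_nonneg _ _ _))
    (Finset.mem_range.2 (Nat.lt_succ_of_le hn)))

lemma Scheme.lossCond (hS : Scheme P h₀ S τ) {k : ℕ} (hk : 3 * k ≤ P.m) :
    LossCond S (fun j => P.m - 3 * j) k (P.lossConst d) := by
  intro i j hi hij ψ C hψ hC _
  dsimp only at hC ⊢
  exact (CB_Lop hS (n := P.m - 3 * (i + j)) (by omega) hψ (hC.mono (by omega) le_rfl)).mono le_rfl
    (mul_le_mul_of_nonneg_right (P.le_lossConst d (by omega) (by omega)) hC.nonneg)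

lemma Scheme.lossCond_of_symm (hS : Scheme P h₀ S τ) (hsy : SymmCond S) {k : ℕ}
    (hk : 2 * k ≤ P.m) : LossCond S (fun j => P.m - 2 * j) k (P.lossConst d) := by
  intro i j hi hij ψ C hψ hC _
  dsimp only at hC ⊢
  have h1 : CB (P.m - 2 * (i + j))
      ((P.kL d (P.m - 2 * (i + j)) (i + 2) + P.kL d (P.m - 2 * (i + j)) (i + 1)) * C)
      (Lop S i ψ) := by
    rcases Nat.even_or_odd i with he | ho
    · have : 2 ≤ i := by obtain ⟨t, rfl⟩ := he; omega
      exact CB_Lop hS (by omega) hψ (hC.mono (by omega) le_rfl)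
    · exact CB_Lop_odd hS hsy ho (by omega) hψ (hC.mono (by omega) le_rfl)
  exact h1.mono le_rfl
    (mul_le_mul_of_nonneg_right (P.le_lossConst d (by omega) (by omega)) hC.nonneg)

lemma Scheme.lossCond_of_antisymm (hS : Scheme P h₀ S τ) (hsy : SymmCond S)
    (han : AntisymmCond S) {k : ℕ} (hk : 2 * k ≤ P.m) :
    LossCond S (fun j => if Odd j then P.m - 2 * j + 2 else P.m - 2 * j) k (P.lossConst d) := by
  intro i j hi hij ψ C hψ hC _
  rcases Nat.even_or_odd i with he | ho
  · have : 2 ≤ i := by obtain ⟨t, rfl⟩ := he; omega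
    have hle : (if Odd (i + j) then P.m - 2 * (i + j) + 2 else P.m - 2 * (i + j)) ≤ P.m := by
      split_ifs <;> omega
    refine (CB_Lop hS hle hψ (hC.mono ?_ le_rfl)).mono le_rfl
      (mul_le_mul_of_nonneg_right (P.le_lossConst d hle (by omega)) hC.nonneg)
    have : Odd (i + j) ↔ Odd j := by
      rw [Nat.odd_add]; simp only [← Nat.not_even_iff_odd, he, not_true]; tauto
    simp only [this]
    split_ifs <;> omega
  · have : Lop S i ψ = fun _ => 0 := funext fun x => Lop_odd_of_antisymm hsy han ho hψ.1 x
    rw [this]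
    have hz : ∀ w : List (Fin d), Dw w (fun _ : E d => (0 : ℝ)) = fun _ => 0 := fun w => Dw_zero w
    intro w _ x
    rw [hz, abs_zero]
    exact mul_nonneg (P.lossConst_nonneg d) hC.nonneg

/-- The alternatives under which the expansion has `k` terms controlled together with `l`
derivatives. -/
def RateCond (S : Coeffs d) (m k l : ℕ) : Prop :=
  3 * k + 3 + l ≤ m ∨ (2 * k + 3 + l ≤ m ∧ SymmCond S) ∨
    (Odd k ∧ 2 * k + 2 + l ≤ m ∧ SymmCond S ∧ AntisymmCond S)

lemma exists_rate_estimate (P : Params) (d k l : ℕ) :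
    ∃ N, 0 ≤ N ∧ ∀ (h₀ : ℝ) (S : Coeffs d) (τ : E d → ℝ), Scheme P h₀ S τ → RateCond S P.m k l →
      ∀ (f : E d → ℝ) (F ε : ℝ) (u : ℕ → E d → ℝ), SB f → CB P.m F f → 0 < ε → ε ≤ h₀ →
        IsExpansion S f ε u → ∀ h, 0 < h → h ≤ h₀ → ∀ v : E d → ℝ, SB v →
        (∀ x, opLh S h v x + f x = 0) →
        CB l (N * F * (h ^ (k + 1) + ε * (1 + h) ^ k))
          (fun x => v x - ∑ j ∈ Finset.range (k + 1), h ^ j * u j x) := by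
  have H : ∀ r : ℕ → ℕ, ∃ N, 0 ≤ N ∧
      ((∀ j, j ≤ k → r j ≤ P.m) ∧ (∀ j, j ≤ k → l + (k - j + 3) ≤ r j) →
      ∀ (h₀ : ℝ) (S : Coeffs d) (τ : E d → ℝ), Scheme P h₀ S τ →
      LossCond S r k (P.lossConst d) →
      ∀ (f : E d → ℝ) (F ε : ℝ) (u : ℕ → E d → ℝ), SB f → CB P.m F f → 0 < ε → ε ≤ h₀ →
        IsExpansion S f ε u → ∀ h, 0 < h → h ≤ h₀ → ∀ v : E d → ℝ, SB v →
        (∀ x, opLh S h v x + f x = 0) →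
        CB l (N * F * (h ^ (k + 1) + ε * (1 + h) ^ k))
          (fun x => v x - ∑ j ∈ Finset.range (k + 1), h ^ j * u j x)) := by
    intro r
    by_cases hr : (∀ j, j ≤ k → r j ≤ P.m) ∧ (∀ j, j ≤ k → l + (k - j + 3) ≤ r j)
    · obtain ⟨N, hN, H⟩ := exists_expansion_estimate P d k l r (P.lossConst d)
        (P.lossConst_nonneg d) hr.1 hr.2
      exact ⟨N, hN, fun _ => H⟩
    · exact ⟨0, le_rfl, fun h => absurd h hr⟩
  obtain ⟨N₁, hN₁, H₁⟩ := H fun j => P.m - 3 * j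
  obtain ⟨N₂, hN₂, H₂⟩ := H fun j => P.m - 2 * j
  obtain ⟨N₃, hN₃, H₃⟩ := H fun j => if Odd j then P.m - 2 * j + 2 else P.m - 2 * j
  refine ⟨N₁ + N₂ + N₃, by positivity, ?_⟩
  intro h₀ S τ hS hR f F ε u hf hF hε hε₀ hu h hh hh₀ v hv hveq
  have hF0 := hF.nonneg
  have hpos : 0 ≤ F * (h ^ (k + 1) + ε * (1 + h) ^ k) := by positivity
  have key : ∀ N, N ≤ N₁ + N₂ + N₃ → N * F * (h ^ (k + 1) + ε * (1 + h) ^ k)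
      ≤ (N₁ + N₂ + N₃) * F * (h ^ (k + 1) + ε * (1 + h) ^ k) := fun N hN => by
    rw [mul_assoc, mul_assoc _ F]
    exact mul_le_mul_of_nonneg_right hN hpos
  rcases hR with h1 | ⟨h1, hsy⟩ | ⟨hk, h1, hsy, han⟩
  · refine (H₁ ⟨fun j _ => by omega, fun j hj => by omega⟩ h₀ S τ hS
      (hS.lossCond (by omega)) f F ε u hf hF hε hε₀ hu h hh hh₀ v hv hveq).mono le_rfl
      (key _ (by linarith))
  · refine (H₂ ⟨fun j _ => by omega, fun j hj => by omega⟩ h₀ S τ hS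
      (hS.lossCond_of_symm hsy (by omega)) f F ε u hf hF hε hε₀ hu h hh hh₀ v hv hveq).mono le_rfl
      (key _ (by linarith))
  · refine (H₃ ⟨fun j hj => ?_, fun j hj => ?_⟩ h₀ S τ hS
      (hS.lossCond_of_antisymm hsy han (by omega)) f F ε u hf hF hε hε₀ hu h hh hh₀ v hv
      hveq).mono le_rfl (key _ (by linarith))
    · split_ifs with ho
      · obtain ⟨t, rfl⟩ := ho; omega
      · omega
    · split_ifs with ho
      · omega
      · obtain ⟨t, rfl⟩ := hk
        obtain ⟨s, rfl⟩ := Nat.not_odd_iff_even.1 ho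
        omega

lemma CB_combination {k l J : ℕ} {A B : ℝ} (hB : 0 ≤ B) {b : Fin (J + 1) → ℝ}
    {u : ℕ → E d → ℝ} {v : ℝ → E d → ℝ} (hu : ∀ j, SB (u j))
    (hv : ∀ j : ℕ, SB (v ((1 / 2 : ℝ) ^ j * h))) (hh : 0 < h) (hA : 0 ≤ A)
    (hb : ∀ i ≤ k, ∀ x, (∑ j, b j * ((1 / 2 : ℝ) ^ (j : ℕ)) ^ i) * u i x
      = if i = 0 then u 0 x else 0)
    (H : ∀ s, 0 < s → s ≤ h → ∀ j : ℕ, s = (1 / 2 : ℝ) ^ j * h →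
      CB l (A * (s ^ (k + 1) + B * (1 + s) ^ k))
        (fun x => v s x - ∑ i ∈ Finset.range (k + 1), s ^ i * u i x)) :
    CB l ((∑ j, |b j|) * A * (h ^ (k + 1) + B * (1 + h) ^ k))
      (fun x => ∑ j : Fin (J + 1), b j * v ((1 / 2 : ℝ) ^ (j : ℕ) * h) x - u 0 x) := by
  have e : (fun x => ∑ j : Fin (J + 1), b j * v ((1 / 2 : ℝ) ^ (j : ℕ) * h) x - u 0 x)
      = fun x => ∑ j : Fin (J + 1), b j * (v ((1 / 2 : ℝ) ^ (j : ℕ) * h) x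
        - ∑ i ∈ Finset.range (k + 1), ((1 / 2 : ℝ) ^ (j : ℕ) * h) ^ i * u i x) := by
    funext x
    simp only [mul_sub, Finset.sum_sub_distrib]
    congr 1
    simp only [Finset.mul_sum]
    rw [Finset.sum_comm]
    have h1 : ∀ i ∈ Finset.range (k + 1),
        ∑ j : Fin (J + 1), b j * (((1 / 2 : ℝ) ^ (j : ℕ) * h) ^ i * u i x)
          = h ^ i * if i = 0 then u 0 x else 0 := by
      intro i hi
      rw [← hb i (Nat.lt_succ_iff.1 (Finset.mem_range.1 hi)) x, Finset.sum_mul, Finset.mul_sum]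
      exact Finset.sum_congr rfl fun j _ => by rw [mul_pow]; ring
    rw [Finset.sum_congr rfl h1, Finset.sum_range_succ', Finset.sum_eq_zero (fun i _ => by simp)]
    simp
  rw [e, mul_assoc, Finset.sum_mul]
  have hsm : ∀ j : ℕ, SB (fun x => v ((1 / 2 : ℝ) ^ j * h) x
        - ∑ i ∈ Finset.range (k + 1), ((1 / 2 : ℝ) ^ j * h) ^ i * u i x) := fun j =>
    (hv j).sub (SB.sum fun i _ => (hu i).const_mul _)
  refine CB.sum (fun j _ => ?_) fun j _ => ((hsm j).const_mul _).1
  have hs0 : 0 < (1 / 2 : ℝ) ^ (j : ℕ) * h := by positivity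
  have hs1 : (1 / 2 : ℝ) ^ (j : ℕ) * h ≤ h :=
    mul_le_of_le_one_left hh.le (pow_le_one₀ (by norm_num) (by norm_num))
  refine ((H _ hs0 hs1 j rfl).const_mul (hsm j).1 (b j)).mono le_rfl ?_
  refine mul_le_mul_of_nonneg_left (mul_le_mul_of_nonneg_left ?_ hA) (abs_nonneg _)
  refine add_le_add (pow_le_pow_left₀ hs0.le hs1 _) (mul_le_mul_of_nonneg_left ?_ hB)
  exact pow_le_pow_left₀ (by linarith) (by linarith) _

/-- Richardson extrapolation for schemes with smooth coefficients. -/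
theorem exists_richardson_estimate (P : Params) (d k l : ℕ) :
    ∃ N, 0 ≤ N ∧ ∀ (h₀ : ℝ) (S : Coeffs d) (τ : E d → ℝ), Scheme P h₀ S τ → RateCond S P.m k l →
      ∀ (f : E d → ℝ) (F ε : ℝ) (u : E d → ℝ) (v : ℝ → E d → ℝ), SB f → CB P.m F f →
        0 < ε → ε ≤ h₀ → SB u → (∀ x, opLh S ε u x + f x = 0) →
        (∀ h, 0 < h → h ≤ h₀ → SB (v h) ∧ ∀ x, opLh S h (v h) x + f x = 0) →
        ∀ h, 0 < h → h ≤ h₀ →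
        CB l (N * F * (h ^ (k + 1) + ε * (1 + h) ^ k)) (fun x => richardson k v h x - u x) ∧
        ((Odd k ∧ SymmCond S ∧ AntisymmCond S) →
          CB l (N * F * (h ^ (k + 1) + ε * (1 + h) ^ k))
            (fun x => richardsonOdd k v h x - u x)) := by
  obtain ⟨N, hN, HN⟩ := exists_rate_estimate P d k l
  set b₁ := ∑ j, |weights (1 / 2) k j| with hb₁
  set b₂ := ∑ j, |weights (1 / 4) ((k - 1) / 2) j| with hb₂
  have hb₁0 : 0 ≤ b₁ := Finset.sum_nonneg fun _ _ => abs_nonneg _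
  have hb₂0 : 0 ≤ b₂ := Finset.sum_nonneg fun _ _ => abs_nonneg _
  refine ⟨(b₁ + b₂) * N, by positivity, ?_⟩
  intro h₀ S τ hS hR f F ε w v hf hF hε hε₀ hw hweq hv h hh hh₀
  have hF0 := hF.nonneg
  obtain ⟨u, hu⟩ := hS.exists_expansion hε hε₀ hf
  have hu0 : u 0 = w := by
    have h1 := (hu 0).2
    simp only [if_true, Finset.sum_range_zero, add_zero] at h1
    exact (hS.mono hε hε₀).diffSol_unique ⟨(hu 0).1.bdd, h1⟩ ⟨hw.bdd, hweq⟩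
  have hle : ∀ j : ℕ, 0 < (1 / 2 : ℝ) ^ j * h ∧ (1 / 2 : ℝ) ^ j * h ≤ h₀ := fun j =>
    ⟨by positivity, (mul_le_of_le_one_left hh.le
      (pow_le_one₀ (by norm_num) (by norm_num))).trans hh₀⟩
  have H : ∀ s, 0 < s → s ≤ h → ∀ j : ℕ, s = (1 / 2 : ℝ) ^ j * h →
      CB l (N * F * (s ^ (k + 1) + ε * (1 + s) ^ k))
        (fun x => v s x - ∑ i ∈ Finset.range (k + 1), s ^ i * u i x) := fun s hs hsh _ _ =>
    HN h₀ S τ hS hR f F ε u hf hF hε hε₀ hu s hs (hsh.trans hh₀) (v s)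
      (hv s hs (hsh.trans hh₀)).1 (hv s hs (hsh.trans hh₀)).2
  have hpos : 0 ≤ N * F * (h ^ (k + 1) + ε * (1 + h) ^ k) := by positivity
  have key : ∀ b, b ≤ b₁ + b₂ → b * (N * F) * (h ^ (k + 1) + ε * (1 + h) ^ k)
      ≤ (b₁ + b₂) * N * F * (h ^ (k + 1) + ε * (1 + h) ^ k) := fun b hb => by
    rw [mul_assoc b, mul_assoc (b₁ + b₂), mul_assoc (b₁ + b₂)]
    exact mul_le_mul_of_nonneg_right hb hpos
  subst hu0
  refine ⟨?_, ?_⟩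
  · refine (CB_combination (k := k) hε.le (fun j => (hu j).1)
      (fun j => (hv _ (hle j).1 (hle j).2).1) hh (by positivity) ?_ H).mono le_rfl
      (key _ (by linarith))
    intro i hi x
    rw [sum_weights (by norm_num) (by norm_num) k i hi]
    split_ifs with h0
    · rw [h0, one_mul]
    · rw [zero_mul]
  · rintro ⟨hk, hsy, han⟩
    refine (CB_combination (k := k) hε.le (fun j => (hu j).1)
      (fun j => (hv _ (hle j).1 (hle j).2).1) hh (by positivity) ?_ H).mono le_rfl
      (key _ (by linarith))
    intro i hi x
    rcases Nat.even_or_odd i with he | ho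
    · obtain ⟨t, rfl⟩ := he
      obtain ⟨q, rfl⟩ := hk
      have h1 := sum_weights (r := 1 / 4) (by norm_num) (by norm_num) ((2 * q + 1 - 1) / 2) t
        (by omega)
      have h2 : ∀ j : ℕ, ((1 / 2 : ℝ) ^ j) ^ (t + t) = ((1 / 4 : ℝ) ^ j) ^ t := fun j => by
        rw [← two_mul, pow_mul, ← pow_mul _ j 2, mul_comm j 2, pow_mul]
        norm_num
      simp only [h2]
      rw [h1]
      by_cases ht : t = 0
      · subst ht; simp
      · rw [if_neg ht, if_neg (by omega), zero_mul]
    · rw [hu.odd_eq_zero (hS.mono hε hε₀) hsy han i ho, mul_zero, if_neg]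
      rintro rfl
      simp at ho

end

end FDRichardson

open MeasureTheory
open scoped ContDiff

namespace FDRichardson

noncomputable section

variable {d : ℕ} {ι : Type*}

section words

/-- The word along which the multi-index derivative is taken. -/
def wordOf (α : Fin d → ℕ) : List (Fin d) :=
  (List.finRange d).reverse.flatMap fun i => List.replicate (α i) i

lemma Dw_replicate (n : ℕ) (i : Fin d) (φ : E d → ℝ) :
    Dw (List.replicate n i) φ = (pderiv i)^[n] φ := by
  induction n generalizing φ with
  | zero => rfl
  | succ n ih => rw [List.replicate_succ, Dw_cons, ih, Function.iterate_succ_apply]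

lemma multiDeriv_eq_Dw (α : Fin d → ℕ) (φ : E d → ℝ) : multiDeriv α φ = Dw (wordOf α) φ := by
  have key : ∀ l : List (Fin d), l.foldr (fun i ψ => (pderiv i)^[α i] ψ) φ
      = Dw (l.reverse.flatMap fun i => List.replicate (α i) i) φ := by
    intro l
    induction l with
    | nil => rfl
    | cons i l ih =>
      rw [List.foldr_cons, ih, List.reverse_cons, List.flatMap_append, Dw_append]
      simp [Dw_replicate]
  exact key _

lemma count_wordOf (α : Fin d → ℕ) (i : Fin d) : (wordOf α).count i = α i := by
  have key : ∀ l : List (Fin d), l.Nodup →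
      (l.flatMap fun j => List.replicate (α j) j).count i = if i ∈ l then α i else 0 := by
    intro l hl
    induction l with
    | nil => simp
    | cons j l ih =>
      rw [List.nodup_cons] at hl
      rw [List.flatMap_cons, List.count_append, ih hl.2, List.count_replicate]
      by_cases hij : i = j
      · subst hij; simp [hl.1]
      · simp [hij, Ne.symm hij]
  rw [wordOf, key _ (List.nodup_reverse.2 (List.nodup_finRange d))]
  simp

lemma length_eq_sum_count (w : List (Fin d)) : w.length = ∑ i, w.count i := by
  have := Multiset.sum_count_eq_card (s := Finset.univ) (m := (w : Multiset (Fin d)))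
    (fun a _ => Finset.mem_univ a)
  simpa using this.symm

lemma length_wordOf (α : Fin d → ℕ) : (wordOf α).length = len α := by
  rw [length_eq_sum_count]
  simp only [count_wordOf, len]

lemma perm_wordOf (w : List (Fin d)) : w.Perm (wordOf fun i => w.count i) :=
  List.perm_iff_count.2 fun i => (count_wordOf (fun i => w.count i) i).symm

lemma len_count (w : List (Fin d)) : len (fun i => w.count i) = w.length :=
  (length_eq_sum_count w).symm

lemma SB.smoothBdd {φ : E d → ℝ} (hφ : SB φ) : SmoothBdd φ := by
  refine ⟨hφ.1, fun n => ?_⟩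
  induction n generalizing φ with
  | zero =>
    obtain ⟨C, hC⟩ := hφ.bdd
    exact ⟨C, fun x => by simpa using hC x⟩
  | succ n ih =>
    choose C hC using fun i => ih (hφ.pd i)
    set g : Fin d → ℝ →L[ℝ] (E d →L[ℝ] ℝ) := fun i =>
      ContinuousLinearMap.toSpanSingleton ℝ (EuclideanSpace.proj i : E d →L[ℝ] ℝ) with hg
    have e : fderiv ℝ φ = fun x => ∑ i, (g i ∘ pderiv i φ) x := by
      funext x
      ext y
      rw [← dirD_eq_fderiv]
      simp [dirD, hg, mul_comm]
    have hs : ∀ i, ContDiff ℝ ∞ (g i ∘ pderiv i φ) := fun i =>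
      (g i).contDiff.comp (contDiff_pderiv hφ.1 i)
    refine ⟨∑ i, ‖g i‖ * C i, fun x => ?_⟩
    rw [← norm_iteratedFDeriv_fderiv, e,
      iteratedFDeriv_fun_sum_apply fun i _ => ((hs i).of_le (by exact_mod_cast le_top)).contDiffAt]
    refine (norm_sum_le _ _).trans (Finset.sum_le_sum fun i _ => ?_)
    refine ((g i).norm_iteratedFDeriv_comp_left
      ((contDiff_pderiv hφ.1 i).contDiffAt) (by exact_mod_cast le_top)).trans ?_
    exact mul_le_mul_of_nonneg_left (hC i x) (norm_nonneg _)

end words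

section mollifier

/-- Essentially bounded measurable functions. -/
def EB (g : E d → ℝ) : Prop :=
  AEStronglyMeasurable g volume ∧ ∃ C, ∀ᵐ x ∂(volume : Measure (E d)), |g x| ≤ C

lemma EB.of_continuous {g : E d → ℝ} (hg : Continuous g) (hb : ∃ C, ∀ x, |g x| ≤ C) : EB g := by
  obtain ⟨C, hC⟩ := hb
  exact ⟨hg.aestronglyMeasurable, C, Filter.Eventually.of_forall hC⟩

lemma EB.add {f g : E d → ℝ} (hf : EB f) (hg : EB g) : EB (f + g) := by
  obtain ⟨hf, C, hC⟩ := hf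
  obtain ⟨hg, C', hC'⟩ := hg
  refine ⟨hf.add hg, C + C', ?_⟩
  filter_upwards [hC, hC'] with x h h'
  exact (abs_add_le _ _).trans (add_le_add h h')

lemma EB.smul {g : E d → ℝ} (hg : EB g) (a : ℝ) : EB (a • g) := by
  obtain ⟨hg, C, hC⟩ := hg
  refine ⟨hg.const_smul a, |a| * C, ?_⟩
  filter_upwards [hC] with x h
  rw [Pi.smul_apply, smul_eq_mul, abs_mul]
  exact mul_le_mul_of_nonneg_left h (abs_nonneg _)

lemma EB.sq {g : E d → ℝ} (hg : EB g) : EB (fun x => g x ^ 2) := by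
  obtain ⟨hg, C, hC⟩ := hg
  refine ⟨hg.pow 2, C ^ 2, ?_⟩
  filter_upwards [hC] with x h
  rw [abs_pow]
  exact pow_le_pow_left₀ (abs_nonneg _) h 2

lemma EB.locallyIntegrable {g : E d → ℝ} (hg : EB g) : LocallyIntegrable g volume := by
  obtain ⟨hg, C, hC⟩ := hg
  exact (memLp_top_of_bound hg C hC).locallyIntegrable le_top

variable (d) in
/-- Smooth bump functions with supports shrinking to the origin. -/
def bump (j : ℕ) : ContDiffBump (0 : E d) where
  rIn := 1 / (2 * ((j : ℝ) + 1))
  rOut := 1 / ((j : ℝ) + 1)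
  rIn_pos := by positivity
  rIn_lt_rOut := by
    apply one_div_lt_one_div_of_lt (by positivity)
    have : (0 : ℝ) < (j : ℝ) + 1 := by positivity
    linarith

variable (d) in
/-- The mollifier kernels. -/
def ker (j : ℕ) : E d → ℝ := (bump d j).normed volume

lemma ker_smooth (j : ℕ) : ContDiff ℝ ∞ (ker d j) := (bump d j).contDiff_normed (n := ⊤)

lemma ker_nonneg (j : ℕ) (x : E d) : 0 ≤ ker d j x := (bump d j).nonneg_normed x

lemma ker_hasCompactSupport (j : ℕ) : HasCompactSupport (ker d j) :=
  (bump d j).hasCompactSupport_normed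

lemma ker_eq_zero {j : ℕ} {x : E d} (hx : 1 / ((j : ℝ) + 1) ≤ ‖x‖) : ker d j x = 0 := by
  have h1 : x ∉ Function.support (ker d j) := by
    rw [ker, (bump d j).support_normed_eq, mem_ball_zero_iff, not_lt]
    exact hx
  simpa using h1

lemma integral_ker_sub (j : ℕ) (x : E d) : ∫ t, ker d j (x - t) = 1 := by
  rw [integral_sub_left_eq_self (ker d j) volume x]
  exact (bump d j).integral_normed

/-- Integration of a function against a reflected and translated kernel. -/
def conv (g ζ : E d → ℝ) (x : E d) : ℝ := ∫ t, g t * ζ (x - t)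

/-- Mollification. -/
def moll (j : ℕ) (g : E d → ℝ) : E d → ℝ := conv g (ker d j)

lemma conv_eq (g ζ : E d → ℝ) :
    conv g ζ = convolution g ζ (ContinuousLinearMap.lsmul ℝ ℝ) volume := by
  funext x
  simp [conv, convolution_def]

lemma hasCompactSupport_reflect {ζ : E d → ℝ} (hζ : HasCompactSupport ζ) (x : E d) :
    HasCompactSupport fun t => ζ (x - t) :=
  hζ.comp_homeomorph (Homeomorph.subLeft x)

lemma integrable_reflect {ζ : E d → ℝ} (hζ : Continuous ζ) (hc : HasCompactSupport ζ) (x : E d) :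
    Integrable (fun t => ζ (x - t)) volume :=
  (hζ.comp (continuous_const.sub continuous_id)).integrable_of_hasCompactSupport
    (hasCompactSupport_reflect hc x)

lemma EB.integrable_mul {g η : E d → ℝ} (hg : EB g) (hη : Integrable η volume) :
    Integrable (fun t => g t * η t) volume := by
  obtain ⟨hg, C, hC⟩ := hg
  exact hη.bdd_mul hg (c := C) hC

lemma EB.integrable_ker {g : E d → ℝ} (hg : EB g) (j : ℕ) (x : E d) :
    Integrable (fun t => g t * ker d j (x - t)) volume :=
  hg.integrable_mul (integrable_reflect (ker_smooth j).continuous (ker_hasCompactSupport j) x)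

lemma moll_mono {f g : E d → ℝ} (hf : EB f) (hg : EB g) (h : ∀ᵐ x ∂(volume : Measure (E d)),
    f x ≤ g x) (j : ℕ) (x : E d) : moll j f x ≤ moll j g x := by
  refine integral_mono_ae (hf.integrable_ker j x) (hg.integrable_ker j x) ?_
  filter_upwards [h] with t ht
  exact mul_le_mul_of_nonneg_right ht (ker_nonneg j _)

lemma moll_const (j : ℕ) (a : ℝ) (x : E d) : moll j (fun _ => a) x = a := by
  rw [moll, conv, integral_const_mul, integral_ker_sub, mul_one]

lemma EB_const (a : ℝ) : EB (fun _ : E d => a) := EB.of_continuous continuous_const ⟨|a|, fun _ => le_rfl⟩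

/-- Mollification at a point as a linear functional on all functions. -/
lemma exists_moll_functional (j : ℕ) (x : E d) :
    ∃ I : (E d → ℝ) →ₗ[ℝ] ℝ, ∀ g, EB g → I g = moll j g x := by
  let p : Submodule ℝ (E d → ℝ) :=
    { carrier := {g | EB g}
      add_mem' := fun h h' => EB.add h h'
      zero_mem' := EB_const 0
      smul_mem' := fun a g h => EB.smul h a }
  let J : p →ₗ[ℝ] ℝ :=
    { toFun := fun g => moll j g.1 x
      map_add' := fun f g => by
        have := integral_add (EB.integrable_ker (g := f.1) f.2 j x) (EB.integrable_ker (g := g.1) g.2 j x)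
        simp only [moll, conv]
        rw [← this]
        exact integral_congr_ae (Filter.Eventually.of_forall fun t => by
          simp [add_mul])
      map_smul' := fun a g => by
        simp only [moll, conv, RingHom.id_apply, smul_eq_mul]
        rw [← integral_const_mul]
        exact integral_congr_ae (Filter.Eventually.of_forall fun t => by
          simp [mul_assoc]) }
  obtain ⟨I, hI⟩ := J.exists_extend
  exact ⟨I, fun g hg => by
    exact LinearMap.congr_fun hI ⟨g, hg⟩⟩

lemma sum_moll_sq_le {s : Finset ι} {g : ι → E d → ℝ} (hg : ∀ i ∈ s, EB (g i)) {B : ℝ}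
    (hB : ∀ᵐ x ∂(volume : Measure (E d)), ∑ i ∈ s, g i x ^ 2 ≤ B) (j : ℕ) (x : E d) :
    ∑ i ∈ s, moll j (g i) x ^ 2 ≤ B := by
  obtain ⟨I, hI⟩ := exists_moll_functional j x
  have hJ : ∀ i ∈ s, moll j (g i) x ^ 2 ≤ I (fun t => g i t ^ 2) := by
    intro i hi
    set a := moll j (g i) x with ha
    have h1 : moll j (fun _ => (0 : ℝ)) x ≤ moll j (fun t => (g i + (-a) • (fun _ => (1 : ℝ)) : E d → ℝ) t ^ 2) x :=
      moll_mono (EB_const 0) ((hg i hi).add ((EB_const 1).smul _)).sq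
        (Filter.Eventually.of_forall fun _ => sq_nonneg _) j x
    rw [moll_const, ← hI _ ((hg i hi).add ((EB_const 1).smul _)).sq] at h1
    have e : (fun t => (g i + (-a) • (fun _ => (1 : ℝ)) : E d → ℝ) t ^ 2)
        = (fun t => g i t ^ 2) + ((-2 * a) • g i + (a ^ 2) • (fun _ => (1 : ℝ))) := by
      funext t
      simp
      ring
    rw [e, map_add, map_add, map_smul, map_smul, hI _ (hg i hi), hI _ (EB_const 1), moll_const] at h1
    simp only [smul_eq_mul] at h1
    rw [← ha] at h1
    linarith
  have hs : EB (∑ i ∈ s, fun t => g i t ^ 2) := by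
    classical
    clear hB hJ
    induction s using Finset.induction_on with
    | empty => exact EB_const 0
    | insert a s ha ih =>
      rw [Finset.sum_insert ha]
      exact (hg a (Finset.mem_insert_self _ _)).sq.add
        (ih fun i hi => hg i (Finset.mem_insert_of_mem hi))
  refine (Finset.sum_le_sum hJ).trans ?_
  rw [← map_sum, hI _ hs]
  refine (moll_mono hs (EB_const B) ?_ j x).trans (moll_const j B x).le
  filter_upwards [hB] with t ht
  simpa [Finset.sum_apply] using ht

lemma abs_moll_le {g : E d → ℝ} (hg : EB g) {C : ℝ}
    (hC : ∀ᵐ x ∂(volume : Measure (E d)), |g x| ≤ C) (j : ℕ) (x : E d) : |moll j g x| ≤ C := by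
  refine abs_le.2 ⟨?_, ?_⟩
  · refine (moll_const j (-C) x).symm.le.trans (moll_mono (EB_const _) hg ?_ j x)
    filter_upwards [hC] with t ht using (abs_le.1 ht).1
  · refine (moll_mono hg (EB_const C) ?_ j x).trans (moll_const j C x).le
    filter_upwards [hC] with t ht using (abs_le.1 ht).2

lemma abs_moll_sub_le {g : E d → ℝ} (hg : EB g) {j : ℕ} {x : E d} {ε : ℝ}
    (h : ∀ t, ‖t - x‖ ≤ 1 / ((j : ℝ) + 1) → |g t - g x| ≤ ε) : |moll j g x - g x| ≤ ε := by
  have h1 : moll j g x - g x = ∫ t, (g t - g x) * ker d j (x - t) := by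
    simp only [sub_mul]
    rw [integral_sub (hg.integrable_ker j x) ((EB_const (g x)).integrable_ker j x),
      integral_const_mul, integral_ker_sub, mul_one]
    rfl
  rw [h1]
  have hi := integrable_reflect (ker_smooth (d := d) j).continuous (ker_hasCompactSupport j) x
  rw [← Real.norm_eq_abs]
  refine (norm_integral_le_of_norm_le (hi.const_mul ε)
    (Filter.Eventually.of_forall fun t => ?_)).trans ?_
  · rw [Real.norm_eq_abs, abs_mul, abs_of_nonneg (ker_nonneg j _)]
    by_cases ht : ‖t - x‖ ≤ 1 / ((j : ℝ) + 1)
    · exact mul_le_mul_of_nonneg_right (h t ht) (ker_nonneg j _)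
    · rw [norm_sub_rev] at ht
      rw [ker_eq_zero (not_le.1 ht).le, mul_zero, mul_zero]
  · rw [integral_const_mul, integral_ker_sub, mul_one]

lemma hasCompactSupport_pderiv {ζ : E d → ℝ} (hζ : HasCompactSupport ζ) (i : Fin d) :
    HasCompactSupport (pderiv i ζ) :=
  (hζ.fderiv (𝕜 := ℝ)).comp_left (g := fun L : E d →L[ℝ] ℝ => L (EuclideanSpace.single i 1)) rfl

lemma hasCompactSupport_Dw {ζ : E d → ℝ} (hζ : HasCompactSupport ζ) (w : List (Fin d)) :
    HasCompactSupport (Dw w ζ) := by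
  induction w generalizing ζ with
  | nil => exact hζ
  | cons i w ih => exact ih (hasCompactSupport_pderiv hζ i)

lemma pderiv_conv {g ζ : E d → ℝ} (hg : LocallyIntegrable g volume) (hζ : ContDiff ℝ ∞ ζ)
    (hc : HasCompactSupport ζ) (i : Fin d) : pderiv i (conv g ζ) = conv g (pderiv i ζ) := by
  funext x
  rw [conv_eq, conv_eq]
  unfold pderiv
  rw [(hc.hasFDerivAt_convolution_right (ContinuousLinearMap.lsmul ℝ ℝ) hg
    (hζ.of_le (by exact_mod_cast le_top)) x).fderiv,
    convolution_precompR_apply (ContinuousLinearMap.lsmul ℝ ℝ) hg (hc.fderiv (𝕜 := ℝ))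
      (hζ.continuous_fderiv (by simp))]

lemma Dw_conv {g ζ : E d → ℝ} (hg : LocallyIntegrable g volume) (hζ : ContDiff ℝ ∞ ζ)
    (hc : HasCompactSupport ζ) (w : List (Fin d)) : Dw w (conv g ζ) = conv g (Dw w ζ) := by
  induction w generalizing ζ with
  | nil => rfl
  | cons i w ih =>
    rw [Dw_cons, Dw_cons, pderiv_conv hg hζ hc, ih (contDiff_pderiv hζ i)
      (hasCompactSupport_pderiv hc i)]

lemma EB.sb_moll {g : E d → ℝ} (hg : EB g) (j : ℕ) : SB (moll j g) := by
  refine ⟨?_, fun w => ?_⟩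
  · rw [moll, conv_eq]
    exact (ker_hasCompactSupport j).contDiff_convolution_right _ hg.locallyIntegrable (ker_smooth j)
  · rw [moll, Dw_conv hg.locallyIntegrable (ker_smooth j) (ker_hasCompactSupport j)]
    obtain ⟨hm, C, hC⟩ := hg
    set ζ := Dw w (ker d j)
    have hζ : Continuous ζ := (contDiff_Dw (ker_smooth j) w).continuous
    have hc : HasCompactSupport ζ := hasCompactSupport_Dw (ker_hasCompactSupport j) w
    refine ⟨C * ∫ t, |ζ t|, fun x => ?_⟩
    rw [← integral_sub_left_eq_self (fun t => |ζ t|) volume x, ← integral_const_mul]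
    rw [← Real.norm_eq_abs]
    refine norm_integral_le_of_norm_le (((integrable_reflect hζ hc x).abs).const_mul C) ?_
    filter_upwards [hC] with t ht
    rw [Real.norm_eq_abs, abs_mul]
    exact mul_le_mul_of_nonneg_right ht (abs_nonneg _)

lemma Dw_reflect {ζ : E d → ℝ} (hζ : ContDiff ℝ ∞ ζ) (w : List (Fin d)) (x : E d) :
    Dw w (fun t => ζ (x - t)) = fun t => (-1) ^ w.length * Dw w ζ (x - t) := by
  induction w generalizing ζ with
  | nil => funext t; simp
  | cons i w ih =>
    have h1 : pderiv i (fun t => ζ (x - t)) = fun t => (-1) * pderiv i ζ (x - t) := by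
      funext t
      have h2 : HasFDerivAt (fun t => ζ (x - t)) ((fderiv ℝ ζ (x - t)).comp
          (-(ContinuousLinearMap.id ℝ (E d)))) t :=
        (differentiable_of_smooth hζ (x - t)).hasFDerivAt.comp t ((hasFDerivAt_id t).const_sub x)
      unfold pderiv
      rw [h2.fderiv]
      simp
    have h3 : ContDiff ℝ ∞ fun t => pderiv i ζ (x - t) :=
      (contDiff_pderiv hζ i).comp (contDiff_const.sub contDiff_id)
    rw [Dw_cons, h1, Dw_const_mul h3, ih (contDiff_pderiv hζ i)]
    funext t
    rw [Dw_cons, List.length_cons, pow_succ]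
    ring

lemma IsWeakDeriv.Dw_moll {α : Fin d → ℕ} {φ g : E d → ℝ} (h : IsWeakDeriv α φ g) (hφ : EB φ)
    {w : List (Fin d)} (hw : w.Perm (wordOf α)) (j : ℕ) : Dw w (moll j φ) = moll j g := by
  funext x
  rw [Dw_perm hw (hφ.sb_moll j).1, moll, Dw_conv hφ.locallyIntegrable (ker_smooth j)
    (ker_hasCompactSupport j)]
  have h1 := h.2 (fun t => ker d j (x - t)) ((ker_smooth j).comp (contDiff_const.sub contDiff_id))
    (hasCompactSupport_reflect (ker_hasCompactSupport j) x)
  rw [multiDeriv_eq_Dw, Dw_reflect (ker_smooth j), length_wordOf] at h1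
  have h2 : ∀ t, φ t * ((-1) ^ len α * Dw (wordOf α) (ker d j) (x - t))
      = (-1) ^ len α * (φ t * Dw (wordOf α) (ker d j) (x - t)) := fun t => by ring
  simp only [h2] at h1
  rw [integral_const_mul] at h1
  exact mul_left_cancel₀ (pow_ne_zero _ (by norm_num)) h1

end mollifier

end

end FDRichardson

open MeasureTheory
open scoped ContDiff

namespace FDRichardson

noncomputable section

variable {d : ℕ} {ι : Type*}

section weak

lemma IsWeakDeriv.ae_eq {α : Fin d → ℕ} {φ g g' : E d → ℝ} (h : IsWeakDeriv α φ g)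
    (h' : IsWeakDeriv α φ g') : g =ᵐ[volume] g' := by
  refine ae_eq_of_integral_contDiff_smul_eq h.1 h'.1 fun η hη hc => ?_
  have h1 := (h.2 η hη hc).symm.trans (h'.2 η hη hc)
  have h2 := mul_left_cancel₀ (pow_ne_zero _ (by norm_num)) h1
  simpa only [smul_eq_mul, mul_comm] using h2

variable {n : ℕ} {φ : E d → ℝ}

lemma MemB.eb (h : MemB n φ) : EB φ := EB.of_continuous h.1 h.2.1

lemma MemB.mono {k : ℕ} (h : MemB n φ) (hk : k ≤ n) : MemB k φ :=
  ⟨h.1, h.2.1, fun α hα => h.2.2 α (hα.trans hk)⟩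

lemma MemB.isWeakDeriv (h : MemB n φ) {α : Fin d → ℕ} (hα : len α ≤ n) :
    IsWeakDeriv α φ (weakDeriv α φ) ∧ EB (weakDeriv α φ) := by
  obtain ⟨g, hg, C, hC⟩ := h.2.2 α hα
  have hex : ∃ g, IsWeakDeriv α φ g := ⟨g, hg⟩
  have h1 : IsWeakDeriv α φ (weakDeriv α φ) := by
    rw [weakDeriv, dif_pos hex]
    exact Classical.choose_spec hex
  refine ⟨h1, h1.1.aestronglyMeasurable, C, ?_⟩
  filter_upwards [h1.ae_eq hg, hC] with x hx hx'
  rwa [hx]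

lemma MemB.Dw_moll (h : MemB n φ) {w : List (Fin d)} (hw : w.length ≤ n) (j : ℕ) :
    Dw w (moll j φ) = moll j (weakDeriv (fun i => w.count i) φ) :=
  (h.isWeakDeriv (α := fun i => w.count i) (by rwa [len_count])).1.Dw_moll h.eb (perm_wordOf w) j

lemma MemB.CBf_moll {s : Finset ι} {φ : ι → E d → ℝ} (h : ∀ i ∈ s, MemB n (φ i)) {B : ℝ}
    (hB : ∀ α : Fin d → ℕ, len α ≤ n → ∀ᵐ x ∂(volume : Measure (E d)),
      ∑ i ∈ s, weakDeriv α (φ i) x ^ 2 ≤ B) (j : ℕ) : CBf n B s (fun i => moll j (φ i)) := by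
  intro w hw x
  rw [Finset.sum_congr rfl fun i hi => by rw [(h i hi).Dw_moll hw]]
  exact sum_moll_sq_le (fun i hi => ((h i hi).isWeakDeriv (by rwa [len_count])).2)
    (hB _ (by rwa [len_count])) j x

lemma MemB.CB_moll (h : MemB n φ) {C : ℝ}
    (hC : ∀ α : Fin d → ℕ, len α ≤ n → ∀ᵐ x ∂(volume : Measure (E d)),
      |weakDeriv α φ x| ≤ C) (j : ℕ) : CB n C (moll j φ) := by
  intro w hw x
  rw [h.Dw_moll hw]
  exact abs_moll_le (h.isWeakDeriv (by rwa [len_count])).2 (hC _ (by rwa [len_count])) j x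

lemma finite_len_le (n : ℕ) : {α : Fin d → ℕ | len α ≤ n}.Finite := by
  refine (Set.finite_Iic (fun _ : Fin d => n)).subset fun α hα i => ?_
  exact (Finset.single_le_sum (f := α) (fun _ _ => Nat.zero_le _) (Finset.mem_univ i)).trans hα

lemma MemB.exists_bound (h : MemB n φ) : ∃ C, 0 ≤ C ∧ ∀ α : Fin d → ℕ, len α ≤ n →
    ∀ᵐ x ∂(volume : Measure (E d)), |weakDeriv α φ x| ≤ C := by
  have h1 : ∀ α : Fin d → ℕ, ∃ C, len α ≤ n →
      ∀ᵐ x ∂(volume : Measure (E d)), |weakDeriv α φ x| ≤ C := by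
    intro α
    by_cases hα : len α ≤ n
    · obtain ⟨-, C, hC⟩ := (h.isWeakDeriv hα).2
      exact ⟨C, fun _ => hC⟩
    · exact ⟨0, fun h => absurd h hα⟩
  choose C hC using h1
  refine ⟨∑ α ∈ (finite_len_le (d := d) n).toFinset, |C α|,
    Finset.sum_nonneg fun _ _ => abs_nonneg _, fun α hα => ?_⟩
  filter_upwards [hC α hα] with x hx
  exact hx.trans ((le_abs_self _).trans (Finset.single_le_sum (f := fun α => |C α|)
    (fun _ _ => abs_nonneg _) ((finite_len_le n).mem_toFinset.2 hα)))

lemma MemB.exists_CB (h : MemB n φ) : ∃ C, 0 ≤ C ∧ ∀ j, CB n C (moll j φ) := by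
  obtain ⟨C, h0, hC⟩ := h.exists_bound
  exact ⟨C, h0, h.CB_moll hC⟩

lemma CB.abs_sub_le {C : ℝ} (hφ : ContDiff ℝ ∞ φ) (h : CB 1 C φ) (x y : E d) :
    |φ x - φ y| ≤ d * C * ‖x - y‖ := by
  have h1 := abs_taylorRem_le 1 hφ (x - y) (B := d * C * ‖x - y‖) (fun z => ?_) y
  · simpa [taylorRem] using h1
  · rw [Function.iterate_one, dirD]
    refine (Finset.abs_sum_le_sum_abs _ _).trans ?_
    have h2 : ∀ i ∈ Finset.univ, |(x - y) i * pderiv i φ z| ≤ ‖x - y‖ * C := fun i _ => by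
      rw [abs_mul]
      exact mul_le_mul (PiLp.norm_apply_le (x - y) i) (h [i] (by simp) z) (abs_nonneg _)
        (norm_nonneg _)
    refine (Finset.sum_le_sum h2).trans (le_of_eq ?_)
    simp
    ring

lemma tendsto_moll (hc : Continuous φ) (hb : ∃ C, ∀ x, |φ x| ≤ C) (x : E d) :
    Filter.Tendsto (fun j => moll j φ x) Filter.atTop (nhds (φ x)) := by
  rw [Metric.tendsto_atTop]
  intro ε hε
  obtain ⟨η, hη, H⟩ := Metric.continuous_iff.1 hc x (ε / 2) (half_pos hε)
  obtain ⟨N, hN⟩ := exists_nat_one_div_lt hη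
  refine ⟨N, fun j hj => ?_⟩
  rw [Real.dist_eq]
  refine (abs_moll_sub_le (EB.of_continuous hc hb) (ε := ε / 2) fun t ht => ?_).trans_lt
    (half_lt_self hε)
  have h1 : (1 : ℝ) / (j + 1) ≤ 1 / (N + 1) :=
    one_div_le_one_div_of_le (by positivity) (by exact_mod_cast Nat.succ_le_succ hj)
  have := H t (by rw [dist_eq_norm]; exact (ht.trans h1).trans_lt hN)
  rw [Real.dist_eq] at this
  exact this.le

lemma MemB.exists_lipschitz (h : MemB 1 φ) :
    ∃ L, 0 ≤ L ∧ ∀ x y, |φ x - φ y| ≤ L * ‖x - y‖ := by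
  obtain ⟨C, h0, hC⟩ := h.exists_CB
  refine ⟨d * C, by positivity, fun x y => ?_⟩
  have h1 := ((tendsto_moll h.1 h.2.1 x).sub (tendsto_moll h.1 h.2.1 y)).abs
  exact le_of_tendsto h1 (Filter.Eventually.of_forall fun j => (hC j).abs_sub_le (h.eb.sb_moll j).1 x y)

lemma MemB.exists_rate (h : MemB 1 φ) :
    ∃ L, 0 ≤ L ∧ ∀ (j : ℕ) (x : E d), |moll j φ x - φ x| ≤ L * (1 / ((j : ℝ) + 1)) := by
  obtain ⟨L, h0, hL⟩ := h.exists_lipschitz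
  exact ⟨L, h0, fun j x => abs_moll_sub_le h.eb fun t ht =>
    (hL t x).trans (mul_le_mul_of_nonneg_left ht h0)⟩

lemma tendsto_mul_one_div (L : ℝ) :
    Filter.Tendsto (fun j : ℕ => L * (1 / ((j : ℝ) + 1))) Filter.atTop (nhds 0) := by
  simpa using (tendsto_one_div_add_atTop_nhds_zero_nat (𝕜 := ℝ)).const_mul L

lemma tendstoUniformly_of_rate {X : Type*} {φ : ℕ → X → ℝ} {g : X → ℝ} {a : ℕ → ℝ}
    (ha : Filter.Tendsto a Filter.atTop (nhds 0)) (h : ∀ j x, |φ j x - g x| ≤ a j) :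
    TendstoUniformly φ g Filter.atTop := by
  rw [Metric.tendstoUniformly_iff]
  intro ε hε
  filter_upwards [ha.eventually (gt_mem_nhds hε)] with j hj x
  rw [dist_comm, Real.dist_eq]
  exact (h j x).trans_lt hj

lemma MemB.tendstoUniformly (h : MemB 1 φ) :
    TendstoUniformly (fun j => moll j φ) φ Filter.atTop := by
  obtain ⟨L, -, hL⟩ := h.exists_rate
  exact tendstoUniformly_of_rate (tendsto_mul_one_div L) hL

lemma MemB.contDiff (h : MemB (n + 1) φ) : ContDiff ℝ n φ ∧ ∀ w : List (Fin d), w.length ≤ n →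
    TendstoUniformly (fun j => Dw w (moll j φ)) (Dw w φ) Filter.atTop := by
  obtain ⟨C, -, hC⟩ := h.exists_CB
  exact limit_contDiff n (fun j => (h.eb.sb_moll j).1) hC (h.mono (by omega)).tendstoUniformly

lemma integral_mul_Dw {φ η : E d → ℝ} (hφ : ContDiff ℝ ∞ φ) (hη : ContDiff ℝ ∞ η)
    (hc : HasCompactSupport η) (w : List (Fin d)) :
    ∫ x, φ x * Dw w η x = (-1 : ℝ) ^ w.length * ∫ x, Dw w φ x * η x := by
  have hint : ∀ {a b : E d → ℝ}, ContDiff ℝ ∞ a → ContDiff ℝ ∞ b → HasCompactSupport b →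
      Integrable (fun x => a x * b x) volume := fun ha hb hcb =>
    (ha.continuous.mul hb.continuous).integrable_of_hasCompactSupport hcb.mul_left
  induction w generalizing φ η with
  | nil => simp
  | cons i w ih =>
    rw [Dw_cons, ih hφ (contDiff_pderiv hη i) (hasCompactSupport_pderiv hc i), Dw_cons,
      Dw_pderiv hφ]
    have hw := contDiff_Dw hφ w
    have h1 := integral_mul_fderiv_eq_neg_fderiv_mul_of_integrable
      (μ := (volume : Measure (E d))) (f := Dw w φ) (g := η) (v := EuclideanSpace.single i 1)
      (hint (contDiff_pderiv hw i) hη hc)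
      (hint hw (contDiff_pderiv hη i) (hasCompactSupport_pderiv hc i)) (hint hw hη hc)
      (fun x _ => differentiable_of_smooth hw x) (fun x _ => differentiable_of_smooth hη x)
    have h2 : ∫ x, Dw w φ x * pderiv i η x = - ∫ x, pderiv i (Dw w φ) x * η x := h1
    rw [h2, List.length_cons, pow_succ]
    ring

lemma tendsto_integral_mul {φ : ℕ → E d → ℝ} {g η : E d → ℝ} (hφ : ∀ j, Continuous (φ j))
    (hg : TendstoUniformly φ g Filter.atTop) (hη : Continuous η) (hc : HasCompactSupport η) :
    Filter.Tendsto (fun j => ∫ x, φ j x * η x) Filter.atTop (nhds (∫ x, g x * η x)) := by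
  have hgc : Continuous g := hg.continuous (Filter.Frequently.of_forall hφ)
  have hi : ∀ {a : E d → ℝ}, Continuous a → Integrable (fun x => a x * η x) volume := fun ha =>
    (ha.mul hη).integrable_of_hasCompactSupport hc.mul_left
  rw [Metric.tendsto_nhds]
  intro ε hε
  set A := ∫ x, |η x| with hA
  have hA0 : 0 ≤ A := integral_nonneg fun _ => abs_nonneg _
  filter_upwards [Metric.tendstoUniformly_iff.1 hg (ε / (A + 1)) (by positivity)] with j hj
  rw [dist_eq_norm, ← integral_sub (hi (hφ j)) (hi hgc)]
  have h1 : ‖∫ x, (φ j x * η x - g x * η x)‖ ≤ ∫ x, ε / (A + 1) * |η x| := by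
    refine norm_integral_le_of_norm_le ((hη.integrable_of_hasCompactSupport hc).abs.const_mul _)
      (Filter.Eventually.of_forall fun x => ?_)
    rw [← sub_mul, norm_mul]
    refine mul_le_mul_of_nonneg_right ?_ (abs_nonneg _)
    have := (hj x).le
    rwa [dist_comm, dist_eq_norm] at this
  refine h1.trans_lt ?_
  rw [integral_const_mul, ← hA, div_mul_eq_mul_div, div_lt_iff₀ (by positivity)]
  nlinarith

lemma integral_mul_Dw_of_limit {φ : ℕ → E d → ℝ} {g G η : E d → ℝ} {w : List (Fin d)}
    (hφ : ∀ j, ContDiff ℝ ∞ (φ j)) (hg : TendstoUniformly φ g Filter.atTop)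
    (hG : TendstoUniformly (fun j => Dw w (φ j)) G Filter.atTop) (hη : ContDiff ℝ ∞ η)
    (hc : HasCompactSupport η) :
    ∫ x, g x * Dw w η x = (-1 : ℝ) ^ w.length * ∫ x, G x * η x := by
  have h1 := tendsto_integral_mul (fun j => (hφ j).continuous) hg (contDiff_Dw hη w).continuous
    (hasCompactSupport_Dw hc w)
  have h2 := (tendsto_integral_mul (fun j => (contDiff_Dw (hφ j) w).continuous) hG
    hη.continuous hc).const_mul ((-1 : ℝ) ^ w.length)
  refine tendsto_nhds_unique h1 ?_
  simpa only [integral_mul_Dw (hφ _) hη hc w] using h2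

lemma isWeakDeriv_of_limit {φ : ℕ → E d → ℝ} {g : E d → ℝ} {C : ℝ}
    (hφ : ∀ j, ContDiff ℝ ∞ (φ j)) (hC : ∀ j, CB (n + 1) C (φ j))
    (hg : TendstoUniformly φ g Filter.atTop) {α : Fin d → ℕ} (hα : len α ≤ n) :
    IsWeakDeriv α g (Dw (wordOf α) g) ∧ Continuous (Dw (wordOf α) g)
      ∧ ∀ x, |Dw (wordOf α) g x| ≤ C := by
  have h1 := (limit_contDiff n hφ hC hg).2 (wordOf α) (by rwa [length_wordOf])
  have hc : Continuous (Dw (wordOf α) g) :=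
    h1.continuous (Filter.Frequently.of_forall fun j => (contDiff_Dw (hφ j) _).continuous)
  refine ⟨⟨hc.locallyIntegrable, fun η hη hcη => ?_⟩, hc, fun x => ?_⟩
  · rw [multiDeriv_eq_Dw, integral_mul_Dw_of_limit hφ hg h1 hη hcη, length_wordOf]
  · exact le_of_tendsto (h1.tendsto_at x).abs (Filter.Eventually.of_forall fun j =>
      hC j (wordOf α) (by rw [length_wordOf]; omega) x)

lemma MemB.weakDeriv_ae_eq (h : MemB (n + 1) φ) {w : List (Fin d)} (hw : w.length ≤ n) :
    weakDeriv (fun i => w.count i) φ =ᵐ[volume] Dw w φ := by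
  obtain ⟨C, -, hC⟩ := h.exists_CB
  have hα : len (fun i => w.count i) ≤ n := by rwa [len_count]
  have hs := fun j => (h.eb.sb_moll j).1
  have h1 := (isWeakDeriv_of_limit hs hC (h.mono (by omega)).tendstoUniformly hα).1
  have h2 := (h.isWeakDeriv (α := fun i => w.count i) (by omega)).1.ae_eq h1
  have h3 : Dw (wordOf fun i => w.count i) φ = Dw w φ := by
    have h4 := h.contDiff.2 w hw
    have h5 := h.contDiff.2 (wordOf fun i => w.count i) (by rwa [length_wordOf])
    funext x
    refine tendsto_nhds_unique (h5.tendsto_at x) ?_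
    simpa only [Dw_perm (perm_wordOf w) (hs _)] using h4.tendsto_at x
  rwa [h3] at h2

lemma MemB.continuous_Dw (h : MemB (n + 1) φ) {w : List (Fin d)} (hw : w.length ≤ n) :
    Continuous (Dw w φ) ∧ ∃ C, ∀ x, |Dw w φ x| ≤ C := by
  obtain ⟨C, -, hC⟩ := h.exists_CB
  have h1 := h.contDiff.2 w hw
  refine ⟨h1.continuous (Filter.Frequently.of_forall fun j =>
    (contDiff_Dw (h.eb.sb_moll j).1 _).continuous), C, fun x => ?_⟩
  exact le_of_tendsto (h1.tendsto_at x).abs (Filter.Eventually.of_forall fun j =>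
      hC j w (by omega) x)

lemma moll_congr {f g : E d → ℝ} (h : f =ᵐ[volume] g) (j : ℕ) : moll j f = moll j g := by
  funext x
  refine integral_congr_ae ?_
  filter_upwards [h] with t ht
  rw [ht]

lemma MemB.Dw_moll_eq_moll_Dw (h : MemB (n + 1) φ) {w : List (Fin d)} (hw : w.length ≤ n)
    (j : ℕ) : Dw w (moll j φ) = moll j (Dw w φ) := by
  rw [h.Dw_moll (by omega), moll_congr (h.weakDeriv_ae_eq hw)]

/-- Uniform limits of smooth functions with uniformly bounded derivatives. -/
lemma memB_of_limit {φ : ℕ → E d → ℝ} {g : E d → ℝ} {C : ℝ}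
    (hφ : ∀ j, ContDiff ℝ ∞ (φ j)) (hC : ∀ j, CB (n + 1) C (φ j))
    (hg : TendstoUniformly φ g Filter.atTop) : MemB (n + 1) g := by
  have hC0 : 0 ≤ C := (hC 0).nonneg
  have hgc : Continuous g := hg.continuous (Filter.Frequently.of_forall fun j => (hφ j).continuous)
  refine ⟨hgc, ⟨C, fun x => le_of_tendsto (hg.tendsto_at x).abs
    (Filter.Eventually.of_forall fun j => (hC j).bound x)⟩, fun α hα => ?_⟩
  rcases Nat.lt_or_ge n (len α) with hlt | hle
  · rcases List.eq_nil_or_concat (wordOf α) with hnil | ⟨w, i, hw⟩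
    · rw [← length_wordOf, hnil] at hlt
      simp at hlt
    rw [List.concat_eq_append] at hw
    have hl : w.length = n := by
      have := length_wordOf α
      rw [hw, List.length_append] at this
      simp at this
      omega
    have h1 := (limit_contDiff n hφ hC hg).2 w hl.le
    have hlip : LipschitzWith (Real.toNNReal (d * C)) (Dw w g) := by
      refine LipschitzWith.of_dist_le_mul fun x y => ?_
      rw [Real.dist_eq, dist_eq_norm, Real.coe_toNNReal _ (by positivity)]
      refine le_of_tendsto ((h1.tendsto_at x).sub (h1.tendsto_at y)).abs
        (Filter.Eventually.of_forall fun j => ?_)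
      refine CB.abs_sub_le (contDiff_Dw (hφ j) w) (fun w' hw' z => ?_) x y
      rw [← Dw_append]
      exact hC j _ (by rw [List.length_append]; omega) z
    refine ⟨fun x => lineDeriv ℝ (Dw w g) x (EuclideanSpace.single i 1),
      ⟨hlip.locallyIntegrable_lineDeriv _, fun η hη hcη => ?_⟩,
      Real.toNNReal (d * C) * ‖(EuclideanSpace.single i 1 : E d)‖,
      Filter.Eventually.of_forall fun x => norm_lineDeriv_le_of_lipschitz ℝ hlip⟩
    obtain ⟨D, hD⟩ := ContDiff.lipschitzWith_of_hasCompactSupport hcη hη (by simp)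
    rw [hlip.integral_lineDeriv_mul_eq hD hcη, multiDeriv_eq_Dw, hw, Dw_append, Dw_cons, Dw_nil, ← Dw_pderiv hη, integral_mul_Dw_of_limit hφ hg h1
      (contDiff_pderiv hη i) (hasCompactSupport_pderiv hcη i), hl, ← length_wordOf, hw,
      List.length_append, hl, List.length_singleton, pow_succ, mul_assoc]
    congr 1
    rw [← integral_const_mul]
    refine integral_congr_ae (Filter.Eventually.of_forall fun x => ?_)
    dsimp only
    rw [(differentiable_of_smooth hη x).lineDeriv_eq_fderiv, map_neg]
    unfold pderiv
    ring
  · obtain ⟨h1, -, h2⟩ := isWeakDeriv_of_limit hφ hC hg hle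
    exact ⟨_, h1, C, Filter.Eventually.of_forall h2⟩

lemma gradSq_ge (α : Fin d → ℕ) (φ : E d → ℝ) (x : E d) :
    weakDeriv α φ x ^ 2 ≤ gradSq (len α) φ x :=
  Finset.single_le_sum (f := fun α => weakDeriv α φ x ^ 2) (fun _ _ => sq_nonneg _)
    (by simp [Finset.mem_piAntidiag, len])

lemma gradSq_nonneg (k : ℕ) (φ : E d → ℝ) (x : E d) : 0 ≤ gradSq k φ x :=
  Finset.sum_nonneg fun _ _ => sq_nonneg _

lemma MemB.abs_weakDeriv_le_normB (h : MemB n φ) {α : Fin d → ℕ} (hα : len α ≤ n) :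
    ∀ᵐ x ∂(volume : Measure (E d)), |weakDeriv α φ x| ≤ normB n φ := by
  obtain ⟨C, h0, hC⟩ := h.exists_bound
  set G : E d → ℝ := fun x => ∑ k ∈ Finset.range (n + 1), gradSq k φ x with hG
  have hbd : Filter.IsBoundedUnder (· ≤ ·) (ae (volume : Measure (E d))) G := by
    refine ⟨∑ k ∈ Finset.range (n + 1), ∑ α ∈ Finset.piAntidiag (Finset.univ : Finset (Fin d)) k,
      C ^ 2, ?_⟩
    rw [Filter.eventually_map]
    have h1 : ∀ᵐ x ∂(volume : Measure (E d)), ∀ α ∈ {α : Fin d → ℕ | len α ≤ n},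
        |weakDeriv α φ x| ≤ C :=
      (ae_ball_iff (finite_len_le n).countable).2 fun α hα => hC α hα
    filter_upwards [h1] with x hx
    refine Finset.sum_le_sum fun k hk => Finset.sum_le_sum fun α hα => ?_
    rw [sq_le_sq, abs_of_nonneg h0]
    refine hx α ?_
    rw [Finset.mem_piAntidiag] at hα
    exact hα.1.le.trans (Nat.lt_succ_iff.1 (Finset.mem_range.1 hk))
  filter_upwards [ae_le_essSup hbd] with x hx
  rw [normB]
  refine Real.le_sqrt_of_sq_le ?_
  rw [sq_abs]
  refine (gradSq_ge α φ x).trans (le_trans ?_ hx)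
  exact Finset.single_le_sum (f := fun k => gradSq k φ x) (fun k _ => gradSq_nonneg k φ x)
    (Finset.mem_range.2 (Nat.lt_succ_of_le hα))

lemma MemB.CB_moll_normB (h : MemB n φ) (j : ℕ) : CB n (normB n φ) (moll j φ) :=
  h.CB_moll (fun _ hα => h.abs_weakDeriv_le_normB hα) j

end weak

end

end FDRichardson

open MeasureTheory
open scoped ContDiff

namespace FDRichardson

noncomputable section

variable {d : ℕ} {ι : Type*} {P : Params} {h₀ h : ℝ} {S : Coeffs d} {τ : E d → ℝ} {τ₀ : ℝ}

section averages
variable {j : ℕ} {x : E d} {f g : E d → ℝ} {a b : ℝ}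

/-- The function `g` has the average `a` against the `j`-th mollifier at `x`. -/
def Av (j : ℕ) (x : E d) (g : E d → ℝ) (a : ℝ) : Prop := EB g ∧ moll j g x = a

lemma Av.add (hf : Av j x f a) (hg : Av j x g b) : Av j x (fun y => f y + g y) (a + b) := by
  obtain ⟨I, hI⟩ := exists_moll_functional j x
  refine ⟨hf.1.add hg.1, ?_⟩
  rw [← hf.2, ← hg.2, ← hI _ hf.1, ← hI _ hg.1, ← map_add, hI _ (hf.1.add hg.1)]
  rfl

lemma Av.const_mul (hf : Av j x f a) (t : ℝ) : Av j x (fun y => t * f y) (t * a) := by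
  obtain ⟨I, hI⟩ := exists_moll_functional j x
  refine ⟨hf.1.smul t, ?_⟩
  rw [← hf.2, ← hI _ hf.1, ← smul_eq_mul, ← map_smul, hI _ (hf.1.smul t)]
  rfl

lemma Av.mul_const (hf : Av j x f a) (t : ℝ) : Av j x (fun y => f y * t) (a * t) := by
  simpa only [mul_comm] using hf.const_mul t

lemma Av.sub (hf : Av j x f a) (hg : Av j x g b) : Av j x (fun y => f y - g y) (a - b) := by
  simpa [sub_eq_add_neg] using hf.add (hg.const_mul (-1))

lemma av_const (j : ℕ) (x : E d) (a : ℝ) : Av j x (fun _ => a) a := ⟨EB_const a, moll_const j a x⟩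

lemma Av.sum {s : Finset ι} {f : ι → E d → ℝ} {a : ι → ℝ} (hf : ∀ i ∈ s, Av j x (f i) (a i)) :
    Av j x (fun y => ∑ i ∈ s, f i y) (∑ i ∈ s, a i) := by
  classical
  induction s using Finset.induction_on with
  | empty => simpa using av_const j x 0
  | insert i s hi ih =>
    simp only [Finset.sum_insert hi]
    exact (hf i (Finset.mem_insert_self _ _)).add
      (ih fun k hk => hf k (Finset.mem_insert_of_mem hk))

lemma Av.le (hf : Av j x f a) (hg : Av j x g b) (hfg : ∀ y, f y ≤ g y) : a ≤ b := by
  rw [← hf.2, ← hg.2]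
  exact moll_mono hf.1 hg.1 (Filter.Eventually.of_forall hfg) j x

lemma EB.av (hf : EB f) : Av j x f (moll j f x) := ⟨hf, rfl⟩

end averages

section differentiability

lemma moll_sub {f g : E d → ℝ} (hf : EB f) (hg : EB g) (j : ℕ) :
    moll j (fun x => f x - g x) = fun x => moll j f x - moll j g x :=
  funext fun _ => (hf.av.sub hg.av).2

lemma moll_const_mul {f : E d → ℝ} (hf : EB f) (a : ℝ) (j : ℕ) :
    moll j (fun x => a * f x) = fun x => a * moll j f x :=
  funext fun _ => (hf.av.const_mul a).2

lemma moll_tr (f : E d → ℝ) (y : E d) (j : ℕ) :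
    moll j (fun x => f (x + y)) = fun x => moll j f (x + y) := by
  funext x
  have h1 := integral_add_right_eq_self (μ := (volume : Measure (E d)))
    (fun t => f t * ker d j (x + y - t)) y
  simp only [moll, conv]
  rw [← h1]
  exact integral_congr_ae (Filter.Eventually.of_forall fun t => by
    simp only [add_sub_add_right_eq_sub])

/-- Functions whose partial derivatives up to order `n` are continuous and bounded and commute
with mollification. -/
def Reg : ℕ → (E d → ℝ) → Prop
  | 0, φ => Continuous φ ∧ ∃ C, ∀ x, |φ x| ≤ C
  | n + 1, φ => (Continuous φ ∧ ∃ C, ∀ x, |φ x| ≤ C) ∧ Differentiable ℝ φ ∧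
      ∀ i, (∀ j, pderiv i (moll j φ) = moll j (pderiv i φ)) ∧ Reg n (pderiv i φ)

variable {n : ℕ} {φ ψ : E d → ℝ}

lemma Reg.zero (h : Reg n φ) : Continuous φ ∧ ∃ C, ∀ x, |φ x| ≤ C := by
  cases n with
  | zero => exact h
  | succ n => exact h.1

lemma Reg.eb (h : Reg n φ) : EB φ := EB.of_continuous h.zero.1 h.zero.2

lemma Reg.sub (h : Reg n φ) (h' : Reg n ψ) : Reg n fun x => φ x - ψ x := by
  have h0 : Continuous (fun x => φ x - ψ x) ∧ ∃ C, ∀ x, |φ x - ψ x| ≤ C := by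
    obtain ⟨hc, C, hC⟩ := h.zero
    obtain ⟨hc', C', hC'⟩ := h'.zero
    exact ⟨hc.sub hc', C + C', fun x => (abs_sub _ _).trans (add_le_add (hC x) (hC' x))⟩
  induction n generalizing φ ψ with
  | zero => exact h0
  | succ n ih =>
    refine ⟨h0, h.2.1.sub h'.2.1, fun i => ⟨fun j => ?_, ?_⟩⟩
    · rw [moll_sub h.eb h'.eb, pderiv_sub (differentiable_of_smooth (h.eb.sb_moll j).1)
        (differentiable_of_smooth (h'.eb.sb_moll j).1), pderiv_sub h.2.1 h'.2.1,
        moll_sub (h.2.2 i).2.eb (h'.2.2 i).2.eb, (h.2.2 i).1, (h'.2.2 i).1]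
    · rw [pderiv_sub h.2.1 h'.2.1]
      refine ih (h.2.2 i).2 (h'.2.2 i).2 ?_
      obtain ⟨hc, C, hC⟩ := (h.2.2 i).2.zero
      obtain ⟨hc', C', hC'⟩ := (h'.2.2 i).2.zero
      exact ⟨hc.sub hc', C + C', fun x => (abs_sub _ _).trans (add_le_add (hC x) (hC' x))⟩

lemma Reg.const_mul (h : Reg n φ) (a : ℝ) : Reg n fun x => a * φ x := by
  have key : ∀ {φ : E d → ℝ}, (Continuous φ ∧ ∃ C, ∀ x, |φ x| ≤ C) →
      Continuous (fun x => a * φ x) ∧ ∃ C, ∀ x, |a * φ x| ≤ C := by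
    rintro φ ⟨hc, C, hC⟩
    refine ⟨continuous_const.mul hc, |a| * C, fun x => ?_⟩
    rw [abs_mul]
    exact mul_le_mul_of_nonneg_left (hC x) (abs_nonneg _)
  induction n generalizing φ with
  | zero => exact key h
  | succ n ih =>
    refine ⟨key h.1, h.2.1.const_mul a, fun i => ⟨fun j => ?_, ?_⟩⟩
    · rw [moll_const_mul h.eb, pderiv_const_mul (differentiable_of_smooth (h.eb.sb_moll j).1),
        pderiv_const_mul h.2.1, moll_const_mul (h.2.2 i).2.eb, (h.2.2 i).1]
    · rw [pderiv_const_mul h.2.1]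
      exact ih (h.2.2 i).2

lemma Reg.tr (h : Reg n φ) (y : E d) : Reg n fun x => φ (x + y) := by
  have key : ∀ {φ : E d → ℝ}, (Continuous φ ∧ ∃ C, ∀ x, |φ x| ≤ C) →
      Continuous (fun x => φ (x + y)) ∧ ∃ C, ∀ x, |φ (x + y)| ≤ C := by
    rintro φ ⟨hc, C, hC⟩
    exact ⟨hc.comp (continuous_id.add continuous_const), C, fun x => hC _⟩
  induction n generalizing φ with
  | zero => exact key h
  | succ n ih =>
    refine ⟨key h.1, h.2.1.comp (differentiable_id.add (differentiable_const y)),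
      fun i => ⟨fun j => ?_, ?_⟩⟩
    · rw [moll_tr, pderiv_tr, pderiv_tr, moll_tr, (h.2.2 i).1]
    · rw [pderiv_tr]
      exact ih (h.2.2 i).2

lemma Reg.mono {k : ℕ} (h : Reg n φ) (hk : k ≤ n) : Reg k φ := by
  induction n generalizing φ k with
  | zero => obtain rfl := Nat.le_zero.1 hk; exact h
  | succ n ih =>
    cases k with
    | zero => exact h.1
    | succ k => exact ⟨h.1, h.2.1, fun i => ⟨(h.2.2 i).1, ih (h.2.2 i).2 (by omega)⟩⟩

lemma Reg.dbar (h : Reg (n + 1) φ) (τ : E d → ℝ) (τ₀ t : ℝ) (a : E d ⊕ Fin d) :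
    Reg n (dbar τ τ₀ t a φ) := by
  have h' := h.mono (Nat.le_succ n)
  cases a with
  | inl lam => exact ((h'.tr _).sub h').const_mul _
  | inr i => exact (h.2.2 i).2.const_mul _

lemma Reg.dbar_moll (h : Reg 1 φ) (τ : E d → ℝ) (τ₀ t : ℝ) (a : E d ⊕ Fin d) (j : ℕ) :
    FDRichardson.dbar τ τ₀ t a (moll j φ) = moll j (FDRichardson.dbar τ τ₀ t a φ) := by
  cases a with
  | inl lam =>
    simp only [FDRichardson.dbar]
    rw [moll_const_mul ((h.tr _).sub h).eb, moll_sub (h.tr _).eb h.eb, moll_tr]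
  | inr i =>
    simp only [FDRichardson.dbar]
    rw [moll_const_mul (h.2.2 i).2.eb, (h.2.2 i).1]

lemma Reg.dbar2_moll (h : Reg 2 φ) (τ : E d → ℝ) (τ₀ t : ℝ) (μ : (E d ⊕ Fin d) × (E d ⊕ Fin d))
    (j : ℕ) : dbar2 τ τ₀ t μ (moll j φ) = moll j (dbar2 τ τ₀ t μ φ) := by
  unfold dbar2
  rw [(h.mono one_le_two).dbar_moll, (h.dbar τ τ₀ t μ.2).dbar_moll]

lemma MemB.reg (h : MemB (n + 1) φ) : Reg n φ := by
  have key : ∀ k (w : List (Fin d)), w.length + k ≤ n → Reg k (Dw w φ) := by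
    intro k
    induction k with
    | zero => exact fun w hw => h.continuous_Dw hw
    | succ k ih =>
      intro w hw
      refine ⟨h.continuous_Dw (by omega), ?_, fun i => ⟨fun j => ?_, ?_⟩⟩
      · obtain ⟨C, -, hC⟩ := h.exists_CB
        have h1 := (limit_contDiff (n - w.length) (C := C) (φ := fun j => Dw w (moll j φ))
          (fun j => contDiff_Dw (h.eb.sb_moll j).1 w) (fun j w' hw' x => by
            rw [← Dw_append]
            exact hC j _ (by rw [List.length_append]; omega) x)
          (h.contDiff.2 w (by omega))).1
        exact h1.differentiable (by
          have : n - w.length ≠ 0 := by omega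
          exact_mod_cast this)
      · rw [← h.Dw_moll_eq_moll_Dw (by omega)]
        have e : ∀ ψ : E d → ℝ, pderiv i (Dw w ψ) = Dw (w ++ [i]) ψ := fun ψ => by
          rw [Dw_append]; rfl
        rw [e, e, h.Dw_moll_eq_moll_Dw (by rw [List.length_append, List.length_singleton]; omega)]
      · have e : pderiv i (Dw w φ) = Dw (w ++ [i]) φ := by rw [Dw_append]; rfl
        rw [e]
        exact ih _ (by rw [List.length_append, List.length_singleton]; omega)
  exact key n [] (by simp)

end differentiability

section translations
variable (φ : E d → ℝ) (s : E d)

lemma shift_tr (a : E d ⊕ Fin d) :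
    shift h a (fun z => φ (z + s)) = fun z => shift h a φ (z + s) := by
  cases a with
  | inl lam => funext z; simp only [shift]; congr 1; abel
  | inr i => rfl

lemma diffQ_tr (y : E d) : diffQ h y (fun z => φ (z + s)) = fun z => diffQ h y φ (z + s) := by
  funext z
  simp only [diffQ]
  rw [add_right_comm]

lemma dbar_tr (a : E d ⊕ Fin d) :
    dbar τ τ₀ h a (fun z => φ (z + s)) = fun z => dbar τ τ₀ h a φ (z + s) := by
  cases a with
  | inl lam => funext z; simp only [dbar]; rw [add_right_comm]
  | inr i => simp only [dbar, pderiv_tr]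

lemma dbar2_tr (μ : (E d ⊕ Fin d) × (E d ⊕ Fin d)) :
    dbar2 τ τ₀ h μ (fun z => φ (z + s)) = fun z => dbar2 τ τ₀ h μ φ (z + s) := by
  unfold dbar2
  rw [dbar_tr, dbar_tr]

lemma shift2_tr (μ : (E d ⊕ Fin d) × (E d ⊕ Fin d)) :
    shift2 h μ (fun z => φ (z + s)) = fun z => shift2 h μ φ (z + s) := by
  unfold shift2
  rw [shift_tr, shift_tr]

end translations

section classK
variable {𝒦 : (E d → ℝ) → E d → ℝ}

lemma SB.bddBorel {φ : E d → ℝ} (h : SB φ) : BddBorel φ := ⟨h.1.continuous.measurable, h.bdd⟩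

lemma SB.abs_sq {φ : E d → ℝ} (h : SB φ) : SB fun x => |φ x| ^ 2 := by
  simp only [sq_abs]
  simpa only [sq] using h.mul h

lemma bddBorel_const (a : ℝ) : BddBorel (fun _ : E d => a) := ⟨measurable_const, |a|, fun _ => le_rfl⟩

lemma BddBorel.add {φ ψ : E d → ℝ} (h : BddBorel φ) (h' : BddBorel ψ) : BddBorel (φ + ψ) := by
  obtain ⟨hm, C, hC⟩ := h
  obtain ⟨hm', C', hC'⟩ := h'
  exact ⟨hm.add hm', C + C', fun x => (abs_add_le _ _).trans (add_le_add (hC x) (hC' x))⟩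

lemma BddBorel.smul {φ : E d → ℝ} (h : BddBorel φ) (a : ℝ) : BddBorel (a • φ) := by
  obtain ⟨hm, C, hC⟩ := h
  refine ⟨hm.const_smul a, |a| * C, fun x => ?_⟩
  rw [Pi.smul_apply, smul_eq_mul, abs_mul]
  exact mul_le_mul_of_nonneg_left (hC x) (abs_nonneg _)

lemma ClassK.le_of_le (hK : ClassK 𝒦) {φ : E d → ℝ} (hφ : BddBorel φ) {B : ℝ} (hB : 0 ≤ B)
    (h : ∀ y, φ y ≤ B) (x : E d) : 𝒦 φ x ≤ B := by
  have h1 := hK.map_nonneg (B • (fun _ => (1 : ℝ)) + (-1 : ℝ) • φ)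
    (((bddBorel_const 1).smul B).add (hφ.smul _)) (fun y => by simpa using h y) x
  rw [hK.map_add _ _ ((bddBorel_const 1).smul B) (hφ.smul _), hK.map_smul _ _ (bddBorel_const 1),
    hK.map_smul _ _ hφ] at h1
  simp only [Pi.add_apply, Pi.smul_apply, smul_eq_mul] at h1
  have h2 := mul_le_mul_of_nonneg_left (hK.map_one_le x) hB
  linarith

lemma ClassK.map_sum (hK : ClassK 𝒦) {s : Finset ι} {φ : ι → E d → ℝ}
    (hφ : ∀ i ∈ s, BddBorel (φ i)) :
    BddBorel (fun y => ∑ i ∈ s, φ i y) ∧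
      ∀ x, 𝒦 (fun y => ∑ i ∈ s, φ i y) x = ∑ i ∈ s, 𝒦 (φ i) x := by
  classical
  induction s using Finset.induction_on with
  | empty =>
    refine ⟨by simpa using bddBorel_const 0, fun x => ?_⟩
    have := hK.map_smul 0 (fun _ => 0) (bddBorel_const 0)
    simp only [zero_smul] at this
    simp only [Finset.sum_empty]
    exact congrFun this x
  | insert i s hi ih =>
    have hi' := hφ i (Finset.mem_insert_self _ _)
    obtain ⟨h1, h2⟩ := ih fun k hk => hφ k (Finset.mem_insert_of_mem hk)
    have e : (fun y => ∑ k ∈ insert i s, φ k y) = φ i + fun y => ∑ k ∈ s, φ k y := by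
      funext y
      simp [Finset.sum_insert hi]
    rw [e]
    refine ⟨hi'.add h1, fun x => ?_⟩
    rw [hK.map_add _ _ hi' h1, Pi.add_apply, h2, Finset.sum_insert hi]

lemma ClassK.sum_le (hK : ClassK 𝒦) {s : Finset ι} {φ : ι → E d → ℝ}
    (hφ : ∀ i ∈ s, BddBorel (φ i)) {B : ℝ} (hB : 0 ≤ B) (h : ∀ y, ∑ i ∈ s, φ i y ≤ B) (x : E d) :
    ∑ i ∈ s, 𝒦 (φ i) x ≤ B := by
  rw [← (hK.map_sum hφ).2]
  exact hK.le_of_le (hK.map_sum hφ).1 hB h x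

end classK

/-- Difference schemes with coefficients of limited smoothness. -/
structure RoughScheme (P : Params) (h₀ : ℝ) (S : Coeffs d) (τ : E d → ℝ) : Prop where
  three_le_m : 3 ≤ P.m
  h₀_pos : 0 < h₀
  q_mem : ∀ lam ∈ S.dirs, MemB P.m (S.q lam)
  p_mem : ∀ lam ∈ S.dirs, MemB P.m (S.p lam)
  c_mem : MemB P.m S.c
  q_bd : ∀ α : Fin d → ℕ, len α ≤ P.m → ∀ᵐ x ∂(volume : Measure (E d)),
    ∑ lam ∈ S.dirs, weakDeriv α (S.q lam) x ^ 2 ≤ P.Mb ^ 2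
  p_bd : ∀ α : Fin d → ℕ, len α ≤ P.m → ∀ᵐ x ∂(volume : Measure (E d)),
    ∑ lam ∈ S.dirs, weakDeriv α (S.p lam) x ^ 2 ≤ P.Mb ^ 2
  c_bd : ∀ α : Fin d → ℕ, len α ≤ P.m → ∀ᵐ x ∂(volume : Measure (E d)),
    |weakDeriv α S.c x| ≤ P.Mb
  sum_sq : ∑ lam ∈ S.dirs, ‖lam‖ ^ 2 ≤ P.a ^ 2
  wsum_sq : ∑ lam ∈ S.dirs, τ lam ^ 2 * ‖lam‖ ^ 2 ≤ P.b ^ 2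
  chi_nonneg : ∀ h, 0 < h → h ≤ h₀ → ∀ lam ∈ S.dirs, ∀ x, 0 ≤ chi S h lam x
  drift : ∀ x, ∑ lam ∈ S.dirs, S.q lam x • lam = 0
  c_ge : ∀ x, P.c₀ ≤ S.c x
  cond1 : StructCond1 S τ P.τ₀ h₀ P.δ P.K P.m
  cond2 : StructCond2 S τ P.τ₀ h₀ P.δ P.K P.m

/-- The scheme with mollified coefficients. -/
def mollCoeffs (S : Coeffs d) (j : ℕ) : Coeffs d where
  dirs := S.dirs
  q lam := moll j (S.q lam)
  p lam := moll j (S.p lam)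
  c := moll j S.c

namespace RoughScheme
variable (hS : RoughScheme P h₀ S τ)
include hS

lemma av_q {lam : E d} (hl : lam ∈ S.dirs) (j : ℕ) (x : E d) :
    Av j x (S.q lam) ((mollCoeffs S j).q lam x) := (hS.q_mem lam hl).eb.av

lemma av_p {lam : E d} (hl : lam ∈ S.dirs) (j : ℕ) (x : E d) :
    Av j x (S.p lam) ((mollCoeffs S j).p lam x) := (hS.p_mem lam hl).eb.av

lemma av_c (j : ℕ) (x : E d) : Av j x S.c ((mollCoeffs S j).c x) := hS.c_mem.eb.av

lemma reg_q {lam : E d} (hl : lam ∈ S.dirs) : Reg 2 (S.q lam) :=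
  ((hS.q_mem lam hl).mono hS.three_le_m).reg

lemma reg_p {lam : E d} (hl : lam ∈ S.dirs) : Reg 2 (S.p lam) :=
  ((hS.p_mem lam hl).mono hS.three_le_m).reg

lemma av_chi {lam : E d} (hl : lam ∈ S.dirs) (j : ℕ) (x : E d) :
    Av j x (chi S h lam) (chi (mollCoeffs S j) h lam x) :=
  (hS.av_q hl j x).add ((hS.av_p hl j x).const_mul h)

lemma av_dbar {φ : E d → ℝ} (hφ : Reg 2 φ) (a : E d ⊕ Fin d) (j : ℕ) (x : E d) :
    Av j x (dbar τ τ₀ h a φ) (dbar τ τ₀ h a (moll j φ) x) := by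
  have := hS.three_le_m
  rw [(hφ.mono one_le_two).dbar_moll]
  exact (hφ.dbar τ τ₀ h a).eb.av

lemma av_formQ (φ : E d → ℝ) (j : ℕ) (x : E d) :
    Av j x (fun y => formQ S h (fun z => φ (z + (x - y))) y) (formQ (mollCoeffs S j) h φ x) := by
  simp only [formQ, diffQ_tr, add_sub_cancel]
  exact Av.sum fun ν hν => (hS.av_chi hν j x).mul_const _

lemma av_formA (φ : E d → ℝ) (j : ℕ) (x : E d) :
    Av j x (fun y => formA S τ τ₀ h (fun z => φ (z + (x - y))) y)
      (formA (mollCoeffs S j) τ τ₀ h φ x) := by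
  simp only [formA, opL0, shift_tr, dbar_tr, diffQ_tr, add_sub_cancel]
  exact (Av.sum fun a _ => (((Av.sum fun ν hν =>
    (hS.av_dbar (hS.reg_q hν) a j x).mul_const _).const_mul _).add
    (Av.sum fun ν hν => (hS.av_dbar (hS.reg_p hν) a j x).mul_const _)).const_mul _).const_mul _

lemma av_opQ2 (φ : E d → ℝ) (μ : (E d ⊕ Fin d) × (E d ⊕ Fin d)) (j : ℕ) (x : E d) :
    Av j x (fun y => opQ2 S τ τ₀ h μ (fun z => φ (z + (x - y))) y)
      (opQ2 (mollCoeffs S j) τ τ₀ h μ φ x) := by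
  simp only [opQ2, diffQ_tr, add_sub_cancel]
  refine (Av.sum fun ν hν => Av.mul_const ?_ _).const_mul _
  change Av j x _ (dbar2 τ τ₀ h μ (moll j (S.q ν)) x)
  rw [(hS.reg_q hν).dbar2_moll]
  exact (((hS.reg_q hν).dbar τ τ₀ h μ.2).dbar τ τ₀ h μ.1).eb.av

lemma cond1_sup (hh : 0 < h) (hh₀ : h ≤ h₀) {φ : E d → ℝ} (hφ : SB φ) {B : ℝ}
    (hB : ∀ y, ∑ lam ∈ fullDirs S, |dbar τ P.τ₀ h lam φ y| ^ 2 ≤ B) (x : E d) :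
    (P.m : ℝ) * formA S τ P.τ₀ h φ x
        ≤ (1 - P.δ) * ∑ lam ∈ fullDirs S, formQ S h (dbar τ P.τ₀ h lam φ) x
          + P.K * formQ S h φ x + 2 * (1 - P.δ) * S.c x * B := by
  obtain ⟨𝒦, hK, H⟩ := hS.cond1 h hh hh₀
  refine (H φ hφ.smoothBdd x).trans ?_
  have hB0 : 0 ≤ B := (Finset.sum_nonneg fun _ _ => by positivity).trans (hB 0)
  have h1 := hK.le_of_le (SB.sum fun a _ => (hφ.dbar τ P.τ₀ h a).abs_sq).bddBorel hB0 hB x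
  have h2 : 0 ≤ 2 * (1 - P.δ) * S.c x :=
    mul_nonneg (mul_nonneg zero_le_two (sub_nonneg.2 P.δ_le)) (P.c₀_pos.le.trans (hS.c_ge x))
  linarith [mul_le_mul_of_nonneg_left h1 h2]

lemma cond2_sup (hh : 0 < h) (hh₀ : h ≤ h₀) {n : ℕ} (hn : 1 ≤ n) (hnm : n ≤ P.m)
    {s : Finset ι} {φ : ι → E d → ℝ} (hφ : ∀ k ∈ s, SB (φ k)) {B B' : ℝ}
    (hB : ∀ y, ∑ k ∈ s, ∑ μ ∈ fullDirs S ×ˢ fullDirs S, |dbar2 τ P.τ₀ h μ (φ k) y| ^ 2 ≤ B)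
    (hB' : ∀ y, ∑ k ∈ s, ∑ lam ∈ fullDirs S, |dbar τ P.τ₀ h lam (φ k) y| ^ 2 ≤ B') (x : E d) :
      ∑ k ∈ s, ((n : ℝ) * ∑ ν ∈ fullDirs S, formA S τ P.τ₀ h (dbar τ P.τ₀ h ν (φ k)) x
          + (n : ℝ) * ((n : ℝ) - 1) * ∑ μ ∈ fullDirs S ×ˢ fullDirs S,
              dbar2 τ P.τ₀ h μ (φ k) x * opQ2 S τ P.τ₀ h μ (shift2 h μ (φ k)) x)
        ≤ (1 - P.δ) * ∑ k ∈ s, ∑ μ ∈ fullDirs S ×ˢ fullDirs S,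
              formQ S h (dbar2 τ P.τ₀ h μ (φ k)) x
          + P.K * ∑ k ∈ s, ∑ lam ∈ fullDirs S, formQ S h (dbar τ P.τ₀ h lam (φ k)) x
          + 2 * (1 - P.δ) * S.c x * B + P.K * B' := by
  obtain ⟨𝒦, 𝒦', hK, hK', H⟩ := hS.cond2 h hh hh₀ n hn hnm
  refine (Finset.sum_le_sum fun k hk => H (φ k) (hφ k hk).smoothBdd x).trans ?_
  have hB0 : 0 ≤ B := (Finset.sum_nonneg fun _ _ => Finset.sum_nonneg fun _ _ => by
    positivity).trans (hB 0)
  have hB0' : 0 ≤ B' := (Finset.sum_nonneg fun _ _ => Finset.sum_nonneg fun _ _ => by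
    positivity).trans (hB' 0)
  have h1 := hK.sum_le (fun k hk => (SB.sum fun (μ : (E d ⊕ Fin d) × (E d ⊕ Fin d)) _ =>
    (((hφ k hk).dbar τ P.τ₀ h μ.2).dbar τ P.τ₀ h μ.1).abs_sq).bddBorel) hB0 hB x
  have h1' := hK'.sum_le (fun k hk => (SB.sum fun a _ =>
    ((hφ k hk).dbar τ P.τ₀ h a).abs_sq).bddBorel) hB0' hB' x
  have h2 : 0 ≤ 2 * (1 - P.δ) * S.c x :=
    mul_nonneg (mul_nonneg zero_le_two (sub_nonneg.2 P.δ_le)) (P.c₀_pos.le.trans (hS.c_ge x))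
  have h3 := mul_le_mul_of_nonneg_left h1 h2
  have h4 := mul_le_mul_of_nonneg_left h1' P.K_pos.le
  simp only [Finset.sum_add_distrib, ← Finset.mul_sum]
  simp only [dbar2] at h3 ⊢
  linarith

lemma scheme (j : ℕ) : Scheme P h₀ (mollCoeffs S j) τ where
  q_sb lam hl := (hS.q_mem lam hl).eb.sb_moll j
  p_sb lam hl := (hS.p_mem lam hl).eb.sb_moll j
  c_sb := hS.c_mem.eb.sb_moll j
  q_bd := MemB.CBf_moll hS.q_mem hS.q_bd j
  p_bd := MemB.CBf_moll hS.p_mem hS.p_bd j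
  c_bd := hS.c_mem.CB_moll hS.c_bd j
  sum_sq := hS.sum_sq
  wsum_sq := hS.wsum_sq
  chi_nonneg h hh hh₀ lam hl x :=
    (av_const j x 0).le (hS.av_chi hl j x) fun y => hS.chi_nonneg h hh hh₀ lam hl y
  drift x := by
    ext i
    have h1 : Av j x (fun y => ∑ lam ∈ S.dirs, S.q lam y * lam i)
        (∑ lam ∈ S.dirs, moll j (S.q lam) x * lam i) :=
      Av.sum fun lam hl => (hS.av_q hl j x).mul_const _
    have h2 : (fun y => ∑ lam ∈ S.dirs, S.q lam y * lam i) = fun _ => 0 := by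
      funext y
      have := congrArg (fun z : E d => z i) (hS.drift y)
      simpa using this
    rw [h2] at h1
    have h3 := h1.2.symm.trans (moll_const j 0 x)
    simpa [mollCoeffs] using h3
  c_ge x := (av_const j x P.c₀).le (hS.av_c j x) hS.c_ge
  cond1 h hh hh₀ φ hφ B hB x := by
    refine Av.le ((hS.av_formA φ j x).const_mul _)
      ((((Av.sum fun a _ => hS.av_formQ (dbar τ P.τ₀ h a φ) j x).const_mul _).add
        ((hS.av_formQ φ j x).const_mul _)).add
        (((hS.av_c j x).const_mul (2 * (1 - P.δ))).mul_const B)) fun y => ?_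
    have := hS.cond1_sup hh hh₀ (hφ.tr (x - y)) (B := B)
      (fun z => by simp only [dbar_tr]; exact hB _) y
    simp only [dbar_tr] at this
    exact this
  cond2 h hh hh₀ n hn hnm s φ hφ B B' hB hB' x := by
    refine Av.le (Av.sum fun k _ => ((Av.sum fun a _ =>
        hS.av_formA (dbar τ P.τ₀ h a (φ k)) j x).const_mul _).add
        ((Av.sum fun μ _ => (hS.av_opQ2 (shift2 h μ (φ k)) μ j x).const_mul _).const_mul _))
      (((((Av.sum fun k _ => Av.sum fun μ _ =>
          hS.av_formQ (dbar2 τ P.τ₀ h μ (φ k)) j x).const_mul _).add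
        ((Av.sum fun k _ => Av.sum fun a _ =>
          hS.av_formQ (dbar τ P.τ₀ h a (φ k)) j x).const_mul _)).add
        (((hS.av_c j x).const_mul (2 * (1 - P.δ))).mul_const B)).add (av_const j x (P.K * B')))
      fun y => ?_
    have := hS.cond2_sup hh hh₀ hn hnm (s := s) (φ := fun k z => φ k (z + (x - y)))
      (fun k hk => (hφ k hk).tr (x - y)) (B := B) (B' := B')
      (fun z => by simp only [dbar2_tr]; exact hB _)
      (fun z => by simp only [dbar_tr]; exact hB' _) y
    simp only [dbar_tr, dbar2_tr, shift2_tr, add_sub_cancel] at this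
    exact this

end RoughScheme

end

end FDRichardson

open MeasureTheory
open scoped ContDiff

namespace FDRichardson

noncomputable section

variable {d : ℕ} {ι : Type*} {P : Params} {h₀ h : ℝ} {S : Coeffs d} {τ : E d → ℝ} {f : E d → ℝ}

section jets

/-- The elliptic operator acting on jets. -/
def jetL (S : Coeffs d) (t : List (Fin d) → ℝ) (x : E d) : ℝ :=
  (1 / 2 : ℝ) * ∑ lam ∈ S.dirs, ∑ i, ∑ j, S.q lam x * lam i * lam j * t [i, j]
    + ∑ lam ∈ S.dirs, ∑ i, S.p lam x * lam i * t [i] - S.c x * t []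

/-- The jet of a function at a point. -/
def jet (φ : E d → ℝ) (x : E d) (w : List (Fin d)) : ℝ := Dw w φ x

/-- The size of the set of directions that enters the bounds for `jetL`. -/
def dirK (S : Coeffs d) : ℝ :=
  (1 / 2 : ℝ) * ∑ lam ∈ S.dirs, ∑ i, ∑ j, |lam i| * |lam j|
    + ∑ lam ∈ S.dirs, ∑ i, |lam i| + 1

lemma dirK_nonneg (S : Coeffs d) : 0 ≤ dirK S := by
  unfold dirK; positivity

lemma jetL_sub (S : Coeffs d) (t t' : List (Fin d) → ℝ) (x : E d) :
    jetL S (fun w => t w - t' w) x = jetL S t x - jetL S t' x := by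
  simp only [jetL, mul_sub, Finset.sum_sub_distrib]
  ring

lemma abs_jetL_le {x : E d} {X η : ℝ} (hq : ∀ lam ∈ S.dirs, |S.q lam x| ≤ X)
    (hp : ∀ lam ∈ S.dirs, |S.p lam x| ≤ X) (hc : |S.c x| ≤ X) {t : List (Fin d) → ℝ}
    (ht : ∀ w : List (Fin d), w.length ≤ 2 → |t w| ≤ η) : |jetL S t x| ≤ dirK S * (X * η) := by
  have hX : 0 ≤ X := (abs_nonneg _).trans hc
  have h1 : |∑ lam ∈ S.dirs, ∑ i, ∑ j, S.q lam x * lam i * lam j * t [i, j]|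
      ≤ (∑ lam ∈ S.dirs, ∑ i, ∑ j, |lam i| * |lam j|) * (X * η) := by
    simp only [Finset.sum_mul]
    refine (Finset.abs_sum_le_sum_abs _ _).trans (Finset.sum_le_sum fun lam hl => ?_)
    refine (Finset.abs_sum_le_sum_abs _ _).trans (Finset.sum_le_sum fun i _ => ?_)
    refine (Finset.abs_sum_le_sum_abs _ _).trans (Finset.sum_le_sum fun j _ => ?_)
    rw [abs_mul, abs_mul, abs_mul]
    have := mul_le_mul (hq lam hl) (ht [i, j] (by simp)) (abs_nonneg _) hX
    have h2 : 0 ≤ |lam i| * |lam j| := by positivity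
    have h3 := mul_le_mul_of_nonneg_left this h2
    linarith
  have h2 : |∑ lam ∈ S.dirs, ∑ i, S.p lam x * lam i * t [i]|
      ≤ (∑ lam ∈ S.dirs, ∑ i, |lam i|) * (X * η) := by
    simp only [Finset.sum_mul]
    refine (Finset.abs_sum_le_sum_abs _ _).trans (Finset.sum_le_sum fun lam hl => ?_)
    refine (Finset.abs_sum_le_sum_abs _ _).trans (Finset.sum_le_sum fun i _ => ?_)
    rw [abs_mul, abs_mul]
    have := mul_le_mul (hp lam hl) (ht [i] (by simp)) (abs_nonneg _) hX
    have h3 := mul_le_mul_of_nonneg_left this (abs_nonneg (lam i))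
    linarith
  have h3 : |S.c x * t []| ≤ X * η := by
    rw [abs_mul]
    exact mul_le_mul hc (ht [] (by simp)) (abs_nonneg _) hX
  have h4 : |(1 / 2 : ℝ) * ∑ lam ∈ S.dirs, ∑ i, ∑ j, S.q lam x * lam i * lam j * t [i, j]|
      ≤ (1 / 2 : ℝ) * ((∑ lam ∈ S.dirs, ∑ i, ∑ j, |lam i| * |lam j|) * (X * η)) := by
    rw [abs_mul, abs_of_nonneg (by norm_num : (0 : ℝ) ≤ 1 / 2)]
    exact mul_le_mul_of_nonneg_left h1 (by norm_num)
  unfold jetL dirK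
  refine (abs_sub _ _).trans
    ((add_le_add ((abs_add_le _ _).trans (add_le_add h4 h2)) h3).trans (le_of_eq ?_))
  ring

lemma dirD_dirD {φ : E d → ℝ} (hφ : ContDiff ℝ ∞ φ) (y : E d) (x : E d) :
    dirD y (dirD y φ) x = ∑ i, ∑ j, y i * y j * Dw [i, j] φ x := by
  have h1 : ∀ j, pderiv j (dirD y φ) x = ∑ i, y i * pderiv j (pderiv i φ) x := by
    intro j
    have := congrFun (Dw_sum (s := Finset.univ) (φ := fun i x => y i * pderiv i φ x)
      (fun i _ => contDiff_const.mul (contDiff_pderiv hφ i)) [j]) x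
    simp only [Dw_cons, Dw_nil] at this
    refine this.trans (Finset.sum_congr rfl fun i _ => ?_)
    rw [pderiv_const_mul (differentiable_of_smooth (contDiff_pderiv hφ i))]
  rw [dirD]
  simp only [h1, Finset.mul_sum]
  rw [Finset.sum_comm]
  refine Finset.sum_congr rfl fun i _ => Finset.sum_congr rfl fun j _ => ?_
  rw [Dw_cons, Dw_cons, Dw_nil]
  ring

lemma Lop_zero_eq_jetL (S : Coeffs d) {φ : E d → ℝ} (hφ : ContDiff ℝ ∞ φ) (x : E d) :
    Lop S 0 φ x - S.c x * φ x = jetL S (jet φ x) x := by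
  have h1 : ∀ lam : E d, (dirD lam)^[2] φ x = ∑ i, ∑ j, lam i * lam j * Dw [i, j] φ x :=
    fun lam => dirD_dirD hφ lam x
  unfold jetL Lop jet
  simp only [h1, zero_add, Function.iterate_one, dirD, Dw_nil, Nat.factorial]
  congr 1
  congr 1
  · rw [Finset.mul_sum]
    refine Finset.sum_congr rfl fun lam _ => ?_
    simp only [Finset.mul_sum]
    refine Finset.sum_congr rfl fun i _ => Finset.sum_congr rfl fun j _ => ?_
    norm_num
    ring
  · refine Finset.sum_congr rfl fun lam _ => ?_
    simp only [Finset.mul_sum]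
    refine Finset.sum_congr rfl fun i _ => ?_
    rw [Dw_cons, Dw_nil]
    norm_num
    ring

lemma count_pair (i j : Fin d) : (fun k => [i, j].count k) = Pi.single i 1 + Pi.single j 1 := by
  funext k
  simp only [List.count_cons, List.count_nil, Pi.add_apply, Pi.single_apply, beq_iff_eq, zero_add]
  simp only [eq_comm (a := k)]
  omega

lemma count_single (i : Fin d) : (fun k => [i].count k) = Pi.single i 1 := by
  funext k
  simp only [List.count_cons, List.count_nil, Pi.single_apply, beq_iff_eq, zero_add]
  simp only [eq_comm (a := k)]

lemma MemB.opL_ae_eq {v : E d → ℝ} (hv : MemB 3 v) (S : Coeffs d) :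
    ∀ᵐ x ∂(volume : Measure (E d)), opL S v x = jetL S (jet v x) x := by
  have h2 : ∀ᵐ x ∂(volume : Measure (E d)), ∀ i j : Fin d,
      weakDeriv (Pi.single i 1 + Pi.single j 1) v x = Dw [i, j] v x := by
    refine ae_all_iff.2 fun i => ae_all_iff.2 fun j => ?_
    have := hv.weakDeriv_ae_eq (w := [i, j]) (by simp)
    rwa [count_pair] at this
  have h1 : ∀ᵐ x ∂(volume : Measure (E d)), ∀ i : Fin d,
      weakDeriv (Pi.single i 1) v x = Dw [i] v x := by
    refine ae_all_iff.2 fun i => ?_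
    have := hv.weakDeriv_ae_eq (w := [i]) (by simp)
    rwa [count_single] at this
  filter_upwards [h1, h2] with x h1 h2
  simp only [opL, jetL, jet, h1, h2, Dw_nil]

end jets

lemma tendsto_jetL {α : Type*} {l : Filter α} {t : α → List (Fin d) → ℝ} {t' : List (Fin d) → ℝ}
    (S : Coeffs d) (x : E d)
    (ht : ∀ w : List (Fin d), w.length ≤ 2 → Filter.Tendsto (fun j => t j w) l (nhds (t' w))) :
    Filter.Tendsto (fun j => jetL S (t j) x) l (nhds (jetL S t' x)) := by
  unfold jetL
  refine (Filter.Tendsto.add ?_ ?_).sub ((ht [] (by simp)).const_mul _)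
  · exact (tendsto_finsetSum _ fun lam _ => tendsto_finsetSum _ fun i _ =>
      tendsto_finsetSum _ fun j _ => (ht [i, j] (by simp)).const_mul _).const_mul _
  · exact tendsto_finsetSum _ fun lam _ => tendsto_finsetSum _ fun i _ =>
      (ht [i] (by simp)).const_mul _

lemma tendsto_Lrem {α : Type*} {l : Filter α} {S' : α → Coeffs d} {r : ℕ} {ψ : E d → ℝ}
    {x : E d} (hd : ∀ j, (S' j).dirs = S.dirs)
    (hq : ∀ lam ∈ S.dirs, Filter.Tendsto (fun j => (S' j).q lam x) l (nhds (S.q lam x)))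
    (hp : ∀ lam ∈ S.dirs, Filter.Tendsto (fun j => (S' j).p lam x) l (nhds (S.p lam x))) :
    Filter.Tendsto (fun j => Lrem (S' j) r h ψ x) l (nhds (Lrem S r h ψ x)) := by
  unfold Lrem
  simp only [hd]
  exact (tendsto_finsetSum _ fun lam hl => (hq lam hl).mul_const _).add
    (tendsto_finsetSum _ fun lam hl => (hp lam hl).mul_const _)

lemma abs_opLh_sub_le {S' : Coeffs d} (hd : S'.dirs = S.dirs) (hh : 0 < h) {φ : E d → ℝ} {x : E d}
    {η C : ℝ} (hq : ∀ lam ∈ S.dirs, |S'.q lam x - S.q lam x| ≤ η)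
    (hp : ∀ lam ∈ S.dirs, |S'.p lam x - S.p lam x| ≤ η) (hc : |S'.c x - S.c x| ≤ η)
    (hφ : ∀ y, |φ y| ≤ C) :
    |opLh S' h φ x - opLh S h φ x|
      ≤ ((h⁻¹ + 1) * (S.dirs.card * (h⁻¹ * (2 * C))) + C) * η := by
  have hη : 0 ≤ η := (abs_nonneg _).trans hc
  have hD : ∀ lam, |diffQ h lam φ x| ≤ h⁻¹ * (2 * C) := fun lam => by
    rw [diffQ, abs_mul, abs_of_pos (inv_pos.2 hh)]
    refine mul_le_mul_of_nonneg_left ((abs_sub _ _).trans ?_) (inv_pos.2 hh).le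
    linarith [hφ (x + h • lam), hφ x]
  have key : ∀ g : E d → ℝ, (∀ lam ∈ S.dirs, |g lam| ≤ η) →
      |∑ lam ∈ S.dirs, g lam * diffQ h lam φ x| ≤ S.dirs.card * (h⁻¹ * (2 * C)) * η := by
    intro g hg
    refine (Finset.abs_sum_le_sum_abs _ _).trans ((Finset.sum_le_sum fun lam hl => ?_).trans_eq
      (Finset.sum_const (η * (h⁻¹ * (2 * C)))) |>.trans_eq ?_)
    · rw [abs_mul]
      exact mul_le_mul (hg lam hl) (hD lam) (abs_nonneg _) hη
    · rw [nsmul_eq_mul]; ring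
  have e : opLh S' h φ x - opLh S h φ x
      = h⁻¹ * ∑ lam ∈ S.dirs, (S'.q lam x - S.q lam x) * diffQ h lam φ x
        + ∑ lam ∈ S.dirs, (S'.p lam x - S.p lam x) * diffQ h lam φ x
        - (S'.c x - S.c x) * φ x := by
    simp only [opLh, hd, sub_mul, Finset.sum_sub_distrib]
    ring
  rw [e]
  have h1 := mul_le_mul_of_nonneg_left (key _ hq) (inv_pos.2 hh).le
  have h2 := key _ hp
  have h3 : |(S'.c x - S.c x) * φ x| ≤ η * C := by
    rw [abs_mul]
    exact mul_le_mul hc (hφ x) (abs_nonneg _) hη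
  have h4 : |h⁻¹ * ∑ lam ∈ S.dirs, (S'.q lam x - S.q lam x) * diffQ h lam φ x|
      ≤ h⁻¹ * (S.dirs.card * (h⁻¹ * (2 * C)) * η) := by
    rw [abs_mul, abs_of_pos (inv_pos.2 hh)]
    exact h1
  refine (abs_sub _ _).trans ((add_le_add ((abs_add_le _ _).trans (add_le_add h4 h2)) h3).trans ?_)
  refine le_of_eq ?_
  ring

/-- Almost solutions of the difference equation converge to a solution. -/
lemma Mono.exists_limit {c₀ : ℝ} (hM : Mono S h c₀) {φ : ℕ → E d → ℝ} {a : ℕ → ℝ} {C : ℝ}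
    (hφ : ∀ j x, |φ j x| ≤ C) (ha : Filter.Tendsto a Filter.atTop (nhds 0))
    (H : ∀ j x, |opLh S h (φ j) x + f x| ≤ a j) :
    ∃ w, IsDiffSol S f h w ∧ TendstoUniformly φ w Filter.atTop := by
  have hdiff : ∀ i j x, |φ i x - φ j x| ≤ (a i + a j) / c₀ := by
    intro i j x
    refine hM.abs_le_of_abs_opLh_le (φ := fun x => φ i x - φ j x)
      ⟨C + C, fun y => (abs_sub _ _).trans (add_le_add (hφ i y) (hφ j y))⟩ (fun y => ?_) x
    have e : opLh S h (fun x => φ i x - φ j x) y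
        = (opLh S h (φ i) y + f y) - (opLh S h (φ j) y + f y) := by
      rw [opLh_eq, opLh_eq, opLh_eq, opM_sub]
      ring
    rw [e]
    exact (abs_sub _ _).trans (add_le_add (H i y) (H j y))
  obtain ⟨w, hw⟩ := exists_tendstoUniformly (φ := φ) (fun ε hε => by
    have h1 := ha.eventually (gt_mem_nhds (show 0 < ε * c₀ / 2 by have := hM.c₀_pos; positivity))
    obtain ⟨N, hN⟩ := Filter.eventually_atTop.1 h1
    refine ⟨N, fun i hi j hj x => (hdiff i j x).trans ?_⟩
    rw [div_le_iff₀ hM.c₀_pos]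
    have := hN i hi
    have := hN j hj
    linarith)
  refine ⟨w, ⟨⟨C, fun x => le_of_tendsto (hw.tendsto_at x).abs
    (Filter.Eventually.of_forall fun j => hφ j x)⟩, fun x => ?_⟩, hw⟩
  have h1 : Filter.Tendsto (fun j => opLh S h (φ j) x + f x) Filter.atTop
      (nhds (opLh S h w x + f x)) := by
    unfold opLh diffQ
    have hsum : ∀ g : E d → ℝ, Filter.Tendsto
        (fun j => ∑ lam ∈ S.dirs, g lam * (h⁻¹ * (φ j (x + h • lam) - φ j x))) Filter.atTop
        (nhds (∑ lam ∈ S.dirs, g lam * (h⁻¹ * (w (x + h • lam) - w x)))) := fun g =>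
      tendsto_finsetSum _ fun lam _ =>
        (((hw.tendsto_at _).sub (hw.tendsto_at x)).const_mul _).const_mul _
    exact ((((hsum _).const_mul _).add (hsum _)).sub ((hw.tendsto_at x).const_mul _)).add_const _
  have h2 : Filter.Tendsto (fun j => opLh S h (φ j) x + f x) Filter.atTop (nhds 0) :=
    squeeze_zero_norm (fun j => H j x) ha
  exact tendsto_nhds_unique h1 h2

namespace RoughScheme
variable (hS : RoughScheme P h₀ S τ)
include hS

lemma exists_sup : ∃ X, 0 ≤ X ∧ ∀ x, (∀ lam ∈ S.dirs, |S.q lam x| ≤ X) ∧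
    (∀ lam ∈ S.dirs, |S.p lam x| ≤ X) ∧ |S.c x| ≤ X := by
  have h1 : ∀ lam, ∃ X, 0 ≤ X ∧ (lam ∈ S.dirs → ∀ x, |S.q lam x| ≤ X ∧ |S.p lam x| ≤ X) := by
    intro lam
    by_cases hl : lam ∈ S.dirs
    · obtain ⟨X, hX⟩ := (hS.q_mem lam hl).2.1
      obtain ⟨Y, hY⟩ := (hS.p_mem lam hl).2.1
      exact ⟨max X Y, ((abs_nonneg _).trans (hX 0)).trans (le_max_left _ _), fun _ x =>
        ⟨(hX x).trans (le_max_left _ _), (hY x).trans (le_max_right _ _)⟩⟩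
    · exact ⟨0, le_rfl, fun h => absurd h hl⟩
  choose X h0 hX using h1
  obtain ⟨Y, hY⟩ := hS.c_mem.2.1
  have hY0 : 0 ≤ Y := (abs_nonneg _).trans (hY 0)
  have hle : ∀ lam ∈ S.dirs, X lam ≤ ∑ lam ∈ S.dirs, X lam + Y := fun lam hl =>
    (Finset.single_le_sum (fun lam _ => h0 lam) hl).trans (le_add_of_nonneg_right hY0)
  refine ⟨∑ lam ∈ S.dirs, X lam + Y, add_nonneg (Finset.sum_nonneg fun lam _ => h0 lam) hY0,
    fun x => ⟨fun lam hl => (hX lam hl x).1.trans (hle lam hl),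
      fun lam hl => (hX lam hl x).2.trans (hle lam hl), (hY x).trans ?_⟩⟩
  exact le_add_of_nonneg_left (Finset.sum_nonneg fun lam _ => h0 lam)

lemma mono (hh : 0 < h) (hh₀ : h ≤ h₀) : Mono S h P.c₀ where
  h_pos := hh
  c₀_pos := P.c₀_pos
  chi_nonneg lam hl x := hS.chi_nonneg h hh hh₀ lam hl x
  chi_bdd := by
    obtain ⟨X, -, hX⟩ := hS.exists_sup
    refine ⟨∑ lam ∈ S.dirs, (X + h * X), fun x => Finset.sum_le_sum fun lam hl => ?_⟩
    exact add_le_add ((le_abs_self _).trans ((hX x).1 lam hl))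
      (mul_le_mul_of_nonneg_left ((le_abs_self _).trans ((hX x).2.1 lam hl)) hh.le)
  c_ge := hS.c_ge

lemma exists_rate (hf : MemB P.m f) : ∃ L, 0 ≤ L ∧ ∀ (j : ℕ) (x : E d),
    (∀ lam ∈ S.dirs, |(mollCoeffs S j).q lam x - S.q lam x| ≤ L * (1 / ((j : ℝ) + 1))) ∧
    (∀ lam ∈ S.dirs, |(mollCoeffs S j).p lam x - S.p lam x| ≤ L * (1 / ((j : ℝ) + 1))) ∧
    |(mollCoeffs S j).c x - S.c x| ≤ L * (1 / ((j : ℝ) + 1)) ∧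
    |moll j f x - f x| ≤ L * (1 / ((j : ℝ) + 1)) := by
  have hm : 1 ≤ P.m := P.one_le_m
  have h1 : ∀ lam, ∃ X, 0 ≤ X ∧ (lam ∈ S.dirs → ∀ (j : ℕ) x,
      |moll j (S.q lam) x - S.q lam x| ≤ X * (1 / ((j : ℝ) + 1)) ∧
      |moll j (S.p lam) x - S.p lam x| ≤ X * (1 / ((j : ℝ) + 1))) := by
    intro lam
    by_cases hl : lam ∈ S.dirs
    · obtain ⟨X, h0, hX⟩ := ((hS.q_mem lam hl).mono hm).exists_rate
      obtain ⟨Y, -, hY⟩ := ((hS.p_mem lam hl).mono hm).exists_rate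
      exact ⟨max X Y, h0.trans (le_max_left _ _), fun _ j x =>
        ⟨(hX j x).trans (mul_le_mul_of_nonneg_right (le_max_left _ _) (by positivity)),
          (hY j x).trans (mul_le_mul_of_nonneg_right (le_max_right _ _) (by positivity))⟩⟩
    · exact ⟨0, le_rfl, fun h => absurd h hl⟩
  choose X h0 hX using h1
  obtain ⟨Y, hY0, hY⟩ := (hS.c_mem.mono hm).exists_rate
  obtain ⟨Z, hZ0, hZ⟩ := (hf.mono hm).exists_rate
  have hs : 0 ≤ ∑ lam ∈ S.dirs, X lam := Finset.sum_nonneg fun lam _ => h0 lam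
  have hle : ∀ lam ∈ S.dirs, X lam ≤ ∑ lam ∈ S.dirs, X lam + Y + Z := fun lam hl => by
    have := Finset.single_le_sum (fun lam _ => h0 lam) hl
    linarith
  have key : ∀ (j : ℕ) {a b : ℝ}, b ≤ ∑ lam ∈ S.dirs, X lam + Y + Z → a ≤ b * (1 / ((j : ℝ) + 1)) →
      a ≤ (∑ lam ∈ S.dirs, X lam + Y + Z) * (1 / ((j : ℝ) + 1)) := fun j a b h h' =>
    h'.trans (mul_le_mul_of_nonneg_right h (by positivity))
  exact ⟨∑ lam ∈ S.dirs, X lam + Y + Z, by positivity, fun j x =>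
    ⟨fun lam hl => key j (hle lam hl) (hX lam hl j x).1,
      fun lam hl => key j (hle lam hl) (hX lam hl j x).2,
      key j (by linarith) (hY j x), key j (by linarith) (hZ j x)⟩⟩

/-- Solutions of the equations with mollified data. -/
lemma exists_approx (hf : MemB P.m f) : ∃ v : ℕ → ℝ → E d → ℝ, ∀ j h, 0 < h → h ≤ h₀ →
    SB (v j h) ∧ ∀ x, opLh (mollCoeffs S j) h (v j h) x + moll j f x = 0 := by
  have h1 : ∀ j h, ∃ v : E d → ℝ, 0 < h → h ≤ h₀ →
      SB v ∧ ∀ x, opLh (mollCoeffs S j) h v x + moll j f x = 0 := by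
    intro j h
    by_cases hh : 0 < h ∧ h ≤ h₀
    · have hj := hS.scheme j
      obtain ⟨v, hv⟩ := exists_smooth_diffSol (hj.mono hh.1 hh.2) hj.q_sb hj.p_sb hj.c_sb
        (hf.eb.sb_moll j)
      exact ⟨v, fun _ _ => hv⟩
    · exact ⟨0, fun h h' => absurd ⟨h, h'⟩ hh⟩
  choose v hv using h1
  exact ⟨v, hv⟩

lemma exists_CB_approx (hf : MemB P.m f) {v : ℕ → ℝ → E d → ℝ}
    (hv : ∀ j h, 0 < h → h ≤ h₀ →
      SB (v j h) ∧ ∀ x, opLh (mollCoeffs S j) h (v j h) x + moll j f x = 0) :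
    ∃ C, 0 ≤ C ∧ ∀ j h, 0 < h → h ≤ h₀ → CB P.m C (v j h) := by
  obtain ⟨N, hN, H⟩ := exists_apriori P d
  have hF : 0 ≤ normB P.m f := Real.sqrt_nonneg _
  refine ⟨N * normB P.m f, by positivity, fun j h hh hh₀ => ?_⟩
  exact H P.m le_rfl h₀ _ τ (hS.scheme j) h hh hh₀ _ _ _ (hf.eb.sb_moll j) (hv j h hh hh₀).1
    (hf.CB_moll_normB j) (hv j h hh hh₀).2

lemma exists_diffSol_limit (hf : MemB P.m f) {v : ℕ → ℝ → E d → ℝ}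
    (hv : ∀ j h, 0 < h → h ≤ h₀ →
      SB (v j h) ∧ ∀ x, opLh (mollCoeffs S j) h (v j h) x + moll j f x = 0)
    (hh : 0 < h) (hh₀ : h ≤ h₀) :
    ∃ w, IsDiffSol S f h w ∧ TendstoUniformly (fun j => v j h) w Filter.atTop := by
  obtain ⟨C, hC0, hC⟩ := hS.exists_CB_approx hf hv
  obtain ⟨L, hL0, hL⟩ := hS.exists_rate hf
  set κ := (h⁻¹ + 1) * (S.dirs.card * (h⁻¹ * (2 * C))) + C with hκ
  refine (hS.mono hh hh₀).exists_limit (C := C) (fun j x => (hC j h hh hh₀).bound x)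
    (tendsto_mul_one_div ((κ + 1) * L)) fun j x => ?_
  obtain ⟨hq, hp, hc, hf'⟩ := hL j x
  have h1 := abs_opLh_sub_le (S := S) (S' := mollCoeffs S j) rfl hh hq hp hc (hC j h hh hh₀).bound
  have e : opLh S h (v j h) x + f x
      = -(opLh (mollCoeffs S j) h (v j h) x - opLh S h (v j h) x) - (moll j f x - f x) := by
    linarith [(hv j h hh hh₀).2 x]
  rw [e]
  refine (abs_sub _ _).trans ?_
  rw [abs_neg]
  refine (add_le_add h1 hf').trans (le_of_eq ?_)
  rw [← hκ]
  ring

lemma abs_Lrem_le (hf : MemB P.m f) (hh : 0 < h) {C : ℝ} {ψ : E d → ℝ} (hψ : SB ψ) (hC : CB 3 C ψ)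
    (x : E d) : |Lrem S 0 h ψ x| ≤ (P.kL d 0 3 + P.kL d 0 2) * h * C := by
  obtain ⟨L, hL0, hL⟩ := hS.exists_rate hf
  have h1 : Filter.Tendsto (fun j => Lrem (mollCoeffs S j) 0 h ψ x) Filter.atTop
      (nhds (Lrem S 0 h ψ x)) :=
    tendsto_Lrem (fun j => rfl)
      (fun lam hl => tendsto_iff_norm_sub_tendsto_zero.2 (squeeze_zero (fun _ => norm_nonneg _)
        (fun j => (hL j x).1 lam hl) (tendsto_mul_one_div L)))
      (fun lam hl => tendsto_iff_norm_sub_tendsto_zero.2 (squeeze_zero (fun _ => norm_nonneg _)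
        (fun j => (hL j x).2.1 lam hl) (tendsto_mul_one_div L)))
  refine le_of_tendsto h1.abs (Filter.Eventually.of_forall fun j => ?_)
  have := (CB_Lrem (hS.scheme j) hh (n := 0) (r := 0) (Nat.zero_le _) hψ (by simpa using hC)).bound x
  simpa using this

/-- The maximum principle for the elliptic operator. -/
lemma abs_le_of_abs_jetL_le (hf : MemB P.m f) {ψ : E d → ℝ} (hψ : SB ψ) {R : ℝ}
    (H : ∀ x, |jetL S (jet ψ x) x| ≤ R) (y : E d) : |ψ y| ≤ R / P.c₀ := by
  obtain ⟨C, hC⟩ := hψ.exists_CB 3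
  set κ := P.kL d 0 3 + P.kL d 0 2 with hκ
  have hle : ∀ j : ℕ, |ψ y| ≤ (R + κ * (h₀ * (1 / ((j : ℝ) + 1))) * C) / P.c₀ := by
    intro j
    have hpos : 0 < h₀ * (1 / ((j : ℝ) + 1)) := mul_pos hS.h₀_pos (by positivity)
    have hle : h₀ * (1 / ((j : ℝ) + 1)) ≤ h₀ := mul_le_of_le_one_right hS.h₀_pos.le (by
      rw [div_le_one (by positivity)]
      have : (0 : ℝ) ≤ j := Nat.cast_nonneg j
      linarith)
    refine (hS.mono hpos hle).abs_le_of_abs_opLh_le hψ.bdd (fun x => ?_) y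
    have h1 := opM_expansion hS.drift hpos.ne' hψ.1 0 x
    rw [zero_add, Finset.sum_range_one, pow_zero, one_mul] at h1
    have e : opLh S (h₀ * (1 / ((j : ℝ) + 1))) ψ x
        = jetL S (jet ψ x) x + Lrem S 0 (h₀ * (1 / ((j : ℝ) + 1))) ψ x := by
      rw [opLh_eq, h1, ← Lop_zero_eq_jetL S hψ.1]
      ring
    rw [e]
    exact (abs_add_le _ _).trans (add_le_add (H x) (hS.abs_Lrem_le hf hpos hψ hC x))
  have h2 : Filter.Tendsto (fun j : ℕ => (R + κ * (h₀ * (1 / ((j : ℝ) + 1))) * C) / P.c₀)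
      Filter.atTop (nhds ((R + κ * 0 * C) / P.c₀)) :=
    ((((tendsto_mul_one_div h₀).const_mul κ).mul_const C).const_add R).div_const _
  simp only [mul_zero, zero_mul, add_zero] at h2
  exact ge_of_tendsto' h2 hle

lemma jetL_add_eq_zero {v : E d → ℝ} (hf : MemB P.m f) (hv : MemB 3 v)
    (hsol : IsEllipticSol S f v) (x : E d) : jetL S (jet v x) x + f x = 0 := by
  have hae : (fun x => jetL S (jet v x) x + f x) =ᵐ[volume] fun _ => 0 := by
    filter_upwards [hsol.2, hv.opL_ae_eq S] with x h1 h2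
    rw [← h2, h1]
  have hc : Continuous fun x => jetL S (jet v x) x + f x := by
    unfold jetL
    have hD : ∀ w : List (Fin d), w.length ≤ 2 → Continuous fun x => jet v x w := fun w hw =>
      (hv.continuous_Dw hw).1
    refine Continuous.add (Continuous.sub (Continuous.add ?_ ?_) (hS.c_mem.1.mul (hD [] (by simp))))
      hf.1
    · exact continuous_const.mul (continuous_finsetSum _ fun lam hl => continuous_finsetSum _
        fun i _ => continuous_finsetSum _ fun j _ => (((hS.q_mem lam hl).1.mul
          continuous_const).mul continuous_const).mul (hD [i, j] (by simp)))
    · exact continuous_finsetSum _ fun lam hl => continuous_finsetSum _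
        fun i _ => ((hS.p_mem lam hl).1.mul continuous_const).mul (hD [i] (by simp))
  exact congrFun (hc.ae_eq_iff_eq _ continuous_const |>.1 hae) x

lemma eventually_jetL_small {v : E d → ℝ} (hf : MemB P.m f) (hv : MemB 3 v)
    (hsol : IsEllipticSol S f v) {ε : ℝ} (hε : 0 < ε) :
    ∀ᶠ j in Filter.atTop, ∀ x, |jetL S (jet (moll j v) x) x + f x| ≤ ε := by
  obtain ⟨X, hX0, hX⟩ := hS.exists_sup
  have hK := dirK_nonneg S
  set η := ε / (dirK S * X + 1) with hη
  have hη0 : 0 < η := by positivity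
  have hD : ∀ w : List (Fin d), w.length ≤ 2 →
      ∀ᶠ j in Filter.atTop, ∀ x, |Dw w (moll j v) x - Dw w v x| ≤ η := by
    intro w hw
    filter_upwards [Metric.tendstoUniformly_iff.1 (hv.contDiff.2 w hw) η hη0] with j hj x
    have := (hj x).le
    rwa [dist_comm, Real.dist_eq] at this
  filter_upwards [hD [] (by simp), Filter.eventually_all.2 fun i => hD [i] (by simp),
    Filter.eventually_all.2 fun i => Filter.eventually_all.2 fun k => hD [i, k] (by simp)]
    with j h0 h1 h2 x
  have h3 : ∀ w : List (Fin d), w.length ≤ 2 → |jet (moll j v) x w - jet v x w| ≤ η := by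
    intro w hw
    match w, hw with
    | [], _ => exact h0 x
    | [i], _ => exact h1 i x
    | [i, k], _ => exact h2 i k x
    | _ :: _ :: _ :: _, hw => simp at hw
  have h4 := abs_jetL_le (hX x).1 (hX x).2.1 (hX x).2.2 h3
  rw [jetL_sub] at h4
  have h5 := hS.jetL_add_eq_zero hf hv hsol x
  have e : jetL S (jet (moll j v) x) x + f x
      = jetL S (jet (moll j v) x) x - jetL S (jet v x) x := by linarith
  rw [e]
  refine h4.trans ?_
  rw [hη, ← mul_assoc, mul_div_assoc', div_le_iff₀ (by positivity)]
  nlinarith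

/-- Uniqueness for the elliptic equation. -/
lemma ellipticSol_unique {v w : E d → ℝ} (hf : MemB P.m f) (hv : MemB 3 v) (hw : MemB 3 w)
    (hv' : IsEllipticSol S f v) (hw' : IsEllipticSol S f w) : v = w := by
  funext y
  have key : ∀ ε > 0, |v y - w y| ≤ ε := by
    intro ε hε
    have hc := P.c₀_pos
    have hε' : 0 < ε * P.c₀ / 2 := by positivity
    have h1 := ((tendsto_moll hv.1 hv.2.1 y).sub (tendsto_moll hw.1 hw.2.1 y)).abs
    refine le_of_tendsto h1 ?_
    filter_upwards [hS.eventually_jetL_small hf hv hv' hε',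
      hS.eventually_jetL_small hf hw hw' hε'] with j hj hj'
    have h2 := hS.abs_le_of_abs_jetL_le hf ((hv.eb.sb_moll j).sub (hw.eb.sb_moll j))
      (R := ε * P.c₀) (fun x => ?_) y
    · rwa [mul_div_cancel_right₀ _ hc.ne'] at h2
    · have e1 : jet (fun x => moll j v x - moll j w x) x
          = fun u => jet (moll j v) x u - jet (moll j w) x u := by
        funext u
        exact congrFun (Dw_sub (hv.eb.sb_moll j).1 (hw.eb.sb_moll j).1 u) x
      rw [e1, jetL_sub]
      have h3 := abs_le.1 (hj x)
      have h4 := abs_le.1 (hj' x)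
      exact abs_le.2 ⟨by linarith, by linarith⟩
  have := le_of_forall_pos_le_add (a := |v y - w y|) (b := 0) fun ε hε => by
    rw [zero_add]; exact key ε hε
  exact sub_eq_zero.1 (abs_nonpos_iff.1 this)

/-- Existence for the elliptic equation. -/
lemma exists_ellipticSol_limit (hf : MemB P.m f) {v : ℕ → ℝ → E d → ℝ}
    (hv : ∀ j h, 0 < h → h ≤ h₀ →
      SB (v j h) ∧ ∀ x, opLh (mollCoeffs S j) h (v j h) x + moll j f x = 0)
    {ε : ℕ → ℝ} (hε : ∀ j, 0 < ε j ∧ ε j ≤ h₀) (hε0 : Filter.Tendsto ε Filter.atTop (nhds 0)) :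
    ∃ w, MemB P.m w ∧ IsEllipticSol S f w
      ∧ TendstoUniformly (fun j => v j (ε j)) w Filter.atTop := by
  obtain ⟨C, hC0, hC⟩ := hS.exists_CB_approx hf hv
  obtain ⟨L, hL0, hL⟩ := hS.exists_rate hf
  have hm := hS.three_le_m
  set u : ℕ → E d → ℝ := fun j => v j (ε j) with hu
  have hus : ∀ j, SB (u j) := fun j => (hv j _ (hε j).1 (hε j).2).1
  have huC : ∀ j, CB P.m C (u j) := fun j => hC j _ (hε j).1 (hε j).2
  set κ := P.kL d 0 3 + P.kL d 0 2 with hκ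
  set a : ℕ → ℝ := fun j => κ * ε j * C + (dirK S * C + 1) * L * (1 / ((j : ℝ) + 1)) with ha
  have ha0 : Filter.Tendsto a Filter.atTop (nhds 0) := by
    have := ((hε0.const_mul κ).mul_const C).add (tendsto_mul_one_div ((dirK S * C + 1) * L))
    simpa only [mul_zero, zero_mul, add_zero] using this
  have H : ∀ j x, |jetL S (jet (u j) x) x + f x| ≤ a j := by
    intro j x
    obtain ⟨hq, hp, hc, hf'⟩ := hL j x
    have h1 := opM_expansion (hS.scheme j).drift (hε j).1.ne' (hus j).1 0 x
    rw [zero_add, Finset.sum_range_one, pow_zero, one_mul] at h1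
    have h2 := (hv j _ (hε j).1 (hε j).2).2 x
    rw [opLh_eq, h1] at h2
    have h3 := Lop_zero_eq_jetL (mollCoeffs S j) (hus j).1 x
    have h4 : |Lrem (mollCoeffs S j) 0 (ε j) (u j) x| ≤ κ * ε j * C := by
      have := (CB_Lrem (hS.scheme j) (hε j).1 (n := 0) (r := 0) (Nat.zero_le _) (hus j)
        ((huC j).mono (by omega) le_rfl)).bound x
      simpa using this
    let D : Coeffs d := ⟨S.dirs, fun lam x => (mollCoeffs S j).q lam x - S.q lam x,
      fun lam x => (mollCoeffs S j).p lam x - S.p lam x, fun x => (mollCoeffs S j).c x - S.c x⟩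
    have h5 : jetL D (jet (u j) x) x
        = jetL (mollCoeffs S j) (jet (u j) x) x - jetL S (jet (u j) x) x := by
      have hd : (mollCoeffs S j).dirs = S.dirs := rfl
      simp only [jetL, D, hd, sub_mul, Finset.sum_sub_distrib]
      ring
    have h6 : |jetL D (jet (u j) x) x| ≤ dirK D * (L * (1 / ((j : ℝ) + 1)) * C) :=
      abs_jetL_le hq hp hc fun w hw => huC j w (by omega) x
    have h7 : dirK D = dirK S := rfl
    have e : jetL S (jet (u j) x) x + f x
        = -jetL D (jet (u j) x) x - Lrem (mollCoeffs S j) 0 (ε j) (u j) x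
          - (moll j f x - f x) := by
      rw [h5]
      linarith
    rw [e]
    refine (abs_sub _ _).trans ((add_le_add ((abs_sub _ _).trans (add_le_add
      ((abs_neg _).le.trans h6) h4)) hf').trans (le_of_eq ?_))
    rw [h7, ha]
    ring
  have hdiff : ∀ i j x, |u i x - u j x| ≤ (a i + a j) / P.c₀ := by
    intro i j x
    refine hS.abs_le_of_abs_jetL_le hf ((hus i).sub (hus j)) (fun y => ?_) x
    have e1 : jet (fun x => u i x - u j x) y = fun w => jet (u i) y w - jet (u j) y w := by
      funext w
      exact congrFun (Dw_sub (hus i).1 (hus j).1 w) y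
    rw [e1, jetL_sub]
    have h3 := abs_le.1 (H i y)
    have h4 := abs_le.1 (H j y)
    exact abs_le.2 ⟨by linarith, by linarith⟩
  obtain ⟨w, hw⟩ := exists_tendstoUniformly (φ := u) (fun η hη => by
    have h1 := ha0.eventually (gt_mem_nhds (show 0 < η * P.c₀ / 2 by
      have := P.c₀_pos; positivity))
    obtain ⟨N, hN⟩ := Filter.eventually_atTop.1 h1
    refine ⟨N, fun i hi j hj x => (hdiff i j x).trans ?_⟩
    rw [div_le_iff₀ P.c₀_pos]
    have := hN i hi
    have := hN j hj
    linarith)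
  obtain ⟨n, hn⟩ : ∃ n, P.m = n + 1 := ⟨P.m - 1, by omega⟩
  have huC' : ∀ j, CB (n + 1) C (u j) := fun j => (huC j).mono hn.ge le_rfl
  have hmem : MemB P.m w := by
    rw [hn]
    exact memB_of_limit (fun j => (hus j).1) huC' hw
  refine ⟨w, hmem, ⟨hmem.mono (by omega), ?_⟩, hw⟩
  filter_upwards [(hmem.mono hm).opL_ae_eq S] with x hx
  rw [hx]
  have h1 : Filter.Tendsto (fun j => jetL S (jet (u j) x) x + f x) Filter.atTop
      (nhds (jetL S (jet w x) x + f x)) :=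
    (tendsto_jetL S x fun w' hw' =>
      ((limit_contDiff n (fun j => (hus j).1) huC' hw).2 w' (by omega)).tendsto_at x).add_const _
  exact tendsto_nhds_unique h1 (squeeze_zero_norm (fun j => H j x) ha0)

end RoughScheme

end

end FDRichardson

open MeasureTheory
open scoped ContDiff

namespace FDRichardson

noncomputable section

variable {d : ℕ} {ι : Type*} {P : Params} {h₀ h : ℝ} {S : Coeffs d} {τ : E d → ℝ} {f : E d → ℝ}

lemma tendstoUniformly_sum {X : Type*} {s : Finset ι} {φ : ι → ℕ → X → ℝ} {g : ι → X → ℝ}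
    (b : ι → ℝ) (h : ∀ i ∈ s, TendstoUniformly (φ i) (g i) Filter.atTop) :
    TendstoUniformly (fun j x => ∑ i ∈ s, b i * φ i j x) (fun x => ∑ i ∈ s, b i * g i x)
      Filter.atTop := by
  rw [Metric.tendstoUniformly_iff]
  intro ε hε
  set A := ∑ i ∈ s, |b i| with hA
  have hA0 : 0 ≤ A := Finset.sum_nonneg fun _ _ => abs_nonneg _
  have h1 : ∀ᶠ j in Filter.atTop, ∀ i ∈ s, ∀ x, dist (g i x) (φ i j x) < ε / (A + 1) :=
    (Filter.eventually_all_finset s).2 fun i hi =>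
      Metric.tendstoUniformly_iff.1 (h i hi) _ (by positivity)
  filter_upwards [h1] with j hj x
  rw [Real.dist_eq, ← Finset.sum_sub_distrib]
  have h2 : |∑ i ∈ s, (b i * g i x - b i * φ i j x)| ≤ A * (ε / (A + 1)) := by
    rw [hA, Finset.sum_mul]
    refine (Finset.abs_sum_le_sum_abs _ _).trans (Finset.sum_le_sum fun i hi => ?_)
    rw [← mul_sub, abs_mul]
    have := (hj i hi x).le
    rw [Real.dist_eq] at this
    exact mul_le_mul_of_nonneg_left this (abs_nonneg _)
  refine h2.trans_lt ?_
  rw [mul_div_assoc', div_lt_iff₀ (by positivity)]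
  nlinarith

lemma SymmCond.mollCoeffs (h : SymmCond S) (j : ℕ) : SymmCond (mollCoeffs S j) := fun lam hl =>
  ⟨(h lam hl).1, fun x => by
    have : S.q (-lam) = S.q lam := funext (h lam hl).2
    simp only [FDRichardson.mollCoeffs, this]⟩

lemma AntisymmCond.mollCoeffs (h : AntisymmCond S) (hp : ∀ lam ∈ S.dirs, EB (S.p lam)) (j : ℕ) :
    AntisymmCond (mollCoeffs S j) := fun lam hl x => by
  have h1 : S.p (-lam) = fun x => (-1) * S.p lam x := funext fun y => by rw [h lam hl y]; ring
  simp only [FDRichardson.mollCoeffs, h1]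
  rw [moll_const_mul (hp lam hl)]
  ring

namespace RoughScheme

/-- The estimate for a linear combination of solutions of difference equations obtained as
limits of smooth approximations. -/
lemma combination_estimate (hS : RoughScheme P h₀ S τ) (hf : MemB P.m f)
    {v : ℕ → ℝ → E d → ℝ}
    (hv : ∀ j h, 0 < h → h ≤ h₀ →
      SB (v j h) ∧ ∀ x, opLh (mollCoeffs S j) h (v j h) x + moll j f x = 0)
    {w : ℝ → E d → ℝ}
    (hw : ∀ h, 0 < h → h ≤ h₀ → TendstoUniformly (fun j => v j h) (w h) Filter.atTop)
    {ε : ℕ → ℝ} (hε : ∀ j, 0 < ε j ∧ ε j ≤ h₀) (hε0 : Filter.Tendsto ε Filter.atTop (nhds 0))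
    {w₀ : E d → ℝ} (hw₀ : TendstoUniformly (fun j => v j (ε j)) w₀ Filter.atTop)
    {l k J : ℕ} (hl : l + 1 ≤ P.m) {N : ℝ} (b : Fin (J + 1) → ℝ) (hh : 0 < h) (hh₀ : h ≤ h₀)
    (H : ∀ j, CB l (N * (h ^ (k + 1) + ε j * (1 + h) ^ k))
      (fun x => ∑ i : Fin (J + 1), b i * v j ((1 / 2 : ℝ) ^ (i : ℕ) * h) x - v j (ε j) x))
    (α : Fin d → ℕ) (hα : len α ≤ l) (x : E d) :
    |multiDeriv α (fun x => ∑ i : Fin (J + 1), b i * w ((1 / 2 : ℝ) ^ (i : ℕ) * h) x) x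
      - multiDeriv α w₀ x| ≤ N * h ^ (k + 1) := by
  obtain ⟨C, hC0, hC⟩ := hS.exists_CB_approx hf hv
  have hle : ∀ j : ℕ, 0 < (1 / 2 : ℝ) ^ j * h ∧ (1 / 2 : ℝ) ^ j * h ≤ h₀ := fun j =>
    ⟨by positivity, (mul_le_of_le_one_left hh.le
      (pow_le_one₀ (by norm_num) (by norm_num))).trans hh₀⟩
  set φ : ℕ → E d → ℝ := fun j x =>
    ∑ i : Fin (J + 1), b i * v j ((1 / 2 : ℝ) ^ (i : ℕ) * h) x with hφ
  have hvs : ∀ (j i : ℕ), SB (v j ((1 / 2 : ℝ) ^ i * h)) := fun j i =>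
    (hv j _ (hle i).1 (hle i).2).1
  have hφs : ∀ j, SB (φ j) := fun j => SB.sum fun i _ => (hvs j i).const_mul _
  have hφC : ∀ j, CB (l + 1) (∑ i, |b i| * C) (φ j) := fun j =>
    CB.sum (fun i _ => ((hC j _ (hle i).1 (hle i).2).mono hl le_rfl).const_mul (hvs j i).1 _)
      fun i _ => ((hvs j i).const_mul _).1
  have h1 := (limit_contDiff l (fun j => (hφs j).1) hφC
    (tendstoUniformly_sum b fun i _ => hw _ (hle i).1 (hle i).2)).2 (wordOf α)
    (by rwa [length_wordOf])
  have h2 := (limit_contDiff l (fun j => (hv j _ (hε j).1 (hε j).2).1.1)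
    (fun j => (hC j _ (hε j).1 (hε j).2).mono hl le_rfl) hw₀).2 (wordOf α)
    (by rwa [length_wordOf])
  have h3 : Filter.Tendsto (fun j => N * (h ^ (k + 1) + ε j * (1 + h) ^ k)) Filter.atTop
      (nhds (N * (h ^ (k + 1) + 0 * (1 + h) ^ k))) :=
    ((hε0.mul_const _).const_add _).const_mul _
  rw [zero_mul, add_zero] at h3
  rw [multiDeriv_eq_Dw, multiDeriv_eq_Dw]
  refine le_of_tendsto_of_tendsto ((h1.tendsto_at x).sub (h2.tendsto_at x)).abs h3
    (Filter.Eventually.of_forall fun j => ?_)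
  have h4 := H j (wordOf α) (by rwa [length_wordOf]) x
  rwa [Dw_sub (hφs j).1 (hv j _ (hε j).1 (hε j).2).1.1] at h4

end RoughScheme

lemma RateCond.mollCoeffs {m k l : ℕ} (h : RateCond S m k l)
    (hp : ∀ lam ∈ S.dirs, EB (S.p lam)) (j : ℕ) : RateCond (mollCoeffs S j) m k l := by
  rcases h with h | ⟨h, h'⟩ | ⟨h, h', h'', h'''⟩
  · exact Or.inl h
  · exact Or.inr (Or.inl ⟨h, h'.mollCoeffs j⟩)
  · exact Or.inr (Or.inr ⟨h, h', h''.mollCoeffs j, h'''.mollCoeffs hp j⟩)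

lemma RateCond.le {m k l : ℕ} (h : RateCond S m k l) : k ≤ m ∧ l + 1 ≤ m := by
  rcases h with h | ⟨h, -⟩ | ⟨-, h, -⟩ <;> omega

/-- Existence, uniqueness and acceleration for schemes with coefficients of limited smoothness. -/
theorem exists_accelerated_rate (P : Params) (d : ℕ) :
    ∃ N, 0 ≤ N ∧ ∀ (h₀ : ℝ) (S : Coeffs d) (τ f : E d → ℝ) (k l : ℕ), RoughScheme P h₀ S τ →
      MemB P.m f → RateCond S P.m k l →
      (∀ h : ℝ, 0 < h → h ≤ h₀ → ∃! w : E d → ℝ, IsDiffSol S f h w) ∧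
      (∃! w : E d → ℝ, MemB P.m w ∧ IsEllipticSol S f w) ∧
      ∀ (v : ℝ → E d → ℝ) (v₀ : E d → ℝ),
        (∀ h : ℝ, 0 < h → h ≤ h₀ → IsDiffSol S f h (v h)) →
        MemB P.m v₀ → IsEllipticSol S f v₀ →
        (∀ h : ℝ, 0 < h → h ≤ h₀ → ContDiff ℝ l (v h)) ∧
        ContDiff ℝ l v₀ ∧
        (∀ h : ℝ, 0 < h → h ≤ h₀ → ∀ α : Fin d → ℕ, len α ≤ l → ∀ x,
          |multiDeriv α (richardson k v h) x - multiDeriv α v₀ x|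
            ≤ N * normB P.m f * h ^ (k + 1)) ∧
        ((Odd k ∧ SymmCond S ∧ AntisymmCond S) →
          ∀ h : ℝ, 0 < h → h ≤ h₀ → ∀ α : Fin d → ℕ, len α ≤ l → ∀ x,
            |multiDeriv α (richardsonOdd k v h) x - multiDeriv α v₀ x|
              ≤ N * normB P.m f * h ^ (k + 1)) := by
  choose N hN HN using fun k l => exists_richardson_estimate P d k l
  refine ⟨∑ k ∈ Finset.range (P.m + 1), ∑ l ∈ Finset.range (P.m + 1), N k l,
    Finset.sum_nonneg fun _ _ => Finset.sum_nonneg fun _ _ => hN _ _, ?_⟩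
  intro h₀ S τ f k l hS hf hR
  have hle : N k l ≤ ∑ k ∈ Finset.range (P.m + 1), ∑ l ∈ Finset.range (P.m + 1), N k l :=
    (Finset.single_le_sum (f := fun l => N k l) (fun l _ => hN k l)
      (Finset.mem_range.2 (by have := hR.le; omega))).trans
    (Finset.single_le_sum (f := fun k => ∑ l ∈ Finset.range (P.m + 1), N k l)
      (fun k _ => Finset.sum_nonneg fun l _ => hN k l)
      (Finset.mem_range.2 (by have := hR.le; omega)))
  obtain ⟨u, hu⟩ := hS.exists_approx hf
  obtain ⟨C, hC0, hC⟩ := hS.exists_CB_approx hf hu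
  set ε : ℕ → ℝ := fun j => h₀ * (1 / ((j : ℝ) + 1)) with hεdef
  have hε : ∀ j, 0 < ε j ∧ ε j ≤ h₀ := fun j =>
    ⟨mul_pos hS.h₀_pos (by positivity), mul_le_of_le_one_right hS.h₀_pos.le (by
      rw [div_le_one (by positivity)]
      have : (0 : ℝ) ≤ j := Nat.cast_nonneg j
      linarith)⟩
  have hε0 : Filter.Tendsto ε Filter.atTop (nhds 0) := tendsto_mul_one_div h₀
  have hdiff : ∀ h : ℝ, 0 < h → h ≤ h₀ → ∃ w, IsDiffSol S f h w ∧
      TendstoUniformly (fun j => u j h) w Filter.atTop := fun h hh hh₀ =>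
    hS.exists_diffSol_limit hf hu hh hh₀
  obtain ⟨w₀, hw₀m, hw₀s, hw₀⟩ := hS.exists_ellipticSol_limit hf hu hε hε0
  have h3m := hS.three_le_m
  refine ⟨fun h hh hh₀ => ?_, ⟨w₀, ⟨hw₀m, hw₀s⟩, fun y hy => ?_⟩, ?_⟩
  · obtain ⟨w, hw, -⟩ := hdiff h hh hh₀
    exact ⟨w, hw, fun y hy => (hS.mono hh hh₀).diffSol_unique hy hw⟩
  · exact hS.ellipticSol_unique hf (hy.1.mono h3m) (hw₀m.mono h3m) hy.2 hw₀s
  intro v v₀ hv hv₀m hv₀s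
  obtain rfl : v₀ = w₀ := hS.ellipticSol_unique hf (hv₀m.mono h3m) (hw₀m.mono h3m) hv₀s hw₀s
  have hvu : ∀ h : ℝ, 0 < h → h ≤ h₀ → TendstoUniformly (fun j => u j h) (v h) Filter.atTop := by
    intro h hh hh₀
    obtain ⟨w, hw, hw'⟩ := hdiff h hh hh₀
    rwa [(hS.mono hh hh₀).diffSol_unique (hv h hh hh₀) hw]
  have hEB : ∀ lam ∈ S.dirs, EB (S.p lam) := fun lam hl => (hS.p_mem lam hl).eb
  have hest : ∀ h : ℝ, 0 < h → h ≤ h₀ → ∀ j : ℕ, _ := fun h hh hh₀ j =>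
    HN k l h₀ (mollCoeffs S j) τ (hS.scheme j) (hR.mollCoeffs hEB j) (moll j f) (normB P.m f)
      (ε j) (u j (ε j)) (u j) (hf.eb.sb_moll j) (hf.CB_moll_normB j) (hε j).1 (hε j).2
      (hu j _ (hε j).1 (hε j).2).1 (hu j _ (hε j).1 (hε j).2).2 (hu j) h hh hh₀
  have hfin : ∀ h : ℝ, 0 < h → N k l * normB P.m f * h ^ (k + 1)
      ≤ (∑ k ∈ Finset.range (P.m + 1), ∑ l ∈ Finset.range (P.m + 1), N k l)
        * normB P.m f * h ^ (k + 1) := fun h hh =>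
    mul_le_mul_of_nonneg_right (mul_le_mul_of_nonneg_right hle (Real.sqrt_nonneg _))
      (by positivity)
  refine ⟨fun h hh hh₀ => ?_, ?_, fun h hh hh₀ α hα x => ?_, fun hodd h hh hh₀ α hα x => ?_⟩
  · exact (limit_contDiff l (fun j => (hu j h hh hh₀).1.1)
      (fun j => (hC j h hh hh₀).mono hR.le.2 le_rfl) (hvu h hh hh₀)).1
  · exact (limit_contDiff l (fun j => (hu j _ (hε j).1 (hε j).2).1.1)
      (fun j => (hC j _ (hε j).1 (hε j).2).mono hR.le.2 le_rfl) hw₀).1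
  · exact (hS.combination_estimate hf hu hvu hε hε0 hw₀ hR.le.2 _ hh hh₀
      (fun j => (hest h hh hh₀ j).1) α hα x).trans (hfin h hh)
  · exact (hS.combination_estimate hf hu hvu hε hε0 hw₀ hR.le.2 _ hh hh₀
      (fun j => (hest h hh hh₀ j).2 ⟨hodd.1, hodd.2.1.mollCoeffs j,
        hodd.2.2.mollCoeffs hEB j⟩) α hα x).trans (hfin h hh)

end

end FDRichardson

open FDRichardson in
theorem corollary3p08p02p08
    (d m : ℕ) (δ K τ₀ c₀ a b : ℝ) (M : Fin (m + 1) → ℝ)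
    (hm : 3 ≤ m) (hδ₀ : 0 < δ) (hδ₁ : δ ≤ 1) (hK : 1 ≤ K) (hτ₀ : 0 < τ₀) (hc₀ : 0 < c₀) :
    ∃ N : ℝ, ∀ (h₀ : ℝ) (S : Coeffs d) (τ : E d → ℝ) (f : E d → ℝ) (k l : ℕ),
      0 < h₀ →
      (0 : E d) ∉ S.dirs →
      (∀ lam ∈ S.dirs, 0 ≤ τ lam) →
      dirsNorm S = a →
      dirsWNorm S τ = b →
      (∀ lam ∈ S.dirs, ∀ x, 0 ≤ S.q lam x) →
      RegularCoeffs S m M →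
      MemB m f →
      (∀ h : ℝ, 0 < h → h ≤ h₀ → ∀ lam ∈ S.dirs, ∀ x, 0 ≤ chi S h lam x) →
      (∀ x, ∑ lam ∈ S.dirs, S.q lam x • lam = 0) →
      (∀ x, c₀ ≤ S.c x) →
      StructCond1 S τ τ₀ h₀ δ K m →
      StructCond2 S τ τ₀ h₀ δ K m →
      (3 * k + 3 + l ≤ m ∨
        (2 * k + 3 + l ≤ m ∧ SymmCond S) ∨
        (Odd k ∧ 2 * k + 2 + l ≤ m ∧ SymmCond S ∧ AntisymmCond S)) →
      (∀ h : ℝ, 0 < h → h ≤ h₀ → ∃! w : E d → ℝ, IsDiffSol S f h w) ∧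
      (∃! w : E d → ℝ, MemB m w ∧ IsEllipticSol S f w) ∧
      ∀ (v : ℝ → E d → ℝ) (v₀ : E d → ℝ),
        (∀ h : ℝ, 0 < h → h ≤ h₀ → IsDiffSol S f h (v h)) →
        MemB m v₀ → IsEllipticSol S f v₀ →
        (∀ h : ℝ, 0 < h → h ≤ h₀ → ContDiff ℝ l (v h)) ∧
        ContDiff ℝ l v₀ ∧
        (∀ h : ℝ, 0 < h → h ≤ h₀ → ∀ α : Fin d → ℕ, len α ≤ l → ∀ x,
          |multiDeriv α (richardson k v h) x - multiDeriv α v₀ x|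
            ≤ N * normB m f * h ^ (k + 1)) ∧
        ((Odd k ∧ 2 * k + 2 + l ≤ m ∧ SymmCond S ∧ AntisymmCond S) →
          ∀ h : ℝ, 0 < h → h ≤ h₀ → ∀ α : Fin d → ℕ, len α ≤ l → ∀ x,
            |multiDeriv α (richardsonOdd k v h) x - multiDeriv α v₀ x|
              ≤ N * normB m f * h ^ (k + 1)) := by
  have hMb0 : 0 ≤ 1 + ∑ k, |M k| := by positivity
  let P : Params :=
    { m := m, δ := δ, K := K, τ₀ := τ₀, c₀ := c₀, a := a, b := b, Mb := 1 + ∑ k, |M k|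
      one_le_m := by omega
      δ_pos := hδ₀
      δ_le := hδ₁
      K_pos := by linarith
      τ₀_pos := hτ₀
      c₀_pos := hc₀ }
  obtain ⟨N, -, HN⟩ := exists_accelerated_rate P d
  refine ⟨N, ?_⟩
  intro h₀ S τ f k l hh₀ _ _ ha hb _ hreg hf hchi hdrift hc h1 h2 hR
  have hMk : ∀ k, M k ^ 2 ≤ P.Mb ^ 2 := fun k => by
    have h3 : |M k| ≤ ∑ k, |M k| :=
      Finset.single_le_sum (f := fun k => |M k|) (fun _ _ => abs_nonneg _) (Finset.mem_univ k)
    have h4 : P.Mb = 1 + ∑ k, |M k| := rfl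
    rw [sq_le_sq, h4, abs_of_nonneg hMb0]
    linarith
  have hbd : ∀ α : Fin d → ℕ, len α ≤ m → ∀ᵐ x ∂(MeasureTheory.volume : MeasureTheory.Measure (E d)),
      ∑ lam ∈ S.dirs, weakDeriv α (S.q lam) x ^ 2 + ∑ lam ∈ S.dirs, weakDeriv α (S.p lam) x ^ 2
        + weakDeriv α S.c x ^ 2 ≤ P.Mb ^ 2 := by
    intro α hα
    have h3 := hreg.2.2 ⟨len α, Nat.lt_succ_of_le hα⟩
    filter_upwards [h3] with x hx
    rw [Finset.sum_add_distrib] at hx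
    refine le_trans ?_ (hx.trans (hMk _))
    exact add_le_add (add_le_add (Finset.sum_le_sum fun lam _ => gradSq_ge α _ x)
      (Finset.sum_le_sum fun lam _ => gradSq_ge α _ x)) (gradSq_ge α _ x)
  have hsum0 : ∀ (α : Fin d → ℕ) (g : E d → E d → ℝ) (x : E d),
      0 ≤ ∑ lam ∈ S.dirs, weakDeriv α (g lam) x ^ 2 := fun α g x =>
    Finset.sum_nonneg fun _ _ => sq_nonneg _
  have hS : RoughScheme P h₀ S τ :=
    { three_le_m := hm
      h₀_pos := hh₀
      q_mem := fun lam hl => (hreg.1 lam hl).1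
      p_mem := fun lam hl => (hreg.1 lam hl).2
      c_mem := hreg.2.1
      q_bd := fun α hα => by
        filter_upwards [hbd α hα] with x hx
        linarith [hsum0 α S.p x, sq_nonneg (weakDeriv α S.c x)]
      p_bd := fun α hα => by
        filter_upwards [hbd α hα] with x hx
        linarith [hsum0 α S.q x, sq_nonneg (weakDeriv α S.c x)]
      c_bd := fun α hα => by
        filter_upwards [hbd α hα] with x hx
        refine abs_le_of_sq_le_sq ?_ hMb0
        linarith [hsum0 α S.q x, hsum0 α S.p x]
      sum_sq := by
        change _ ≤ a ^ 2
        rw [← ha, dirsNorm, Real.sq_sqrt (Finset.sum_nonneg fun _ _ => by positivity)]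
      wsum_sq := by
        change _ ≤ b ^ 2
        rw [← hb, dirsWNorm, Real.sq_sqrt (Finset.sum_nonneg fun _ _ => by positivity)]
        refine le_of_eq (Finset.sum_congr rfl fun lam _ => ?_)
        rw [norm_smul, mul_pow, Real.norm_eq_abs, sq_abs]
      chi_nonneg := hchi
      drift := hdrift
      c_ge := hc
      cond1 := h1
      cond2 := h2 }
  obtain ⟨A, B, H⟩ := HN h₀ S τ f k l hS hf hR
  refine ⟨A, B, fun v v₀ hv hv₀ hv₀' => ?_⟩
  obtain ⟨H1, H2, H3, H4⟩ := H v v₀ hv hv₀ hv₀'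
  exact ⟨H1, H2, H3, fun hodd => H4 ⟨hodd.1, hodd.2.2⟩⟩
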